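/- Let $A(t)=\exp(tB)$ be a one-parameter subgroup of $\mathrm{GL}(n,\mathbb R)$ with $A(1)\in \mathrm{SL}(n,\mathbb Z)$, and let $G=\mathbb R^n\rtimes_A\mathbb R$ be the Lie group with group law $(x,s)(y,t)=(x+A(s)y,\,s+t)$. Assume that $G$ is exponential, i.e. that its exponential map is a diffeomorphism. Let $\Gamma=\mathbb Z^n\rtimes_A\mathbb Z\subset G$, let $\varepsilon:\Gamma\to\mathbb Z_2=\{0,1\}$ be a homomorphism, and put $\varepsilon'(k)=\varepsilon(k,0)$ for $k\in\mathbb Z^n$ and $\dot\varepsilon(l)=\varepsilon(0,l)$ for $l\in\mathbb Z$. Let $C(G,\varepsilon)$ be the space of continuous functions $\varphi:G\to\mathbb C$ with $\varphi(\gamma y)=e^{i\pi\varepsilon(\gamma)}\varphi(y)$ for all $\gamma\in\Gamma$, $y\in G$, and let $L^2(G,\varepsilon)$ be its completion for the norm $|\varphi|^2=\int_0^1\int_{[0,1]^n}|\varphi(x,s)|^2\,dx\,ds$. Let $\rho$ be the right regular representation of $G$ on $L^2(G,\varepsilon)$, $\rho(g)\varphi(y)=\varphi(yg)$. For $\xi\in\mathbb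 Z^n$ let $\widehat\varphi(\xi,t)=\int_{[0,1]^n}\varphi(2x,t)e^{-2\pi i\langle\xi,x\rangle}\,dx$; the map $\varphi\mapsto\widehat\varphi(\xi,\cdot)$ extends to a bounded operator from $L^2(G,\varepsilon)$ to $L^2([0,1])$. Let $$\Sigma_{\varepsilon'}=\{\xi\in\mathbb Z^n:\ \xi_\nu\in 2\mathbb Z+\varepsilon'(e_\nu)\text{ for }1\le\nu\le n\}.$$ The $\mathbb Z$-orbit and the $\mathbb R$-orbit of $\xi\in\mathbb R^n$ are $\{A(l)^\top\xi:l\in\mathbb Z\}$ and $\{A(t)^\top\xi:t\in\mathbb R\}$. Let $\mathbb Z\backslash\Sigma_{\varepsilon'}$ be the set of $\mathbb Z$-orbits contained in $\Sigma_{\varepsilon'}$. Let $X^0_{\varepsilon'}$ be the set of all $\omega=\{\xi\}$ where $\xi\in\Sigma_{\varepsilon'}$ satisfies $A(t)^\top\xi=\xi$ for all $t\in\mathbb R$, and let $X^\infty_{\varepsilon'}$ be the set of all $\mathbb R$-orbits which intersect $\Sigma_{\varepsilon'}$ and are not relatively compact. For $\theta\in\mathbb Z\backslash\Sigma_{\varepsilon'}$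 let $U_\theta$ be the closed subspace of all $\varphi\in L^2(G,\varepsilon)$ with $\widehat\varphi(\xi,\cdot)=0$ for all $\xi\in\mathbb Z^n\setminus\theta$. Finally put $$\chi_{\dot\varepsilon,\omega,m}(x,s)=e^{\pi i\langle\xi,x\rangle}\,e^{\pi i(2m+\dot\varepsilon(1))s}\quad(\omega=\{\xi\}\in X^0_{\varepsilon'},\ m\in\mathbb Z),$$ which are unitary characters of $G$, and for $\eta\in\mathbb R^n$ let $\rho_\eta$ be the unitary representation of $G$ on $L^2(\mathbb R)$ given by $$(\rho_\eta(x,s)\psi)(t)=e^{\pi i\langle A(t)^\top\eta,x\rangle}\,\psi(t+s).$$ Then the following hold. 1. $L^2(G,\varepsilon)$ is the orthogonal Hilbert sum of the subspaces $U_\theta$, $\theta\in\mathbb Z\backslash\Sigma_{\varepsilon'}$. These are $\rho(G)$-invariant, so that $\rho\cong\bigoplus_{\theta\in\mathbb Z\backslash\Sigma_{\varepsilon'}}\rho_\theta$ with $\rho_\theta=\rho|U_\theta$. 2. If $\theta\in\mathbb Z\backslash\Sigma_{\varepsilon'}$ consists of a single point fixed by all $A(t)^\top$, then $\rho_\theta\cong\bigoplus_{m\in\mathbb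 Z}\chi_{\dot\varepsilon,\theta,m}$. 3. If $\omega\in X^\infty_{\varepsilon'}$, $\theta\in\mathbb Z\backslash\Sigma_{\varepsilon'}$, $\theta\subset\omega$ and $\eta\in\omega$, then $\rho_\theta\cong\rho_\eta$. In particular the representations $\rho_\eta$, $\eta\in\omega$, are all unitarily equivalent; let $\rho_\omega$ denote their unitary equivalence class. The representations $\rho_\omega$ are irreducible. 4. For every $\omega\in X^\infty_{\varepsilon'}$ the number $m_{\varepsilon,\omega}$ of $\mathbb Z$-orbits contained in $\omega\cap\Sigma_{\varepsilon'}$ is finite, and $$\rho\;\cong\;\Big(\bigoplus_{\omega\in X^0_{\varepsilon'}}\bigoplus_{m\in\mathbb Z}\chi_{\dot\varepsilon,\omega,m}\Big)\oplus\Big(\bigoplus_{\omega\in X^\infty_{\varepsilon'}}m_{\varepsilon,\omega}\,\rho_\omega\Big).$$ 5. The representations $\chi_{\dot\varepsilon,\omega,m}$ ($\omega\in X^0_{\varepsilon'}$, $m\in\mathbb Z$) and $\rho_\omega$ ($\omega\in X^\infty_{\varepsilon'}$) are mutually inequivalent. -/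

import Mathlib

noncomputable section

namespace SemidirectModel

open MeasureTheory Matrix Complex
open scoped ENNReal

/-! ## Unitary representations -/

/-- A (strongly continuous) unitary representation of a topological group on a complex
Hilbert space. -/
structure UnitaryRep (G : Type) [Group G] [TopologicalSpace G] where
  space : Type
  [instNormed : NormedAddCommGroup space]
  [instInner : InnerProductSpace ℂ space]
  [instComplete : CompleteSpace space]
  op : G →* (space ≃ₗᵢ[ℂ] space)
  continuous_op : ∀ v : space, Continuous fun g => op g v

attribute [instance] UnitaryRep.instNormed UnitaryRep.instInner UnitaryRep.instComplete

namespace UnitaryRep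

variable {G : Type} [Group G] [TopologicalSpace G]

/-- Unitary equivalence. -/
def Equivalent (π σ : UnitaryRep G) : Prop :=
  ∃ T : π.space ≃ₗᵢ[ℂ] σ.space, ∀ (g : G) (v : π.space), T (π.op g v) = σ.op g (T v)

/-- Topological irreducibility. -/
def Irreducible (π : UnitaryRep G) : Prop :=
  Nontrivial π.space ∧
    ∀ W : Submodule ℂ π.space, IsClosed (W : Set π.space) →
      (∀ (g : G), ∀ v ∈ W, π.op g v ∈ W) → W = ⊥ ∨ W = ⊤

/-- The restriction of a unitary representation to a closed invariant subspace. -/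
def sub (π : UnitaryRep G) (W : Submodule ℂ π.space) (hW : IsClosed (W : Set π.space))
    (hinv : ∀ (g : G), ∀ v ∈ W, π.op g v ∈ W) : UnitaryRep G :=
  haveI : CompleteSpace W := hW.completeSpace_coe
  { space := W
    op :=
      { toFun := fun g =>
          { toFun := fun v => ⟨π.op g v, hinv g v v.2⟩
            invFun := fun v => ⟨π.op g⁻¹ v, hinv g⁻¹ v v.2⟩
            map_add' := fun v w => Subtype.ext (by simp)
            map_smul' := fun c v => Subtype.ext (by simp)
            left_inv := fun v => Subtype.ext (by
              change (π.op g⁻¹ * π.op g) v = v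
              rw [← map_mul]; simp)
            right_inv := fun v => Subtype.ext (by
              change (π.op g * π.op g⁻¹) v = v
              rw [← map_mul]; simp)
            norm_map' := fun v => (π.op g).norm_map v }
        map_one' := by ext v; simp
        map_mul' := fun g h => by ext v; simp }
    continuous_op := fun v => (π.continuous_op v).subtype_mk _ }

theorem sub_op_coe (π : UnitaryRep G) (W : Submodule ℂ π.space)
    (hW : IsClosed (W : Set π.space)) (hinv : ∀ (g : G), ∀ v ∈ W, π.op g v ∈ W) (g : G) (v : W) :
    (show W from (π.sub W hW hinv).op g v) = ⟨π.op g v, hinv g v v.2⟩ := rfl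

/-- A family of linear isometries is strongly continuous if it is so on a total set. -/
theorem continuous_of_total {X H K : Type} [TopologicalSpace X]
    [NormedAddCommGroup H] [NormedSpace ℂ H] [NormedAddCommGroup K] [NormedSpace ℂ K]
    (U : X → (H →ₗᵢ[ℂ] K)) (S : Set H)
    (hS : Dense (Submodule.span ℂ S : Set H)) (hc : ∀ v ∈ S, Continuous fun x => U x v) (v : H) :
    Continuous fun x => U x v := by
  have h1 : ∀ w ∈ Submodule.span ℂ S, Continuous fun x => U x w := by
    intro w hw
    induction hw using Submodule.span_induction with
    | mem w hw => exact hc w hw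
    | zero => simpa using continuous_const
    | add a b _ _ ha hb => simpa [Pi.add_def] using ha.add hb
    | smul c a _ ha => simpa [Pi.smul_def] using ha.const_smul c
  rw [continuous_iff_continuousAt]
  intro x
  rw [Metric.continuousAt_iff']
  intro e he
  obtain ⟨w, hw, hvw⟩ := Metric.dense_iff.1 hS v (e / 3) (by positivity)
  have h2 := Metric.continuousAt_iff'.1 ((h1 w hvw).continuousAt (x := x)) (e / 3) (by positivity)
  filter_upwards [h2] with y hy
  have h3 : ∀ z, dist (U z v) (U z w) < e / 3 := fun z => by
    rw [(U z).dist_map, dist_comm]; exact hw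
  calc dist (U y v) (U x v) ≤ dist (U y v) (U y w) + dist (U y w) (U x w) + dist (U x w) (U x v) :=
        dist_triangle4 _ _ _ _
    _ < e / 3 + e / 3 + e / 3 := by
        have := h3 y
        have h4 := h3 x
        rw [dist_comm] at h4
        linarith
    _ = e := by ring

/-- The unitary operator on a Hilbert direct sum acting componentwise. -/
def sumOp {ι : Type} (H : ι → Type) [∀ i, NormedAddCommGroup (H i)]
    [∀ i, InnerProductSpace ℂ (H i)] (U : ∀ i, H i ≃ₗᵢ[ℂ] H i) : lp H 2 ≃ₗᵢ[ℂ] lp H 2 where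
  toFun f := ⟨fun i => U i (f i), by
    refine (memℓp_gen_iff (by norm_num)).2 ?_
    simpa using (memℓp_gen_iff (by norm_num)).1 (lp.memℓp f)⟩
  invFun f := ⟨fun i => (U i).symm (f i), by
    refine (memℓp_gen_iff (by norm_num)).2 ?_
    simpa using (memℓp_gen_iff (by norm_num)).1 (lp.memℓp f)⟩
  map_add' f g := by ext i; simp; rfl
  map_smul' c f := by ext i; simp
  left_inv f := by ext i; simp
  right_inv f := by ext i; simp
  norm_map' f := by
    simp [lp.norm_eq_tsum_rpow]

theorem sumOp_apply {ι : Type} (H : ι → Type) [∀ i, NormedAddCommGroup (H i)]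
    [∀ i, InnerProductSpace ℂ (H i)] (U : ∀ i, H i ≃ₗᵢ[ℂ] H i) (f : lp H 2) (i : ι) :
    sumOp H U f i = U i (f i) := rfl

open Classical in
/-- The Hilbert direct sum of a family of unitary representations. -/
def directSum {ι : Type} (π : ι → UnitaryRep G) : UnitaryRep G where
  space := lp (fun i => (π i).space) 2
  op :=
    { toFun := fun g => sumOp (fun i => (π i).space) fun i => (π i).op g
      map_one' := by ext f i; simp [sumOp_apply]
      map_mul' := fun g h => by ext f i; simp [sumOp_apply] }
  continuous_op := by
    refine continuous_of_total
      (fun g => (sumOp (fun i => (π i).space) fun i => (π i).op g).toLinearIsometry)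
      {f | ∃ i v, f = lp.single 2 i v} ?_ ?_
    · intro f
      refine mem_closure_of_tendsto (lp.hasSum_single (by norm_num) f) (Filter.Eventually.of_forall ?_)
      exact fun s => Submodule.sum_mem _ fun i _ => Submodule.subset_span ⟨i, f i, rfl⟩
    · rintro _ ⟨i, v, rfl⟩
      have h : ∀ g, (sumOp (fun i => (π i).space) fun i => (π i).op g).toLinearIsometry
          (lp.single 2 i v) = lp.single 2 i ((π i).op g v) := by
        intro g
        ext j
        change (π j).op g (lp.single (E := fun i => (π i).space) 2 i v j) = _
        by_cases hj : j = i
        · subst hj; simp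
        · simp [hj]
      simp only [h]
      exact (lp.isometry_single (E := fun i => (π i).space) (p := 2) i).continuous.comp
        ((π i).continuous_op v)

end UnitaryRep

/-! ## The groups -/

/-- The one-parameter group `A(t) = exp(tB)`. -/
def oneParam {n : ℕ} (B : Matrix (Fin n) (Fin n) ℝ) (t : ℝ) : Matrix (Fin n) (Fin n) ℝ :=
  NormedSpace.exp (t • B)

/-- A one-parameter group `A(t) = exp(tB)` of `GL(n, ℝ)` with `A(1) ∈ SL(n, ℤ)`. -/
structure Data (n : ℕ) where
  B : Matrix (Fin n) (Fin n) ℝ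
  integral : ∃ M : Matrix.SpecialLinearGroup (Fin n) ℤ,
    oneParam B 1 = (M : Matrix (Fin n) (Fin n) ℤ).map (fun k : ℤ => (k : ℝ))

section oneParam

variable {n : ℕ} (B : Matrix (Fin n) (Fin n) ℝ)

theorem oneParam_zero : oneParam B 0 = 1 := by simp [oneParam]

theorem oneParam_add (s t : ℝ) : oneParam B (s + t) = oneParam B s * oneParam B t := by
  rw [oneParam, add_smul, Matrix.exp_add_of_commute]
  · rfl
  · exact ((Commute.refl B).smul_left s).smul_right t

theorem oneParam_neg_mul (t : ℝ) : oneParam B (-t) * oneParam B t = 1 := by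
  rw [← oneParam_add, neg_add_cancel, oneParam_zero]

open scoped Matrix.Norms.Operator in
theorem hasDerivAt_oneParam (t : ℝ) : HasDerivAt (oneParam B) (oneParam B t * B) t :=
  hasDerivAt_exp_smul_const B t

theorem continuous_oneParam : Continuous (oneParam B) := by
  open scoped Matrix.Norms.Operator in
  exact continuous_iff_continuousAt.2 fun t => (hasDerivAt_oneParam B t).continuousAt

end oneParam

namespace Data

variable {n : ℕ} (D : Data n)

/-- `A(t)`. -/
def A (t : ℝ) : Matrix (Fin n) (Fin n) ℝ := oneParam D.B t

theorem A_zero : D.A 0 = 1 := oneParam_zero D.B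

theorem A_add (s t : ℝ) : D.A (s + t) = D.A s * D.A t := oneParam_add D.B s t

theorem continuous_A : Continuous D.A := continuous_oneParam D.B

/-- The underlying space of the group `G = ℝⁿ ⋊_A ℝ`. -/
def Grp (_D : Data n) : Type := (Fin n → ℝ) × ℝ

variable {D}

/-- The element `(x, s)` of `G`. -/
def Grp.mk (x : Fin n → ℝ) (s : ℝ) : D.Grp := (x, s)

/-- The component of an element of `G` in `ℝⁿ`. -/
def Grp.vec (g : D.Grp) : Fin n → ℝ := Prod.fst g

/-- The component of an element of `G` in `ℝ`. -/
def Grp.time (g : D.Grp) : ℝ := Prod.snd g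

@[simp] theorem Grp.vec_mk (x : Fin n → ℝ) (s : ℝ) : (Grp.mk x s : D.Grp).vec = x := rfl
@[simp] theorem Grp.time_mk (x : Fin n → ℝ) (s : ℝ) : (Grp.mk x s : D.Grp).time = s := rfl
@[simp] theorem Grp.mk_eta (g : D.Grp) : Grp.mk g.vec g.time = g := rfl

@[ext] theorem Grp.ext {g h : D.Grp} (h1 : g.vec = h.vec) (h2 : g.time = h.time) : g = h :=
  Prod.ext h1 h2

instance : TopologicalSpace D.Grp := inferInstanceAs (TopologicalSpace ((Fin n → ℝ) × ℝ))
instance : MeasurableSpace D.Grp := inferInstanceAs (MeasurableSpace ((Fin n → ℝ) × ℝ))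
instance : BorelSpace D.Grp := inferInstanceAs (BorelSpace ((Fin n → ℝ) × ℝ))
instance : SecondCountableTopology D.Grp :=
  inferInstanceAs (SecondCountableTopology ((Fin n → ℝ) × ℝ))
instance : T2Space D.Grp := inferInstanceAs (T2Space ((Fin n → ℝ) × ℝ))
instance : LocallyCompactSpace D.Grp := inferInstanceAs (LocallyCompactSpace ((Fin n → ℝ) × ℝ))
instance : PolishSpace D.Grp := inferInstanceAs (PolishSpace ((Fin n → ℝ) × ℝ))
/-- Lebesgue measure on `G`, regarded as `ℝⁿ × ℝ`. -/
instance : MeasureSpace D.Grp := inferInstanceAs (MeasureSpace ((Fin n → ℝ) × ℝ))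
instance : SFinite (volume : Measure D.Grp) :=
  inferInstanceAs (SFinite (volume : Measure ((Fin n → ℝ) × ℝ)))
instance : IsLocallyFiniteMeasure (volume : Measure D.Grp) :=
  inferInstanceAs (IsLocallyFiniteMeasure (volume : Measure ((Fin n → ℝ) × ℝ)))
instance : (volume : Measure D.Grp).IsOpenPosMeasure :=
  inferInstanceAs ((volume : Measure ((Fin n → ℝ) × ℝ)).IsOpenPosMeasure)

@[fun_prop] theorem Grp.continuous_vec : Continuous (Grp.vec : D.Grp → _) := continuous_fst
@[fun_prop] theorem Grp.continuous_time : Continuous (Grp.time : D.Grp → _) := continuous_snd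
@[fun_prop] theorem Grp.continuous_mk {X : Type} [TopologicalSpace X] {f : X → Fin n → ℝ}
    {g : X → ℝ} (hf : Continuous f) (hg : Continuous g) :
    Continuous fun x => (Grp.mk (f x) (g x) : D.Grp) := hf.prodMk hg

/-- The group law `(x, s)(y, t) = (x + A(s)y, s + t)`. -/
instance : Group D.Grp where
  mul g h := Grp.mk (g.vec + D.A g.time *ᵥ h.vec) (g.time + h.time)
  one := Grp.mk 0 0
  inv g := Grp.mk (-(D.A (-g.time) *ᵥ g.vec)) (-g.time)
  mul_assoc g h k := by
    refine Grp.ext ?_ (add_assoc _ _ _)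
    change g.vec + D.A g.time *ᵥ h.vec + D.A (g.time + h.time) *ᵥ k.vec =
      g.vec + D.A g.time *ᵥ (h.vec + D.A h.time *ᵥ k.vec)
    rw [Matrix.mulVec_add, A_add, Matrix.mulVec_mulVec, add_assoc]
  one_mul g := by
    refine Grp.ext ?_ (zero_add _)
    change 0 + D.A 0 *ᵥ g.vec = g.vec
    rw [A_zero, Matrix.one_mulVec, zero_add]
  mul_one g := by
    refine Grp.ext ?_ (add_zero _)
    change g.vec + D.A g.time *ᵥ 0 = g.vec
    rw [Matrix.mulVec_zero, add_zero]
  inv_mul_cancel g := by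
    refine Grp.ext ?_ (neg_add_cancel _)
    change -(D.A (-g.time) *ᵥ g.vec) + D.A (-g.time) *ᵥ g.vec = 0
    exact neg_add_cancel _

@[simp] theorem Grp.vec_mul (g h : D.Grp) : (g * h).vec = g.vec + D.A g.time *ᵥ h.vec := rfl
@[simp] theorem Grp.time_mul (g h : D.Grp) : (g * h).time = g.time + h.time := rfl
@[simp] theorem Grp.vec_one : (1 : D.Grp).vec = 0 := rfl
@[simp] theorem Grp.time_one : (1 : D.Grp).time = 0 := rfl
@[simp] theorem Grp.vec_inv (g : D.Grp) : (g⁻¹).vec = -(D.A (-g.time) *ᵥ g.vec) := rfl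
@[simp] theorem Grp.time_inv (g : D.Grp) : (g⁻¹).time = -g.time := rfl

instance : ContinuousMul D.Grp where
  continuous_mul := by
    have hA := D.continuous_A
    have h : Continuous fun p : D.Grp × D.Grp => D.A p.1.time := by fun_prop
    exact Grp.continuous_mk ((Grp.continuous_vec.comp continuous_fst).add
      (h.matrix_mulVec (Grp.continuous_vec.comp continuous_snd)))
      ((Grp.continuous_time.comp continuous_fst).add (Grp.continuous_time.comp continuous_snd))

variable (D)

/-! ### The exponential map -/

/-- The exponential map of `G`, on the Lie algebra `ℝⁿ × ℝ` (the tangent space at the identity):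
`exp(v, s) = (∫₀¹ A(rs)v dr, s)`. The two theorems below show that `r ↦ exp(rX)` is the
one-parameter subgroup with initial velocity `X`. -/
def expMap (X : (Fin n → ℝ) × ℝ) : D.Grp :=
  Grp.mk (∫ r in (0 : ℝ)..1, D.A (r * X.2) *ᵥ X.1) X.2

theorem continuous_A_mulVec (s : ℝ) (v : Fin n → ℝ) : Continuous fun r : ℝ => D.A (r * s) *ᵥ v :=
  (D.continuous_A.comp (by fun_prop)).matrix_mulVec continuous_const

theorem expMap_smul_vec (X : (Fin n → ℝ) × ℝ) (r : ℝ) :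
    (D.expMap (r • X)).vec = ∫ u in (0 : ℝ)..r, D.A (u * X.2) *ᵥ X.1 := by
  have h := intervalIntegral.smul_integral_comp_mul_right
    (fun u => D.A (u * X.2) *ᵥ X.1) r (a := 0) (b := 1)
  rw [zero_mul, one_mul] at h
  rw [← h, ← intervalIntegral.integral_smul]
  simp only [expMap, Grp.vec_mk, Prod.smul_fst, Prod.smul_snd, Matrix.mulVec_smul, smul_eq_mul,
    mul_assoc]

theorem expMap_add_smul (X : (Fin n → ℝ) × ℝ) (r r' : ℝ) :
    D.expMap ((r + r') • X) = D.expMap (r • X) * D.expMap (r' • X) := by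
  have hc := D.continuous_A_mulVec X.2 X.1
  refine Grp.ext ?_ (by simp [expMap, add_mul])
  rw [Grp.vec_mul, expMap_smul_vec, expMap_smul_vec, expMap_smul_vec,
    ← intervalIntegral.integral_add_adjacent_intervals (hc.intervalIntegrable 0 r)
      (hc.intervalIntegrable r (r + r'))]
  congr 1
  have h1 := intervalIntegral.integral_comp_add_left (fun u => D.A (u * X.2) *ᵥ X.1) r
    (a := 0) (b := r')
  rw [add_zero] at h1
  rw [← h1]
  have h2 := ((Matrix.mulVecLin (D.A (r * X.2))).toContinuousLinearMap).intervalIntegral_comp_comm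
    (hc.intervalIntegrable (μ := volume) 0 r')
  simp only [LinearMap.coe_toContinuousLinearMap', Matrix.mulVecLin_apply] at h2
  have h3 : (D.expMap (r • X)).time = r * X.2 := by simp [expMap]
  rw [h3, ← h2]
  simp only [add_mul, A_add, Matrix.mulVec_mulVec]

theorem hasDerivAt_expMap_smul (X : (Fin n → ℝ) × ℝ) :
    HasDerivAt (fun r : ℝ => ((D.expMap (r • X)).vec, (D.expMap (r • X)).time)) X 0 := by
  have hc := D.continuous_A_mulVec X.2 X.1
  refine HasDerivAt.prodMk (f₂' := X.2) ?_ ?_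
  · simp only [expMap_smul_vec]
    have h2 := intervalIntegral.integral_hasDerivAt_right (hc.intervalIntegrable 0 0)
      (hc.stronglyMeasurableAtFilter _ _) hc.continuousAt
    simpa [A_zero] using h2
  · simpa [expMap] using (hasDerivAt_id (0 : ℝ)).mul_const X.2

/-- `G` is an exponential Lie group: the exponential map is a diffeomorphism of the Lie algebra
onto `G`. -/
def IsExponential : Prop :=
  ∃ L : D.Grp → (Fin n → ℝ) × ℝ, Function.LeftInverse L D.expMap ∧
    Function.RightInverse L D.expMap ∧
    ContDiff ℝ (⊤ : ℕ∞) (fun X : (Fin n → ℝ) × ℝ => ((D.expMap X).vec, (D.expMap X).time)) ∧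
    ContDiff ℝ (⊤ : ℕ∞) (fun p : (Fin n → ℝ) × ℝ => L (Grp.mk p.1 p.2))

/-! ### The lattice -/

theorem A_int (l : ℤ) : ∃ M : Matrix.SpecialLinearGroup (Fin n) ℤ,
    D.A l = (M : Matrix (Fin n) (Fin n) ℤ).map (fun k : ℤ => (k : ℝ)) := by
  obtain ⟨M, hM⟩ := D.integral
  have hnat : ∀ k : ℕ, ∃ M : Matrix.SpecialLinearGroup (Fin n) ℤ,
      D.A k = (M : Matrix (Fin n) (Fin n) ℤ).map (fun k : ℤ => (k : ℝ)) := by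
    intro k
    induction k with
    | zero => exact ⟨1, by simp [A_zero]⟩
    | succ k ih =>
      obtain ⟨N, hN⟩ := ih
      refine ⟨N * M, ?_⟩
      push_cast
      rw [A_add, hN]
      change _ * oneParam D.B 1 = _
      rw [hM, Matrix.SpecialLinearGroup.coe_mul]
      exact (Matrix.map_mul (f := Int.castRingHom ℝ)).symm
  obtain ⟨k, rfl | rfl⟩ := l.eq_nat_or_neg
  · simpa using hnat k
  · obtain ⟨N, hN⟩ := hnat k
    refine ⟨N⁻¹, ?_⟩
    have h1 : D.A (-(k : ℝ)) * D.A k = 1 := oneParam_neg_mul D.B _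
    have h2 : D.A k * (((N⁻¹ : Matrix.SpecialLinearGroup (Fin n) ℤ) :
        Matrix (Fin n) (Fin n) ℤ).map (fun k : ℤ => (k : ℝ))) = 1 := by
      rw [hN]
      refine (Matrix.map_mul (f := Int.castRingHom ℝ)).symm.trans ?_
      rw [← Matrix.SpecialLinearGroup.coe_mul, mul_inv_cancel]
      simp
    push_cast
    exact left_inv_eq_right_inv h1 h2

theorem exists_A_int_mulVec (l : ℤ) (k : Fin n → ℤ) :
    ∃ k' : Fin n → ℤ, D.A l *ᵥ (fun i => (k i : ℝ)) = fun i => (k' i : ℝ) := by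
  obtain ⟨M, hM⟩ := D.A_int l
  refine ⟨(M : Matrix (Fin n) (Fin n) ℤ) *ᵥ k, ?_⟩
  rw [hM]
  ext i
  simp [Matrix.mulVec, dotProduct]

/-- The subgroup `Γ = ℤⁿ ⋊_A ℤ` of `G`. -/
def Gam : Subgroup D.Grp where
  carrier := {g | ∃ (k : Fin n → ℤ) (l : ℤ), g = Grp.mk (fun i => (k i : ℝ)) (l : ℝ)}
  mul_mem' := by
    rintro _ _ ⟨k, l, rfl⟩ ⟨k', l', rfl⟩
    obtain ⟨k'', h⟩ := D.exists_A_int_mulVec l k'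
    refine ⟨k + k'', l + l', Grp.ext ?_ (by simp)⟩
    rw [Grp.vec_mul, Grp.vec_mk, Grp.vec_mk, Grp.time_mk, h]
    ext i; simp
  one_mem' := ⟨0, 0, Grp.ext (by ext i; simp) (by simp)⟩
  inv_mem' := by
    rintro _ ⟨k, l, rfl⟩
    obtain ⟨k'', h⟩ := D.exists_A_int_mulVec (-l) k
    refine ⟨-k'', -l, Grp.ext ?_ (by simp)⟩
    push_cast at h
    rw [Grp.vec_inv, Grp.vec_mk, Grp.time_mk, h]
    ext i; simp

/-- The element `(k, l)` of `Γ`. -/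
def gam (k : Fin n → ℤ) (l : ℤ) : D.Gam := ⟨Grp.mk (fun i => (k i : ℝ)) (l : ℝ), k, l, rfl⟩

/-! ### The space `L²(G, ε)` and the right regular representation -/

/-- The unitary character `e^{iπε}` of `Γ`. -/
def sign (ε : D.Gam →* Multiplicative (ZMod 2)) (γ : D.Gam) : ℂ :=
  Complex.exp (I * Real.pi * (((ε γ).toAdd.val : ℕ) : ℂ))

theorem norm_sign (ε : D.Gam →* Multiplicative (ZMod 2)) (γ : D.Gam) : ‖D.sign ε γ‖ = 1 := by
  have : I * Real.pi * (((ε γ).toAdd.val : ℕ) : ℂ) =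
      ((Real.pi * ((ε γ).toAdd.val : ℕ) : ℝ) : ℂ) * I := by push_cast; ring
  rw [sign, this, Complex.norm_exp_ofReal_mul_I]

/-- The space `C(G, ε)` as a subspace of the space of all functions. -/
def CSub (ε : D.Gam →* Multiplicative (ZMod 2)) : Submodule ℂ (D.Grp → ℂ) where
  carrier := {φ | Continuous φ ∧ ∀ (γ : D.Gam) (y : D.Grp), φ (γ * y) = D.sign ε γ * φ y}
  add_mem' := fun ⟨h1, h2⟩ ⟨h3, h4⟩ =>
    ⟨h1.add h3, fun γ y => by simp only [Pi.add_apply, h2, h4]; ring⟩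
  zero_mem' := ⟨continuous_const, fun _ _ => by simp⟩
  smul_mem' := fun c _ ⟨h1, h2⟩ =>
    ⟨h1.const_smul c, fun γ y => by simp only [Pi.smul_apply, h2, smul_eq_mul]; ring⟩

/-- The space `C(G, ε)` of continuous functions `φ` on `G` such that
`φ(γy) = e^{iπε(γ)} φ(y)` for all `γ ∈ Γ`, `y ∈ G`. -/
def CSpace (ε : D.Gam →* Multiplicative (ZMod 2)) : Type := D.CSub ε

variable (ε : D.Gam →* Multiplicative (ZMod 2))

instance : AddCommGroup (D.CSpace ε) := inferInstanceAs (AddCommGroup (D.CSub ε))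
instance : Module ℂ (D.CSpace ε) := inferInstanceAs (Module ℂ (D.CSub ε))
instance : CoeFun (D.CSpace ε) (fun _ => D.Grp → ℂ) := ⟨fun φ => φ.1⟩

variable {D} {ε}

theorem CSpace.continuous (φ : D.CSpace ε) : Continuous φ := φ.2.1
theorem CSpace.equivariant (φ : D.CSpace ε) (γ : D.Gam) (y : D.Grp) :
    φ (γ * y) = D.sign ε γ * φ y := φ.2.2 γ y
@[simp] theorem CSpace.add_apply (φ ψ : D.CSpace ε) (y : D.Grp) : (φ + ψ) y = φ y + ψ y := rfl
@[simp] theorem CSpace.zero_apply (y : D.Grp) : (0 : D.CSpace ε) y = 0 := rfl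
@[simp] theorem CSpace.smul_apply (c : ℂ) (φ : D.CSpace ε) (y : D.Grp) : (c • φ) y = c * φ y := rfl
@[ext] theorem CSpace.ext {φ ψ : D.CSpace ε} (h : ∀ y, φ y = ψ y) : φ = ψ :=
  Subtype.ext (funext h)

variable (D)

/-- The unit cube `[0,1]ⁿ × [0,1]` in `G`. -/
def box : Set D.Grp := {g | (∀ i, g.vec i ∈ Set.Icc (0 : ℝ) 1) ∧ g.time ∈ Set.Icc (0 : ℝ) 1}

/-- The half-open unit cube. -/
def hbox : Set D.Grp := {g | (∀ i, g.vec i ∈ Set.Ico (0 : ℝ) 1) ∧ g.time ∈ Set.Ico (0 : ℝ) 1}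

theorem box_eq : D.box = ((Set.univ.pi fun _ => Set.Icc (0 : ℝ) 1) ×ˢ Set.Icc (0 : ℝ) 1 :
    Set ((Fin n → ℝ) × ℝ)) := by
  exact Set.ext fun g => ⟨fun h => ⟨fun i _ => h.1 i, h.2⟩, fun h => ⟨fun i => h.1 i trivial, h.2⟩⟩

theorem hbox_eq : D.hbox = ((Set.univ.pi fun _ => Set.Ico (0 : ℝ) 1) ×ˢ Set.Ico (0 : ℝ) 1 :
    Set ((Fin n → ℝ) × ℝ)) := by
  exact Set.ext fun g => ⟨fun h => ⟨fun i _ => h.1 i, h.2⟩, fun h => ⟨fun i => h.1 i trivial, h.2⟩⟩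

theorem isCompact_box : IsCompact D.box := by
  rw [box_eq]
  exact (isCompact_univ_pi fun _ => isCompact_Icc).prod isCompact_Icc

theorem measurableSet_hbox : MeasurableSet D.hbox := by
  rw [hbox_eq]
  exact (MeasurableSet.univ_pi fun _ => measurableSet_Ico).prod measurableSet_Ico

theorem hbox_ae_eq : D.hbox =ᵐ[volume] D.box := by
  rw [hbox_eq, box_eq]
  refine Measure.set_prod_ae_eq ?_ Ico_ae_eq_Icc
  have h := Measure.univ_pi_Ico_ae_eq_Icc (μ := fun _ : Fin n => (volume : Measure ℝ))
    (f := 0) (g := 1)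
  rw [← Set.pi_univ_Icc] at h
  exact h

theorem exists_unique_mem_hbox (p : D.Grp) : ∃! γ : D.Gam, (γ : D.Grp) * p ∈ D.hbox := by
  have key : ∀ (k : Fin n → ℤ) (l : ℤ), (D.gam k l : D.Grp) * p ∈ D.hbox ↔
      l = -⌊p.time⌋ ∧ ∀ i, k i = -⌊(D.A l *ᵥ p.vec) i⌋ := by
    intro k l
    have h : ∀ (a : ℤ) (x : ℝ), (a : ℝ) + x ∈ Set.Ico (0 : ℝ) 1 ↔ a = -⌊x⌋ := by
      intro a x
      rw [eq_neg_iff_add_eq_zero, add_comm a, ← eq_neg_iff_add_eq_zero, Int.floor_eq_iff]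
      push_cast
      constructor
      · rintro ⟨h1, h2⟩; constructor <;> linarith
      · rintro ⟨h1, h2⟩; constructor <;> linarith
    rw [← h l, and_comm]
    simp_rw [← h]
    rfl
  refine ⟨D.gam (fun i => -⌊(D.A ((-⌊p.time⌋ : ℤ) : ℝ) *ᵥ p.vec) i⌋) (-⌊p.time⌋),
    (key _ _).2 ⟨rfl, fun i => rfl⟩, ?_⟩
  rintro ⟨_, k, l, rfl⟩ hγ
  obtain ⟨rfl, hk⟩ := (key k l).1 hγ
  refine Subtype.ext (Grp.ext ?_ rfl)
  ext i
  change ((k i : ℤ) : ℝ) = _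
  rw [hk i]; rfl

instance : Countable D.Gam := by
  have : Function.Surjective (fun p : (Fin n → ℤ) × ℤ => D.gam p.1 p.2) := by
    rintro ⟨_, k, l, rfl⟩; exact ⟨(k, l), rfl⟩
  exact this.countable

theorem det_A_int (l : ℤ) : (D.A l).det = 1 := by
  obtain ⟨M, hM⟩ := D.A_int l
  rw [hM]
  have := (Int.castRingHom ℝ).map_det (M : Matrix (Fin n) (Fin n) ℤ)
  rw [M.det_coe, map_one] at this
  exact this.symm

theorem measurePreserving_mul_left (γ : D.Gam) :
    MeasurePreserving (fun p : D.Grp => (γ : D.Grp) * p) volume volume := by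
  obtain ⟨_, k, l, rfl⟩ := γ
  have h1 : MeasurePreserving (fun x : Fin n → ℝ => (fun i => (k i : ℝ)) + D.A l *ᵥ x)
      volume volume := by
    refine (measurePreserving_add_left volume (fun i => (k i : ℝ))).comp ⟨?_, ?_⟩
    · exact (continuous_const.matrix_mulVec continuous_id).measurable
    · have := Real.map_matrix_volume_pi_eq_smul_volume_pi (M := D.A l) (by simp [det_A_int])
      rw [det_A_int, inv_one, abs_one, ENNReal.ofReal_one, one_smul] at this
      exact this
  exact h1.prod (measurePreserving_add_left volume (l : ℝ))

theorem measurePreserving_mul_right (g : D.Grp) :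
    MeasurePreserving (fun p : D.Grp => p * g) volume volume := by
  have h : MeasurePreserving (fun q : ℝ × (Fin n → ℝ) =>
      (q.1 + g.time, q.2 + D.A q.1 *ᵥ g.vec)) (volume.prod volume) (volume.prod volume) := by
    refine MeasurePreserving.skew_product (g := fun t x => x + D.A t *ᵥ g.vec)
      (measurePreserving_add_right volume g.time) ?_ ?_
    · refine Continuous.measurable ?_
      exact continuous_snd.add ((D.continuous_A.comp continuous_fst).matrix_mulVec continuous_const)
    · exact Filter.Eventually.of_forall fun t => (measurePreserving_add_right volume _).map_eq
  exact (Measure.measurePreserving_swap.comp h).comp Measure.measurePreserving_swap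

theorem measurableEmbedding_mul_right (g : D.Grp) :
    MeasurableEmbedding (fun p : D.Grp => p * g) := by
  refine Continuous.measurableEmbedding (continuous_mul_const g) (mul_left_injective g)

/-- Right translations preserve the integral of `Γ`-invariant functions over the unit cube. -/
theorem setLIntegral_box_mul_right (h : D.Grp → ℝ≥0∞) (hinv : ∀ (γ : D.Gam) p, h (γ * p) = h p)
    (g : D.Grp) : ∫⁻ p in D.box, h (p * g) = ∫⁻ p in D.box, h p := by
  have : SMulInvariantMeasure D.Gam D.Grp volume :=
    ⟨fun γ s hs => (D.measurePreserving_mul_left γ).measure_preimage hs.nullMeasurableSet⟩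
  have : MeasurableConstSMul D.Gam D.Grp :=
    ⟨fun γ => (D.measurePreserving_mul_left γ).measurable⟩
  have f1 : IsFundamentalDomain D.Gam D.hbox volume :=
    IsFundamentalDomain.mk' D.measurableSet_hbox.nullMeasurableSet D.exists_unique_mem_hbox
  have f2 : IsFundamentalDomain D.Gam ((fun p : D.Grp => p * g⁻¹) ⁻¹' D.hbox) volume := by
    refine IsFundamentalDomain.mk'
      ((D.measurePreserving_mul_right _).measurable D.measurableSet_hbox).nullMeasurableSet ?_
    intro p
    have := D.exists_unique_mem_hbox (p * g⁻¹)
    simp only [← mul_assoc] at this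
    exact this
  have h1 := f1.setLIntegral_eq f2 h hinv
  have h2 := (D.measurePreserving_mul_right g).setLIntegral_comp_preimage_emb
    (D.measurableEmbedding_mul_right g) h ((fun p : D.Grp => p * g⁻¹) ⁻¹' D.hbox)
  have h3 : (fun p : D.Grp => p * g) ⁻¹' ((fun p : D.Grp => p * g⁻¹) ⁻¹' D.hbox) = D.hbox := by
    ext p; simp
  rw [h3] at h2
  rw [← setLIntegral_congr D.hbox_ae_eq, ← setLIntegral_congr D.hbox_ae_eq, h2, h1]

variable {D}

theorem CSpace.norm_equivariant (φ : D.CSpace ε) (γ : D.Gam) (y : D.Grp) :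
    ‖φ (γ * y)‖ = ‖φ y‖ := by
  rw [φ.equivariant, norm_mul, norm_sign, one_mul]

theorem CSpace.integrableOn (φ ψ : D.CSpace ε) :
    IntegrableOn (fun p => starRingEnd ℂ (φ p) * ψ p) D.box :=
  (((Complex.continuous_conj.comp φ.continuous).mul ψ.continuous).continuousOn).integrableOn_compact
    D.isCompact_box

theorem CSpace.integrableOn_sq (φ : D.CSpace ε) : IntegrableOn (fun p => ‖φ p‖ ^ 2) D.box :=
  ((φ.continuous.norm.pow 2).continuousOn).integrableOn_compact D.isCompact_box

theorem CSpace.inner_self (φ : D.CSpace ε) :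
    ∫ p in D.box, starRingEnd ℂ (φ p) * φ p = ((∫ p in D.box, ‖φ p‖ ^ 2 : ℝ) : ℂ) := by
  rw [← integral_complex_ofReal]
  congr 1; ext p
  rw [Complex.conj_mul']; push_cast; rfl

theorem CSpace.eq_zero_of_integral (φ : D.CSpace ε) (h : ∫ p in D.box, ‖φ p‖ ^ 2 = 0) : φ = 0 := by
  have h1 : (fun p => ‖φ p‖ ^ 2) =ᵐ[volume.restrict D.box] 0 :=
    (integral_eq_zero_iff_of_nonneg (fun p => by positivity) φ.integrableOn_sq).1 h
  have hint : D.box ⊆ closure (interior D.box) := by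
    rw [box_eq]
    change (_ : Set ((Fin n → ℝ) × ℝ)) ⊆ closure (interior (_ : Set ((Fin n → ℝ) × ℝ)))
    intro p hp
    rw [interior_prod_eq, closure_prod_eq, interior_pi_set Set.finite_univ, closure_pi_set]
    refine ⟨fun i _ => ?_, ?_⟩
    · rw [interior_Icc, closure_Ioo (by norm_num)]; exact hp.1 i trivial
    · rw [interior_Icc, closure_Ioo (by norm_num)]; exact hp.2
  have h2 := Measure.eqOn_of_ae_eq h1 (φ.continuous.norm.pow 2).continuousOn
    continuousOn_const hint
  ext p
  obtain ⟨γ, hγ, -⟩ := D.exists_unique_mem_hbox p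
  have h3 : (γ : D.Grp) * p ∈ D.box :=
    ⟨fun i => Set.Ico_subset_Icc_self (hγ.1 i), Set.Ico_subset_Icc_self hγ.2⟩
  have h4 := h2 h3
  simp only [CSpace.norm_equivariant, Pi.zero_apply] at h4
  simpa using h4

variable (D) (ε)

/-- The inner product `⟨φ, ψ⟩ = ∫_{Γ\G} φ̄ ψ dμ` on `C(G, ε)`, where `μ` is the normalised
invariant measure, which is given by integration over the unit cube. -/
instance : InnerProductSpace.Core ℂ (D.CSpace ε) where
  inner φ ψ := ∫ p in D.box, starRingEnd ℂ (φ p) * ψ p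
  conj_inner_symm φ ψ := by
    rw [← integral_conj]
    congr 1; ext p; simp [mul_comm]
  re_inner_nonneg φ := by
    rw [CSpace.inner_self]
    simp only [RCLike.re_to_complex, Complex.ofReal_re]
    exact integral_nonneg fun p => by positivity
  add_left φ ψ χ := by
    rw [← integral_add (φ.integrableOn χ) (ψ.integrableOn χ)]
    congr 1; ext p; simp [add_mul]
  smul_left φ ψ c := by
    rw [← integral_const_mul]
    congr 1; ext p; simp [mul_assoc]
  definite φ h := by
    rw [CSpace.inner_self] at h
    exact φ.eq_zero_of_integral (Complex.ofReal_injective (by simpa using h))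

instance : NormedAddCommGroup (D.CSpace ε) :=
  InnerProductSpace.Core.toNormedAddCommGroup (𝕜 := ℂ)

instance : InnerProductSpace ℂ (D.CSpace ε) := InnerProductSpace.ofCore inferInstance

variable {D ε}

theorem CSpace.norm_sq (φ : D.CSpace ε) : ‖φ‖ ^ 2 = ∫ p in D.box, ‖φ p‖ ^ 2 := by
  have h : (inner ℂ φ φ : ℂ) = ∫ p in D.box, starRingEnd ℂ (φ p) * φ p := rfl
  rw [CSpace.inner_self, inner_self_eq_norm_sq_to_K] at h
  refine Complex.ofReal_injective (Eq.trans ?_ h)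
  simp

theorem CSpace.enorm_sq (φ : D.CSpace ε) :
    ENNReal.ofReal (‖φ‖ ^ 2) = ∫⁻ p in D.box, ‖φ p‖ₑ ^ 2 := by
  rw [φ.norm_sq, ofReal_integral_eq_lintegral_ofReal φ.integrableOn_sq
    (Filter.Eventually.of_forall fun p => by positivity)]
  congr 1; ext p
  rw [ENNReal.ofReal_pow (norm_nonneg _), ofReal_norm]

/-- Right translation `ρ(g)φ(y) = φ(yg)` on `C(G, ε)`. -/
def CSpace.trans (g : D.Grp) (φ : D.CSpace ε) : D.CSpace ε :=
  ⟨fun y => φ (y * g), φ.continuous.comp (continuous_mul_const g),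
    fun γ _ => (congrArg φ.1 (mul_assoc _ _ _)).trans (φ.equivariant γ _)⟩

@[simp] theorem CSpace.trans_apply (g : D.Grp) (φ : D.CSpace ε) (y : D.Grp) :
    CSpace.trans g φ y = φ (y * g) := rfl

theorem CSpace.norm_trans (g : D.Grp) (φ : D.CSpace ε) : ‖CSpace.trans g φ‖ = ‖φ‖ := by
  have h : ENNReal.ofReal (‖CSpace.trans g φ‖ ^ 2) = ENNReal.ofReal (‖φ‖ ^ 2) := by
    rw [CSpace.enorm_sq, CSpace.enorm_sq]
    refine D.setLIntegral_box_mul_right (fun p => ‖φ p‖ₑ ^ 2) (fun γ p => ?_) g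
    rw [← ofReal_norm, ← ofReal_norm, φ.norm_equivariant]
  rw [ENNReal.ofReal_eq_ofReal_iff (by positivity) (by positivity)] at h
  exact (pow_left_inj₀ (norm_nonneg _) (norm_nonneg _) two_ne_zero).1 h

/-- Right translation as a linear isometry of `C(G, ε)`. -/
def CSpace.transₗᵢ (g : D.Grp) : D.CSpace ε →ₗᵢ[ℂ] D.CSpace ε where
  toFun := CSpace.trans g
  map_add' _ _ := rfl
  map_smul' _ _ := rfl
  norm_map' := CSpace.norm_trans g

theorem CSpace.continuous_trans (φ : D.CSpace ε) : Continuous fun g => CSpace.trans g φ := by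
  rw [continuous_iff_continuousAt]
  intro g
  rw [ContinuousAt, tendsto_iff_norm_sub_tendsto_zero]
  have h1 : Filter.Tendsto (fun h => ∫ p in D.box, ‖φ (p * h) - φ (p * g)‖ ^ 2) (nhds g)
      (nhds 0) := by
    have hc : Continuous fun h : D.Grp => ∫ p in D.box, ‖φ (p * h) - φ (p * g)‖ ^ 2 := by
      refine continuous_parametric_integral_of_continuous ?_ D.isCompact_box
      have h1 : Continuous fun q : D.Grp × D.Grp => φ (q.2 * q.1) :=
        φ.continuous.comp (continuous_snd.mul continuous_fst)
      have h2 : Continuous fun q : D.Grp × D.Grp => φ (q.2 * g) :=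
        φ.continuous.comp (continuous_snd.mul continuous_const)
      exact (h1.sub h2).norm.pow 2
    have := hc.tendsto g
    simpa using this
  have h2 : ∀ h, ‖CSpace.trans h φ - CSpace.trans g φ‖ =
      Real.sqrt (∫ p in D.box, ‖φ (p * h) - φ (p * g)‖ ^ 2) := by
    intro h
    rw [← Real.sqrt_sq (norm_nonneg (CSpace.trans h φ - CSpace.trans g φ)), CSpace.norm_sq]
    rfl
  simp only [h2]
  have h3 := (Real.continuous_sqrt.tendsto 0).comp h1
  rw [Real.sqrt_zero] at h3
  exact h3

variable (D) (ε)

/-- `L²(G, ε)`, the completion of `C(G, ε)`. -/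
abbrev L2 : Type := UniformSpace.Completion (D.CSpace ε)

variable {D ε}

/-- Right translation on `L²(G, ε)`, the continuous extension of right translation on `C(G, ε)`. -/
def L2.trans (g : D.Grp) : D.L2 ε →L[ℂ] D.L2 ε :=
  (CSpace.transₗᵢ g).toContinuousLinearMap.completion

@[simp] theorem L2.trans_coe (g : D.Grp) (φ : D.CSpace ε) :
    L2.trans g (φ : D.L2 ε) = (CSpace.trans g φ : D.L2 ε) :=
  UniformSpace.Completion.map_coe
    (CSpace.transₗᵢ g).toContinuousLinearMap.uniformContinuous φ

theorem L2.norm_trans (g : D.Grp) (φ : D.L2 ε) : ‖L2.trans g φ‖ = ‖φ‖ := by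
  induction φ using UniformSpace.Completion.induction_on with
  | hp => exact isClosed_eq (L2.trans g).continuous.norm continuous_norm
  | ih φ => simp [CSpace.norm_trans]

theorem L2.trans_one (φ : D.L2 ε) : L2.trans 1 φ = φ := by
  induction φ using UniformSpace.Completion.induction_on with
  | hp => exact isClosed_eq (L2.trans 1).continuous continuous_id
  | ih φ => rw [L2.trans_coe]; congr 1; ext y; simp

theorem L2.trans_mul (g h : D.Grp) (φ : D.L2 ε) :
    L2.trans (g * h) φ = L2.trans g (L2.trans h φ) := by
  induction φ using UniformSpace.Completion.induction_on with
  | hp =>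
    exact isClosed_eq (L2.trans (ε := ε) (g * h)).continuous
      ((L2.trans g).continuous.comp (L2.trans h).continuous)
  | ih φ => rw [L2.trans_coe, L2.trans_coe, L2.trans_coe]; congr 1; ext y; simp [mul_assoc]

variable (D) (ε)

/-- The right regular representation `ρ` of `G` on `L²(G, ε)`: the continuous extension of
`ρ(g)φ(y) = φ(yg)` for `φ ∈ C(G, ε)`. -/
def rho : UnitaryRep D.Grp where
  space := D.L2 ε
  op :=
    { toFun := fun g =>
        { (L2.trans g).toLinearMap with
          invFun := L2.trans g⁻¹
          left_inv := fun φ => (L2.trans_mul g⁻¹ g φ).symm.trans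
            (by rw [inv_mul_cancel]; exact L2.trans_one φ)
          right_inv := fun φ => (L2.trans_mul g g⁻¹ φ).symm.trans
            (by rw [mul_inv_cancel]; exact L2.trans_one φ)
          norm_map' := L2.norm_trans g }
      map_one' := LinearIsometryEquiv.ext L2.trans_one
      map_mul' := fun g h => LinearIsometryEquiv.ext (L2.trans_mul g h) }
  continuous_op := by
    refine UnitaryRep.continuous_of_total (fun g : D.Grp =>
      (⟨(L2.trans g).toLinearMap, L2.norm_trans g⟩ : D.L2 ε →ₗᵢ[ℂ] D.L2 ε))
      (Set.range ((↑) : D.CSpace ε → D.L2 ε))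
      (UniformSpace.Completion.denseRange_coe.mono Submodule.subset_span) ?_
    rintro _ ⟨φ, rfl⟩
    refine Continuous.congr ((UniformSpace.Completion.continuous_coe _).comp φ.continuous_trans) ?_
    exact fun g => (L2.trans_coe g φ).symm

theorem rho_op_coe (g : D.Grp) (φ : D.CSpace ε) :
    (show D.L2 ε from (D.rho ε).op g (φ : D.L2 ε)) = (CSpace.trans g φ : D.L2 ε) :=
  L2.trans_coe g φ

/-! ### Partial Fourier transform and the subspaces `U_θ` -/

variable {D ε}

/-- The partial Fourier transform `φ̂(ξ, t) = ∫_{[0,1]ⁿ} φ(2x, t) e^{-2πi⟨ξ,x⟩} dx`. -/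
def CSpace.fourier (ξ : Fin n → ℤ) (φ : D.CSpace ε) (t : ℝ) : ℂ :=
  ∫ x in Set.Icc (0 : Fin n → ℝ) 1, φ (Grp.mk ((2 : ℝ) • x) t) *
    Complex.exp (-(2 * Real.pi * I * (((fun i => (ξ i : ℝ)) ⬝ᵥ x : ℝ) : ℂ)))

theorem CSpace.continuous_fourier_integrand (ξ : Fin n → ℤ) (φ : D.CSpace ε) :
    Continuous fun q : ℝ × (Fin n → ℝ) => φ (Grp.mk ((2 : ℝ) • q.2) q.1) *
      Complex.exp (-(2 * Real.pi * I * (((fun i => (ξ i : ℝ)) ⬝ᵥ q.2 : ℝ) : ℂ))) := by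
  refine (φ.continuous.comp (Grp.continuous_mk (continuous_snd.const_smul (2 : ℝ)) continuous_fst)).mul ?_
  have : Continuous fun q : ℝ × (Fin n → ℝ) => (fun i => (ξ i : ℝ)) ⬝ᵥ q.2 :=
    continuous_const.dotProduct continuous_snd
  fun_prop

theorem CSpace.continuous_fourier (ξ : Fin n → ℤ) (φ : D.CSpace ε) : Continuous (φ.fourier ξ) :=
  continuous_parametric_integral_of_continuous (CSpace.continuous_fourier_integrand ξ φ)
    isCompact_Icc

theorem CSpace.integrableOn_fourier (ξ : Fin n → ℤ) (φ : D.CSpace ε) (t : ℝ) :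
    IntegrableOn (fun x => φ (Grp.mk ((2 : ℝ) • x) t) *
      Complex.exp (-(2 * Real.pi * I * (((fun i => (ξ i : ℝ)) ⬝ᵥ x : ℝ) : ℂ))))
      (Set.Icc (0 : Fin n → ℝ) 1) :=
  ((CSpace.continuous_fourier_integrand ξ φ).comp
    (continuous_const.prodMk continuous_id : Continuous fun x : Fin n → ℝ => (t, x))).continuousOn
    |>.integrableOn_compact isCompact_Icc

theorem CSpace.memLp_fourier (ξ : Fin n → ℤ) (φ : D.CSpace ε) :
    MemLp (φ.fourier ξ) 2 (volume.restrict (Set.Icc (0 : ℝ) 1)) := by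
  obtain ⟨C, hC⟩ := isCompact_Icc.exists_bound_of_continuousOn
    (φ.continuous_fourier ξ).continuousOn (s := Set.Icc (0 : ℝ) 1)
  refine MemLp.of_bound (φ.continuous_fourier ξ).aestronglyMeasurable C ?_
  exact (ae_restrict_iff' measurableSet_Icc).2 (Filter.Eventually.of_forall hC)

theorem lintegral_sq_le {X : Type} [MeasurableSpace X] (μ : Measure X) [IsProbabilityMeasure μ]
    (f : X → ℝ≥0∞) (hf : AEMeasurable f μ) : (∫⁻ x, f x ∂μ) ^ 2 ≤ ∫⁻ x, f x ^ 2 ∂μ := by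
  have h := ENNReal.lintegral_mul_le_Lp_mul_Lq μ Real.HolderConjugate.two_two hf
    (aemeasurable_const (b := (1 : ℝ≥0∞)))
  simp only [Pi.mul_apply, mul_one, ENNReal.one_rpow, lintegral_one, measure_univ] at h
  calc (∫⁻ x, f x ∂μ) ^ 2 ≤ ((∫⁻ x, f x ^ (2 : ℝ) ∂μ) ^ (1 / 2 : ℝ)) ^ 2 := by gcongr
    _ = ∫⁻ x, f x ^ 2 ∂μ := by
      rw [← ENNReal.rpow_natCast, ← ENNReal.rpow_mul]
      simp

/-- Dilating a periodic function changes its integral over the unit cube by a bounded factor. -/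
theorem exists_lintegral_dilate_le (n : ℕ) : ∃ C : ℝ≥0∞, C ≠ ⊤ ∧ ∀ H : (Fin n → ℝ) → ℝ≥0∞,
    Measurable H → (∀ (k : Fin n → ℤ) x, H ((fun i => (k i : ℝ)) + x) = H x) →
    ∫⁻ x in Set.Icc (0 : Fin n → ℝ) 1, H ((2 : ℝ) • x) ≤
      C * ∫⁻ x in Set.Icc (0 : Fin n → ℝ) 1, H x := by
  set c : ℝ≥0∞ := ENNReal.ofReal |((2 : ℝ) ^ Module.finrank ℝ (Fin n → ℝ))⁻¹|
  refine ⟨∑ _k : Fin n → Fin 2, c, by simp [c, ENNReal.mul_eq_top], ?_⟩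
  intro H hH hper
  set K : (Fin n → ℝ) → ℝ≥0∞ := (Set.Icc (0 : Fin n → ℝ) 1).indicator H
  have hK : Measurable K := hH.indicator measurableSet_Icc
  let e : (Fin n → Fin 2) → (Fin n → ℝ) := fun k i => -((k i : ℕ) : ℝ)
  have h1 : ∀ x ∈ Set.Icc (0 : Fin n → ℝ) 1,
      H ((2 : ℝ) • x) ≤ ∑ k : Fin n → Fin 2, K (e k + (2 : ℝ) • x) := by
    intro x hx
    have hx0 : ∀ i, 0 ≤ x i := hx.1
    have hx1 : ∀ i, x i ≤ 1 := hx.2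
    let k : Fin n → Fin 2 := fun i => if 2 * x i ≤ 1 then 0 else 1
    have hmem : e k + (2 : ℝ) • x ∈ Set.Icc (0 : Fin n → ℝ) 1 := by
      constructor <;> intro i <;> have := hx0 i <;> have := hx1 i <;>
        simp only [e, k, Pi.add_apply, Pi.smul_apply, smul_eq_mul, Pi.zero_apply, Pi.one_apply] <;>
        split_ifs <;> simp <;> linarith
    have hk : K (e k + (2 : ℝ) • x) = H ((2 : ℝ) • x) := by
      rw [show K (e k + (2 : ℝ) • x) = H (e k + (2 : ℝ) • x) from Set.indicator_of_mem hmem H,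
        ← hper (fun i => -((k i : ℕ) : ℤ)) ((2 : ℝ) • x)]
      congr 2
      ext i; simp [e]
    rw [← hk]
    exact Finset.single_le_sum (f := fun k => K (e k + (2 : ℝ) • x)) (fun _ _ => zero_le)
      (Finset.mem_univ k)
  have h2 : ∀ k, ∫⁻ x : Fin n → ℝ, K (e k + (2 : ℝ) • x) = c * ∫⁻ x, K x := by
    intro k
    have h := lintegral_map (μ := volume) (f := fun y : Fin n → ℝ => K (e k + y))
      (g := fun x : Fin n → ℝ => (2 : ℝ) • x)
      (hK.comp (measurable_const_add _)) (measurable_const_smul _)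
    rw [Measure.map_addHaar_smul volume (two_ne_zero), lintegral_smul_measure,
      lintegral_add_left_eq_self] at h
    exact h.symm
  calc ∫⁻ x in Set.Icc (0 : Fin n → ℝ) 1, H ((2 : ℝ) • x)
      ≤ ∫⁻ x in Set.Icc (0 : Fin n → ℝ) 1, ∑ k : Fin n → Fin 2, K (e k + (2 : ℝ) • x) :=
        setLIntegral_mono' measurableSet_Icc h1
    _ ≤ ∫⁻ x : Fin n → ℝ, ∑ k : Fin n → Fin 2, K (e k + (2 : ℝ) • x) :=
        setLIntegral_le_lintegral _ _
    _ = ∑ k : Fin n → Fin 2, ∫⁻ x : Fin n → ℝ, K (e k + (2 : ℝ) • x) :=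
        lintegral_finsetSum _ fun k _ =>
          hK.comp ((measurable_const_add _).comp (measurable_const_smul _))
    _ = (∑ _k : Fin n → Fin 2, c) * ∫⁻ x in Set.Icc (0 : Fin n → ℝ) 1, H x := by
        simp only [h2, Finset.sum_mul, K, lintegral_indicator measurableSet_Icc]

theorem exists_norm_fourier_le (D : Data n) (ε : D.Gam →* Multiplicative (ZMod 2))
    (ξ : Fin n → ℤ) : ∃ C : ℝ, ∀ φ : D.CSpace ε, ‖(φ.memLp_fourier ξ).toLp‖ ≤ C * ‖φ‖ := by
  obtain ⟨C, hC, hbd⟩ := exists_lintegral_dilate_le n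
  refine ⟨(C ^ (1 / 2 : ℝ)).toReal, fun φ => ?_⟩
  have hprob : IsProbabilityMeasure (volume.restrict (Set.Icc (0 : Fin n → ℝ) 1)) :=
    ⟨by simp [Real.volume_Icc_pi]⟩
  have hφm : Measurable fun q : (Fin n → ℝ) × ℝ => ‖φ (Grp.mk q.1 q.2)‖ₑ ^ 2 :=
    (φ.continuous.measurable.enorm.pow_const 2)
  have key : ∫⁻ t in Set.Icc (0 : ℝ) 1, ‖φ.fourier ξ t‖ₑ ^ 2 ≤ C * ENNReal.ofReal (‖φ‖ ^ 2) := by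
    have h1 : ∀ t, ‖φ.fourier ξ t‖ₑ ^ 2 ≤
        C * ∫⁻ x in Set.Icc (0 : Fin n → ℝ) 1, ‖φ (Grp.mk x t)‖ₑ ^ 2 := by
      intro t
      have hm : Measurable fun x : Fin n → ℝ => φ (Grp.mk x t) :=
        (φ.continuous.comp (Grp.continuous_mk continuous_id continuous_const)).measurable
      calc ‖φ.fourier ξ t‖ₑ ^ 2
          ≤ (∫⁻ x in Set.Icc (0 : Fin n → ℝ) 1, ‖φ (Grp.mk ((2 : ℝ) • x) t)‖ₑ) ^ 2 := by
            gcongr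
            refine (enorm_integral_le_lintegral_enorm _).trans (le_of_eq ?_)
            congr 1; ext x
            rw [enorm_mul]
            have : -(2 * Real.pi * I * (((fun i => (ξ i : ℝ)) ⬝ᵥ x : ℝ) : ℂ)) =
              ((-(2 * Real.pi * ((fun i => (ξ i : ℝ)) ⬝ᵥ x)) : ℝ) : ℂ) * I := by
              push_cast; ring
            rw [this, ← ofReal_norm (Complex.exp _), Complex.norm_exp_ofReal_mul_I]
            simp
        _ ≤ ∫⁻ x in Set.Icc (0 : Fin n → ℝ) 1, ‖φ (Grp.mk ((2 : ℝ) • x) t)‖ₑ ^ 2 :=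
            lintegral_sq_le _ _ (hm.comp (measurable_const_smul _)).enorm.aemeasurable
        _ ≤ C * ∫⁻ x in Set.Icc (0 : Fin n → ℝ) 1, ‖φ (Grp.mk x t)‖ₑ ^ 2 := by
            refine hbd (fun x => ‖φ (Grp.mk x t)‖ₑ ^ 2) (hm.enorm.pow_const 2) ?_
            intro k x
            have := φ.norm_equivariant (D.gam k 0) (Grp.mk x t)
            have h2 : ((D.gam k 0 : D.Gam) : D.Grp) * Grp.mk x t =
                Grp.mk ((fun i => (k i : ℝ)) + x) t := by
              refine Grp.ext ?_ ?_ <;> simp [gam, A_zero]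
            rw [h2] at this
            rw [← ofReal_norm, ← ofReal_norm, this]
    have hbox : volume.restrict D.box = ((volume.restrict (Set.Icc (0 : Fin n → ℝ) 1)).prod
        (volume.restrict (Set.Icc (0 : ℝ) 1)) : Measure ((Fin n → ℝ) × ℝ)) := by
      rw [box_eq, Measure.prod_restrict, ← Set.pi_univ_Icc]
      rfl
    calc ∫⁻ t in Set.Icc (0 : ℝ) 1, ‖φ.fourier ξ t‖ₑ ^ 2
        ≤ ∫⁻ t in Set.Icc (0 : ℝ) 1,
            C * ∫⁻ x in Set.Icc (0 : Fin n → ℝ) 1, ‖φ (Grp.mk x t)‖ₑ ^ 2 :=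
          lintegral_mono h1
      _ = C * ∫⁻ t in Set.Icc (0 : ℝ) 1,
            ∫⁻ x in Set.Icc (0 : Fin n → ℝ) 1, ‖φ (Grp.mk x t)‖ₑ ^ 2 :=
          lintegral_const_mul' _ _ hC
      _ = C * ENNReal.ofReal (‖φ‖ ^ 2) := by
          rw [φ.enorm_sq]
          congr 1
          have h3 := lintegral_prod_symm (μ := volume.restrict (Set.Icc (0 : Fin n → ℝ) 1))
            (ν := volume.restrict (Set.Icc (0 : ℝ) 1)) _ hφm.aemeasurable
          rw [← h3]
          change _ = lintegral (volume.restrict D.box) _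
          rw [hbox]
          rfl
  have h4 : eLpNorm (φ.fourier ξ) 2 (volume.restrict (Set.Icc (0 : ℝ) 1)) ≤
      C ^ (1 / 2 : ℝ) * ENNReal.ofReal ‖φ‖ := by
    rw [eLpNorm_eq_lintegral_rpow_enorm_toReal two_ne_zero ENNReal.ofNat_ne_top]
    simp only [ENNReal.toReal_ofNat, ENNReal.rpow_ofNat]
    calc (∫⁻ t in Set.Icc (0 : ℝ) 1, ‖φ.fourier ξ t‖ₑ ^ 2) ^ (1 / 2 : ℝ)
        ≤ (C * ENNReal.ofReal (‖φ‖ ^ 2)) ^ (1 / 2 : ℝ) := by gcongr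
      _ = C ^ (1 / 2 : ℝ) * ENNReal.ofReal ‖φ‖ := by
        rw [ENNReal.mul_rpow_of_nonneg _ _ (by norm_num), ENNReal.ofReal_pow (norm_nonneg _),
          ← ENNReal.rpow_natCast, ← ENNReal.rpow_mul]
        simp
  rw [Lp.norm_toLp]
  have h5 : C ^ (1 / 2 : ℝ) ≠ ⊤ := ENNReal.rpow_ne_top_of_nonneg (by norm_num) hC
  have h6 := ENNReal.toReal_mono (ENNReal.mul_ne_top h5 ENNReal.ofReal_ne_top) h4
  rwa [ENNReal.toReal_mul, ENNReal.toReal_ofReal (norm_nonneg _)] at h6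

variable (D) (ε)

/-- The operator `φ ↦ φ̂(ξ, ·)` from `C(G, ε)` to `L²([0,1])`. -/
def fourierC (ξ : Fin n → ℤ) :
    D.CSpace ε →L[ℂ] Lp ℂ 2 (volume.restrict (Set.Icc (0 : ℝ) 1)) :=
  LinearMap.mkContinuousOfExistsBound
    { toFun := fun φ => (φ.memLp_fourier ξ).toLp
      map_add' := fun φ ψ => by
        rw [← MemLp.toLp_add]
        congr 1; ext t
        change CSpace.fourier ξ (φ + ψ) t = CSpace.fourier ξ φ t + CSpace.fourier ξ ψ t
        rw [CSpace.fourier, CSpace.fourier, CSpace.fourier,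
          ← integral_add (φ.integrableOn_fourier ξ t) (ψ.integrableOn_fourier ξ t)]
        congr 1; ext x; rw [CSpace.add_apply]; ring
      map_smul' := fun c φ => by
        rw [RingHom.id_apply, ← MemLp.toLp_const_smul]
        congr 1; ext t
        change CSpace.fourier ξ (c • φ) t = c * CSpace.fourier ξ φ t
        rw [CSpace.fourier, CSpace.fourier, ← integral_const_mul]
        congr 1; ext x; rw [CSpace.smul_apply]; ring }
    (exists_norm_fourier_le D ε ξ)

/-- The operator `F_ξ φ = φ̂(ξ, ·)` from `L²(G, ε)` to `L²([0,1])`. -/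
def F (ξ : Fin n → ℤ) : D.L2 ε →L[ℂ] Lp ℂ 2 (volume.restrict (Set.Icc (0 : ℝ) 1)) :=
  (D.fourierC ε ξ).fromCompletion

theorem F_coe (ξ : Fin n → ℤ) (φ : D.CSpace ε) :
    D.F ε ξ (φ : D.L2 ε) = (φ.memLp_fourier ξ).toLp :=
  ContinuousLinearMap.fromCompletion_apply_coe _ _

/-- `U_θ`, the space of those `φ ∈ L²(G, ε)` such that `φ̂(ξ, ·) = 0` for all `ξ ∈ ℤⁿ \ θ`. -/
def U (θ : Set (Fin n → ℝ)) : Submodule ℂ (D.rho ε).space :=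
  ⨅ (ξ : Fin n → ℤ) (_ : (fun i => (ξ i : ℝ)) ∉ θ), LinearMap.ker (D.F ε ξ).toLinearMap

theorem isClosed_U (θ : Set (Fin n → ℝ)) : IsClosed (D.U ε θ : Set (D.rho ε).space) := by
  simp only [U, Submodule.coe_iInf]
  exact isClosed_iInter fun ξ => isClosed_iInter fun _ => (D.F ε ξ).isClosed_ker

/-! ### Orbits -/

/-- `ε'(k) = ε(k, 0)`. -/
def epsPrime (k : Fin n → ℤ) : ZMod 2 := (ε (D.gam k 0)).toAdd

/-- `ε̇(l) = ε(0, l)`. -/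
def epsDot (l : ℤ) : ZMod 2 := (ε (D.gam 0 l)).toAdd

/-- `Σ_{ε'}`, the set of those `ξ ∈ ℤⁿ` with `ξ_ν ∈ 2ℤ + ε'(e_ν)` for all `ν`. -/
def Sig : Set (Fin n → ℝ) :=
  {ξ | ∀ ν, ∃ k : ℤ, ξ ν = 2 * (k : ℝ) + ((D.epsPrime ε (Pi.single ν 1)).val : ℝ)}

/-- The `ℤ`-orbit of `ξ`. -/
def zOrbit (ξ : Fin n → ℝ) : Set (Fin n → ℝ) := Set.range fun l : ℤ => (D.A l)ᵀ *ᵥ ξ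

/-- The `ℝ`-orbit of `ξ`. -/
def rOrbit (ξ : Fin n → ℝ) : Set (Fin n → ℝ) := Set.range fun t : ℝ => (D.A t)ᵀ *ᵥ ξ

/-- The set of all `ℤ`-orbits contained in `S`. -/
def zOrbitsIn (S : Set (Fin n → ℝ)) : Set (Set (Fin n → ℝ)) :=
  {θ | (∃ ξ, θ = D.zOrbit ξ) ∧ θ ⊆ S}

/-- The set of all orbits `{ξ}` of fixed points `ξ ∈ Σ_{ε'}`. -/
def X0 : Set (Set (Fin n → ℝ)) :=
  {ω | ∃ ξ ∈ D.Sig ε, (∀ t : ℝ, (D.A t)ᵀ *ᵥ ξ = ξ) ∧ ω = {ξ}}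

/-- The set of all `ℝ`-orbits which intersect `Σ_{ε'}` and are not relatively compact. -/
def XInf : Set (Set (Fin n → ℝ)) :=
  {ω | (∃ η, ω = D.rOrbit η) ∧ (ω ∩ D.Sig ε).Nonempty ∧ ¬ IsCompact (closure ω)}

variable {D ε}

/-- The unique element `ξ` of an orbit `ω = {ξ}`. -/
def fixedPoint (ω : D.X0 ε) : Fin n → ℝ := ω.2.choose

theorem fixedPoint_fixed (ω : D.X0 ε) (t : ℝ) : (D.A t)ᵀ *ᵥ fixedPoint ω = fixedPoint ω :=
  ω.2.choose_spec.2.1 t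

theorem eq_singleton_fixedPoint (ω : D.X0 ε) : ω.1 = {fixedPoint ω} := ω.2.choose_spec.2.2

/-! ### The representations `ρ_η` -/

/-- The function `t ↦ e^{πi⟨A(t)ᵀη, x⟩}`, where `g = (x, s)`. -/
def phase (η : Fin n → ℝ) (g : D.Grp) (t : ℝ) : ℂ :=
  Complex.exp (Real.pi * I * ((((D.A t)ᵀ *ᵥ η) ⬝ᵥ g.vec : ℝ) : ℂ))

theorem norm_phase (η : Fin n → ℝ) (g : D.Grp) (t : ℝ) : ‖phase η g t‖ = 1 := by
  have : Real.pi * I * ((((D.A t)ᵀ *ᵥ η) ⬝ᵥ g.vec : ℝ) : ℂ) =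
      ((Real.pi * (((D.A t)ᵀ *ᵥ η) ⬝ᵥ g.vec) : ℝ) : ℂ) * I := by push_cast; ring
  rw [phase, this, Complex.norm_exp_ofReal_mul_I]

theorem continuous_phase_right (η : Fin n → ℝ) (g : D.Grp) : Continuous (phase η g) := by
  have h : Continuous fun t : ℝ => ((D.A t)ᵀ *ᵥ η) ⬝ᵥ g.vec :=
    (D.continuous_A.matrix_transpose.matrix_mulVec continuous_const).dotProduct continuous_const
  unfold phase
  fun_prop

theorem continuous_phase_left (η : Fin n → ℝ) (t : ℝ) :
    Continuous fun g : D.Grp => phase η g t := by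
  have h : Continuous fun g : D.Grp => ((D.A t)ᵀ *ᵥ η) ⬝ᵥ g.vec :=
    continuous_const.dotProduct Grp.continuous_vec
  unfold phase
  fun_prop

theorem phase_one (η : Fin n → ℝ) (t : ℝ) : phase η (1 : D.Grp) t = 1 := by
  simp [phase]

theorem phase_mul (η : Fin n → ℝ) (g h : D.Grp) (t : ℝ) :
    phase η (g * h) t = phase η g t * phase η h (t + g.time) := by
  rw [phase, phase, phase, ← Complex.exp_add]
  congr 1
  have : ((D.A t)ᵀ *ᵥ η) ⬝ᵥ (g * h).vec =
      ((D.A t)ᵀ *ᵥ η) ⬝ᵥ g.vec + ((D.A (t + g.time))ᵀ *ᵥ η) ⬝ᵥ h.vec := by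
    rw [Grp.vec_mul, dotProduct_add, A_add, Matrix.transpose_mul, ← Matrix.mulVec_mulVec,
      Matrix.dotProduct_mulVec, Matrix.mulVec_transpose (D.A g.time)]
  rw [this]; push_cast; ring

theorem memLp_etaFun (η : Fin n → ℝ) (g : D.Grp) (ψ : Lp ℂ 2 (volume : Measure ℝ)) :
    MemLp (fun t => phase η g t * ψ (t + g.time)) 2 volume := by
  have h : MemLp (fun t => ψ (t + g.time)) 2 volume :=
    (Lp.memLp ψ).comp_measurePreserving (measurePreserving_add_right volume g.time)
  have hc := continuous_phase_right η g
  refine h.congr_norm (hc.aestronglyMeasurable.mul h.1) (Filter.Eventually.of_forall fun t => ?_)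
  simp [norm_phase]

/-- `(ρ_η(x, s)ψ)(t) = e^{πi⟨A(t)ᵀη, x⟩} ψ(t + s)` for `ψ ∈ L²(ℝ)`. -/
def etaOp (η : Fin n → ℝ) (g : D.Grp) (ψ : Lp ℂ 2 (volume : Measure ℝ)) :
    Lp ℂ 2 (volume : Measure ℝ) :=
  (memLp_etaFun η g ψ).toLp

theorem etaOp_ae (η : Fin n → ℝ) (g : D.Grp) (ψ : Lp ℂ 2 (volume : Measure ℝ)) :
    etaOp η g ψ =ᵐ[volume] fun t => phase η g t * ψ (t + g.time) :=
  MemLp.coeFn_toLp _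

theorem ae_shift {p : ℝ → Prop} (h : ∀ᵐ t, p t) (s : ℝ) : ∀ᵐ t : ℝ, p (t + s) :=
  (measurePreserving_add_right volume s).quasiMeasurePreserving.ae h

theorem norm_etaOp (η : Fin n → ℝ) (g : D.Grp) (ψ : Lp ℂ 2 (volume : Measure ℝ)) :
    ‖etaOp η g ψ‖ = ‖ψ‖ := by
  rw [etaOp, Lp.norm_toLp, Lp.norm_def]
  congr 1
  rw [← eLpNorm_comp_measurePreserving (Lp.aestronglyMeasurable ψ)
    (measurePreserving_add_right volume g.time)]
  exact eLpNorm_congr_norm_ae (Filter.Eventually.of_forall fun t => by simp [norm_phase])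

theorem etaOp_add (η : Fin n → ℝ) (g : D.Grp) (ψ χ : Lp ℂ 2 (volume : Measure ℝ)) :
    etaOp η g (ψ + χ) = etaOp η g ψ + etaOp η g χ := by
  refine Lp.ext ?_
  filter_upwards [etaOp_ae η g (ψ + χ), etaOp_ae η g ψ, etaOp_ae η g χ,
    Lp.coeFn_add (etaOp η g ψ) (etaOp η g χ), ae_shift (Lp.coeFn_add ψ χ) g.time]
    with t h1 h2 h3 h4 h5
  rw [h1, h4, Pi.add_apply, h2, h3, h5, Pi.add_apply]; ring

theorem etaOp_smul (η : Fin n → ℝ) (g : D.Grp) (c : ℂ) (ψ : Lp ℂ 2 (volume : Measure ℝ)) :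
    etaOp η g (c • ψ) = c • etaOp η g ψ := by
  refine Lp.ext ?_
  filter_upwards [etaOp_ae η g (c • ψ), etaOp_ae η g ψ,
    Lp.coeFn_smul c (etaOp η g ψ), ae_shift (Lp.coeFn_smul c ψ) g.time] with t h1 h2 h3 h4
  rw [h1, h3, Pi.smul_apply, h2, h4, Pi.smul_apply, smul_eq_mul, smul_eq_mul]; ring

theorem etaOp_one (η : Fin n → ℝ) (ψ : Lp ℂ 2 (volume : Measure ℝ)) :
    etaOp η (1 : D.Grp) ψ = ψ := by
  refine Lp.ext ?_
  filter_upwards [etaOp_ae η (1 : D.Grp) ψ] with t h1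
  rw [h1, phase_one, Grp.time_one, add_zero, one_mul]

theorem etaOp_mul (η : Fin n → ℝ) (g h : D.Grp) (ψ : Lp ℂ 2 (volume : Measure ℝ)) :
    etaOp η (g * h) ψ = etaOp η g (etaOp η h ψ) := by
  refine Lp.ext ?_
  filter_upwards [etaOp_ae η (g * h) ψ, etaOp_ae η g (etaOp η h ψ),
    ae_shift (etaOp_ae η h ψ) g.time] with t h1 h2 h3
  rw [h1, h2, h3, phase_mul, Grp.time_mul]; ring_nf

theorem continuous_etaOp (η : Fin n → ℝ) (ψ : Lp ℂ 2 (volume : Measure ℝ)) :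
    Continuous fun g : D.Grp => etaOp η g ψ := by
  rw [continuous_iff_continuousAt]
  intro g₀
  rw [ContinuousAt, tendsto_iff_norm_sub_tendsto_zero]
  set f : ℝ → ℂ := fun t => ψ (t + g₀.time)
  have hf : MemLp f 2 volume :=
    (Lp.memLp ψ).comp_measurePreserving (measurePreserving_add_right volume g₀.time)
  have hcp : ∀ g : D.Grp, Continuous (phase η g) := continuous_phase_right η
  -- translations are strongly continuous
  let T : D.Grp → Lp ℂ 2 (volume : Measure ℝ) := fun g =>
    Lp.compMeasurePreserving (fun t => t + g.time) (measurePreserving_add_right volume g.time) ψ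
  have hT : Continuous T := by
    let τ : D.Grp → C(ℝ, ℝ) := fun g => ⟨fun t => t + g.time, by fun_prop⟩
    have hτ : Continuous τ := by
      refine ContinuousMap.continuous_of_continuous_uncurry _ ?_
      exact continuous_snd.add (Grp.continuous_time.comp continuous_fst)
    have hmp : ∀ g : D.Grp, MeasurePreserving (τ g) volume volume :=
      fun g => measurePreserving_add_right volume g.time
    exact Continuous.compMeasurePreservingLp (f := fun _ : D.Grp => ψ) (g := τ)
      continuous_const hτ hmp ENNReal.ofNat_ne_top
  have hT0 : Filter.Tendsto (fun g => ‖T g - T g₀‖) (nhds g₀) (nhds 0) :=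
    tendsto_iff_norm_sub_tendsto_zero.1 (hT.tendsto g₀)
  -- dominated convergence for the multiplication operators
  have hM : ∀ g : D.Grp, MemLp (fun t => (phase η g t - phase η g₀ t) * f t) 2 volume := by
    intro g
    refine MemLp.of_le_mul (c := 2) hf
      (((hcp g).sub (hcp g₀)).aestronglyMeasurable.mul hf.1) (Filter.Eventually.of_forall fun t => ?_)
    rw [norm_mul]
    gcongr
    refine (norm_sub_le _ _).trans ?_
    rw [norm_phase, norm_phase]; norm_num
  have hM0 : Filter.Tendsto (fun g => ‖(hM g).toLp‖) (nhds g₀) (nhds 0) := by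
    have h1 : Filter.Tendsto (fun g : D.Grp => ∫ t, ‖(phase η g t - phase η g₀ t) * f t‖ ^ 2)
        (nhds g₀) (nhds (∫ _t : ℝ, (0 : ℝ))) := by
      refine tendsto_integral_filter_of_dominated_convergence (fun t => 4 * ‖f t‖ ^ 2) ?_ ?_ ?_ ?_
      · exact Filter.Eventually.of_forall fun g => ((hM g).1.norm.pow 2)
      · refine Filter.Eventually.of_forall fun g => Filter.Eventually.of_forall fun t => ?_
        have : ‖phase η g t - phase η g₀ t‖ ≤ 2 := by
          refine (norm_sub_le _ _).trans ?_
          rw [norm_phase, norm_phase]; norm_num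
        rw [norm_mul, mul_pow, norm_mul, norm_pow, norm_pow, norm_norm, norm_norm]
        gcongr
        nlinarith [norm_nonneg (phase η g t - phase η g₀ t)]
      · exact ((memLp_two_iff_integrable_sq_norm hf.1).1 hf).const_mul 4
      · refine Filter.Eventually.of_forall fun t => ?_
        have hc : Continuous fun g : D.Grp => ‖(phase η g t - phase η g₀ t) * f t‖ ^ 2 := by
          have : Continuous fun g : D.Grp => phase η g t := continuous_phase_left η t
          fun_prop
        simpa using hc.tendsto g₀
    have h2 : ∀ g, ‖(hM g).toLp‖ =
        Real.sqrt (∫ t, ‖(phase η g t - phase η g₀ t) * f t‖ ^ 2) := by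
      intro g
      rw [← Real.sqrt_sq (norm_nonneg ((hM g).toLp))]
      congr 1
      have h4 : ((‖(hM g).toLp‖ ^ 2 : ℝ) : ℂ) = inner ℂ ((hM g).toLp) ((hM g).toLp) := by
        rw [inner_self_eq_norm_sq_to_K]; simp
      refine Complex.ofReal_injective (h4.trans ?_)
      rw [L2.inner_def, ← integral_complex_ofReal]
      refine integral_congr_ae ?_
      filter_upwards [(hM g).coeFn_toLp] with t ht
      rw [ht, inner_self_eq_norm_sq_to_K]; simp
    simp only [h2]
    have h3 := (Real.continuous_sqrt.tendsto _).comp h1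
    simpa [Function.comp_def] using h3
  have hS := hT0.add hM0
  rw [add_zero] at hS
  refine squeeze_zero (fun _ => norm_nonneg _) (fun g => ?_) hS
  -- the triangle inequality
  have hN : ∀ χ : Lp ℂ 2 (volume : Measure ℝ), ∀ hχ : MemLp (fun t => phase η g t * χ t) 2 volume,
      ‖hχ.toLp‖ = ‖χ‖ := by
    intro χ hχ
    rw [Lp.norm_toLp, Lp.norm_def]
    congr 1
    exact eLpNorm_congr_norm_ae (Filter.Eventually.of_forall fun t => by simp [norm_phase])
  have hχ : MemLp (fun t => phase η g t * (T g - T g₀) t) 2 volume := by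
    refine (Lp.memLp (T g - T g₀)).congr_norm
      ((hcp g).aestronglyMeasurable.mul (Lp.aestronglyMeasurable _))
      (Filter.Eventually.of_forall fun t => ?_)
    simp [norm_phase]
  have hsum : etaOp η g ψ - etaOp η g₀ ψ = hχ.toLp + (hM g).toLp := by
    refine Lp.ext ?_
    filter_upwards [Lp.coeFn_sub (etaOp η g ψ) (etaOp η g₀ ψ), etaOp_ae η g ψ, etaOp_ae η g₀ ψ,
      Lp.coeFn_add hχ.toLp (hM g).toLp, hχ.coeFn_toLp, (hM g).coeFn_toLp,
      Lp.coeFn_sub (T g) (T g₀),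
      Lp.coeFn_compMeasurePreserving ψ (measurePreserving_add_right volume g.time),
      Lp.coeFn_compMeasurePreserving ψ (measurePreserving_add_right volume g₀.time)]
      with t h1 h2 h3 h4 h5 h6 h7 h8 h9
    rw [h1, h4, Pi.sub_apply, Pi.add_apply, h2, h3, h5, h6, h7, Pi.sub_apply, h8, h9]
    simp only [Function.comp_apply, f]
    ring
  rw [hsum]
  refine (norm_add_le _ _).trans (le_of_eq ?_)
  rw [hN _ hχ]

variable (D)

/-- The unitary representation `ρ_η` of `G` on `L²(ℝ)`. -/
def rhoEta (η : Fin n → ℝ) : UnitaryRep D.Grp where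
  space := Lp ℂ 2 (volume : Measure ℝ)
  op :=
    { toFun := fun g =>
        { toFun := etaOp η g
          invFun := etaOp η g⁻¹
          map_add' := etaOp_add η g
          map_smul' := etaOp_smul η g
          left_inv := fun ψ => by
            rw [← etaOp_mul, inv_mul_cancel, etaOp_one]
          right_inv := fun ψ => by
            rw [← etaOp_mul, mul_inv_cancel, etaOp_one]
          norm_map' := norm_etaOp η g }
      map_one' := LinearIsometryEquiv.ext (etaOp_one η)
      map_mul' := fun g h => LinearIsometryEquiv.ext (etaOp_mul η g h) }
  continuous_op := continuous_etaOp η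

/-! ### The characters -/

variable {D}

/-- The value `e^{πi⟨ξ,x⟩} e^{πi(2m + ε̇(1))s}` at `(x, s)`, where `ω = {ξ}`. -/
def chiVal (ω : D.X0 ε) (m : ℤ) (g : D.Grp) : ℂ :=
  Complex.exp (Real.pi * I * ((fixedPoint ω ⬝ᵥ g.vec : ℝ) : ℂ)) *
    Complex.exp (Real.pi * I * (2 * (m : ℂ) + ((D.epsDot ε 1).val : ℂ)) * (g.time : ℂ))

theorem norm_chiVal (ω : D.X0 ε) (m : ℤ) (g : D.Grp) : ‖chiVal ω m g‖ = 1 := by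
  have h1 : Real.pi * I * ((fixedPoint ω ⬝ᵥ g.vec : ℝ) : ℂ) =
      ((Real.pi * (fixedPoint ω ⬝ᵥ g.vec) : ℝ) : ℂ) * I := by push_cast; ring
  have h2 : Real.pi * I * (2 * (m : ℂ) + ((D.epsDot ε 1).val : ℂ)) * (g.time : ℂ) =
      ((Real.pi * (2 * m + (D.epsDot ε 1).val) * g.time : ℝ) : ℂ) * I := by push_cast; ring
  rw [chiVal, norm_mul, h1, h2, Complex.norm_exp_ofReal_mul_I, Complex.norm_exp_ofReal_mul_I,
    one_mul]

theorem chiVal_one (ω : D.X0 ε) (m : ℤ) : chiVal ω m (1 : D.Grp) = 1 := by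
  simp [chiVal]

theorem chiVal_mul (ω : D.X0 ε) (m : ℤ) (g h : D.Grp) :
    chiVal ω m (g * h) = chiVal ω m g * chiVal ω m h := by
  have : fixedPoint ω ⬝ᵥ (g * h).vec = fixedPoint ω ⬝ᵥ g.vec + fixedPoint ω ⬝ᵥ h.vec := by
    rw [Grp.vec_mul, dotProduct_add, Matrix.dotProduct_mulVec, ← Matrix.mulVec_transpose,
      fixedPoint_fixed]
  simp only [chiVal, this, Grp.time_mul, ← Complex.exp_add]
  congr 1
  push_cast; ring

theorem continuous_chiVal (ω : D.X0 ε) (m : ℤ) : Continuous (chiVal ω m) := by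
  have h : Continuous fun g : D.Grp => fixedPoint ω ⬝ᵥ g.vec :=
    continuous_const.dotProduct Grp.continuous_vec
  unfold chiVal
  fun_prop

/-- The unitary character `χ_{ε̇,ω,m}` of `G`, as a one-dimensional representation. -/
def chi (ω : D.X0 ε) (m : ℤ) : UnitaryRep D.Grp where
  space := ℂ
  op :=
    { toFun := fun g =>
        { toFun := fun z => chiVal ω m g * z
          invFun := fun z => chiVal ω m g⁻¹ * z
          map_add' := mul_add _
          map_smul' := fun c z => by simp only [smul_eq_mul, RingHom.id_apply]; ring
          left_inv := fun z => by
            change chiVal ω m g⁻¹ * (chiVal ω m g * z) = z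
            rw [← mul_assoc, ← chiVal_mul, inv_mul_cancel, chiVal_one, one_mul]
          right_inv := fun z => by
            change chiVal ω m g * (chiVal ω m g⁻¹ * z) = z
            rw [← mul_assoc, ← chiVal_mul, mul_inv_cancel, chiVal_one, one_mul]
          norm_map' := fun z => by
            change ‖chiVal ω m g * z‖ = ‖z‖
            rw [norm_mul, norm_chiVal, one_mul] }
      map_one' := LinearIsometryEquiv.ext fun z => by
        change chiVal ω m 1 * z = z
        rw [chiVal_one, one_mul]
      map_mul' := fun g h => LinearIsometryEquiv.ext fun z => by
        change chiVal ω m (g * h) * z = chiVal ω m g * (chiVal ω m h * z)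
        rw [chiVal_mul, mul_assoc] }
  continuous_op := fun z => (continuous_chiVal ω m).mul continuous_const

/-! ### Multiplicities and the representations `ρ_θ` -/

variable (D) (ε)

/-- The multiplicity `m_{ε,ω}`, the number of `ℤ`-orbits contained in `ω ∩ Σ_{ε'}`. -/
def mult (ω : Set (Fin n → ℝ)) : ℕ := (D.zOrbitsIn (ω ∩ D.Sig ε)).ncard

/-- The restriction `ρ_θ` of `ρ` to the closed subspace `U_θ`, if this subspace is invariant. -/
def rhoTheta (θ : Set (Fin n → ℝ))
    (hinv : ∀ (g : D.Grp), ∀ φ ∈ D.U ε θ, (D.rho ε).op g φ ∈ D.U ε θ) : UnitaryRep D.Grp :=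
  (D.rho ε).sub (D.U ε θ) (D.isClosed_U ε θ) hinv

end Data

end SemidirectModel

end

noncomputable section

namespace SemidirectModel

open MeasureTheory Matrix Complex
open scoped ENNReal

/-! ## Periodic functions on `ℝⁿ` -/

namespace Periodic

variable {n : ℕ}

-- Fourier expansion in `x` turns `L²(G, ε)` into a space of sequences of functions of `t`. For `φ ∈
-- C(G, ε)` the function `x ↦ φ(2x, t)` is periodic, and Parseval on every slice makes `φ ↦ (F_ξ
-- φ)_ξ` an isometry into `ℓ²(ℤⁿ; L²([0,1]))` (`hasSum_inner_F`). Only frequencies in `Σ_{ε'}`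
-- occur, and `U_θ` consists of the vectors with frequencies in `θ`, so different `U_θ` are
-- orthogonal and together they are total.
--
-- Invariance and the structure of `U_θ` come from Poincaré series. For `ξ ∈ Σ_{ε'}` and `ψ ∈
-- C_c(ℝ)` the function `ψ(t) e^{πi⟨ξ,x⟩}` is already equivariant under `ℤⁿ`; summing its translates
-- over `ℤ` with signs gives an element of `C(G, ε)` with frequencies in the `ℤ`-orbit of `ξ`. These
-- series are dense in `U_θ` (`U_eq_closure`), and right translation by `g` acts on `ψ` through
-- `ρ_ξ(g)` (`trans_poincare`). If the stabiliser of `ξ` in `ℤ` is trivial, the frequencies `A(l)ᵀξ`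
-- are distinct, the pieces `ψ(l + t)`, `t ∈ [0,1]`, do not interfere, and the norm of the series is
-- the norm of `ψ` in `L²(ℝ)` (`norm_poincare`); hence `ρ_θ ≅ ρ_ξ`. If `ξ` is fixed, a vector of
-- `U_θ` is a single function on `[0,1]`, and Fourier series in `t` split `U_θ` into the characters.
--
-- Exponentiality enters through `IsExponential.fixed`. If `A(s)ᵀξ = ξ` with `s ≠ 0`, then writing
-- `(w, s)` as an exponential exhibits `⟨ξ, A(u)w⟩` as the mean of an `s`-periodic function over
-- `[u, u + s]`, which does not depend on `u`. So every point is fixed or has trivial stabiliser. A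
-- point of `Σ_{ε'}` that is not fixed has infinitely many integral points on its orbit, which is
-- therefore unbounded, and the two kinds of orbits exhaust `Σ_{ε'}`.
--
-- For irreducibility and inequivalence, the matrix coefficient `x ↦ ⟨w, ρ_η(x, s)v⟩` is the Fourier
-- transform of the measure with density `v(t + s) conj(w(t))` pushed forward along the injective
-- curve `t ↦ A(t)ᵀη`. Uniqueness of Fourier transforms recovers this density. If `w` is orthogonal
-- to the orbit of `v`, all these products vanish, and Tonelli gives `v = 0` or `w = 0`. For `v =
-- w`, `s = 0` the measure is carried by the orbit of `η`, which separates different orbits.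

local instance : MeasureSpace UnitAddCircle := ⟨AddCircle.haarAddCircle⟩

local instance : Measure.IsAddHaarMeasure (volume : Measure UnitAddCircle) :=
  inferInstanceAs (Measure.IsAddHaarMeasure AddCircle.haarAddCircle)

local instance : IsProbabilityMeasure (volume : Measure UnitAddCircle) :=
  inferInstanceAs (IsProbabilityMeasure AddCircle.haarAddCircle)

/-- A function on `ℝⁿ` is `ℤⁿ`-periodic. -/
def IsPeriodic {β : Type} (H : (Fin n → ℝ) → β) : Prop :=
  ∀ (k : Fin n → ℤ) x, H (x + fun i => (k i : ℝ)) = H x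

/-- The projection of `ℝⁿ` onto the torus. -/
def proj (x : Fin n → ℝ) : UnitAddTorus (Fin n) := fun i => (x i : UnitAddCircle)

theorem isOpenQuotientMap_proj : IsOpenQuotientMap (proj : (Fin n → ℝ) → UnitAddTorus (Fin n)) := by
  have h : IsOpenQuotientMap ((↑) : ℝ → UnitAddCircle) := QuotientAddGroup.isOpenQuotientMap_mk
  exact IsOpenQuotientMap.piMap fun _ : Fin n => h

/-- The function on the torus defined by a periodic function. -/
def lift {β : Type} (H : (Fin n → ℝ) → β) (z : UnitAddTorus (Fin n)) : β :=
  H (isOpenQuotientMap_proj.surjective z).choose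

/-- `lift` evaluates `H` at an arbitrary preimage; two preimages differ by an integral vector, so
for periodic `H` the choice is immaterial. -/
theorem lift_proj {β : Type} {H : (Fin n → ℝ) → β} (hH : IsPeriodic H) (x : Fin n → ℝ) :
    lift H (proj x) = H x := by
  have h := (isOpenQuotientMap_proj.surjective (proj x)).choose_spec
  set y := (isOpenQuotientMap_proj.surjective (proj x)).choose with hy
  have h1 : ∀ i, ∃ k : ℤ, y i = x i + k := by
    intro i
    have h2 : (y i : UnitAddCircle) = (x i : UnitAddCircle) := congrFun h i
    have h3 : ((y i - x i : ℝ) : UnitAddCircle) = 0 := by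
      rw [AddCircle.coe_sub, h2, sub_self]
    obtain ⟨k, hk⟩ := (AddCircle.coe_eq_zero_iff 1).1 h3
    refine ⟨k, ?_⟩
    rw [zsmul_eq_mul, mul_one] at hk
    rw [hk]; ring
  choose k hk using h1
  change H y = H x
  rw [← hH k x]
  congr 1
  exact funext hk

theorem continuous_lift {β : Type} [TopologicalSpace β] {H : (Fin n → ℝ) → β} (hH : IsPeriodic H)
    (hc : Continuous H) : Continuous (lift H) := by
  rw [isOpenQuotientMap_proj.isQuotientMap.continuous_iff]
  exact hc.congr fun x => (lift_proj hH x).symm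

/-- The half-open cube is a fundamental domain for `ℤⁿ` and differs from the closed one by a null
set. This transfers invariance properties of Haar measure on the torus to integrals over the cube.
-/
theorem setIntegral_cube_eq {E : Type} [NormedAddCommGroup E] [NormedSpace ℝ E]
    (f : UnitAddTorus (Fin n) → E) :
    ∫ x in Set.Icc (0 : Fin n → ℝ) 1, f (proj x) = ∫ z, f z := by
  rw [UnitAddTorus.integral_preimage f 0]
  have h : {x : Fin n → ℝ | ∀ i, x i ∈ Set.Ioc ((0 : Fin n → ℝ) i) ((0 : Fin n → ℝ) i + 1)} =
      Set.univ.pi fun i => Set.Ioc ((0 : Fin n → ℝ) i) ((1 : Fin n → ℝ) i) := by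
    ext x; simp
  rw [h]
  exact (setIntegral_congr_set
    (Measure.univ_pi_Ioc_ae_eq_Icc (μ := fun _ : Fin n => (volume : Measure ℝ)))).symm

theorem setIntegral_cube_translate {E : Type} [NormedAddCommGroup E] [NormedSpace ℝ E]
    {H : (Fin n → ℝ) → E} (hH : IsPeriodic H) (a : Fin n → ℝ) :
    ∫ x in Set.Icc (0 : Fin n → ℝ) 1, H (x + a) = ∫ x in Set.Icc (0 : Fin n → ℝ) 1, H x := by
  have h1 := setIntegral_cube_eq (lift H)
  have h2 := setIntegral_cube_eq fun z => lift H (z + proj a)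
  rw [integral_add_right_eq_self] at h2
  simp only [lift_proj hH] at h1
  rw [h1, ← h2]
  congr 1; ext x
  rw [← lift_proj hH]; rfl

/-- The endomorphism `z ↦ 2z` of the torus preserves Haar measure. This compensates for the factor
`2` in the definition of the partial Fourier transform. -/
theorem setIntegral_cube_dilate {E : Type} [NormedAddCommGroup E] [NormedSpace ℝ E]
    {H : (Fin n → ℝ) → E} (hH : IsPeriodic H) (hc : Continuous H) :
    ∫ x in Set.Icc (0 : Fin n → ℝ) 1, H ((2 : ℝ) • x) =
      ∫ x in Set.Icc (0 : Fin n → ℝ) 1, H x := by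
  have h0 : MeasurePreserving (fun z : UnitAddTorus (Fin n) => fun i => (2 : ℤ) • z i)
      volume volume :=
    measurePreserving_pi _ _ fun _ => Measure.measurePreserving_zsmul
      (volume : Measure UnitAddCircle) two_ne_zero
  have h1 := setIntegral_cube_eq (lift H)
  have h2 := setIntegral_cube_eq fun z => lift H (fun i => (2 : ℤ) • z i)
  have h3 : ∫ z : UnitAddTorus (Fin n), lift H (fun i => (2 : ℤ) • z i) = ∫ z, lift H z := by
    conv_rhs => rw [← h0.map_eq]
    exact (integral_map h0.aemeasurable (continuous_lift hH hc).aestronglyMeasurable).symm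
  rw [h3] at h2
  simp only [lift_proj hH] at h1
  rw [h1, ← h2]
  congr 1; ext x
  rw [← lift_proj hH]
  congr 1; ext i
  change (((2 : ℝ) * x i : ℝ) : UnitAddCircle) = (2 : ℤ) • (x i : UnitAddCircle)
  rw [← AddCircle.coe_zsmul, zsmul_eq_mul]
  norm_num

theorem mFourier_proj (ξ : Fin n → ℤ) (x : Fin n → ℝ) :
    UnitAddTorus.mFourier ξ (proj x) = Complex.exp (2 * Real.pi * I * (((fun i => (ξ i : ℝ)) ⬝ᵥ x : ℝ) : ℂ)) := by
  simp only [UnitAddTorus.mFourier, ContinuousMap.coe_mk, proj, fourier_coe_apply, dotProduct]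
  rw [← Complex.exp_sum]
  push_cast
  rw [Finset.mul_sum]
  congr 1
  refine Finset.sum_congr rfl fun i _ => ?_
  ring

/-- Parseval's identity for continuous periodic functions. -/
theorem hasSum_sq_cube {H : (Fin n → ℝ) → ℂ} (hH : IsPeriodic H) (hc : Continuous H) :
    HasSum (fun ξ : Fin n → ℤ => ‖∫ x in Set.Icc (0 : Fin n → ℝ) 1, H x *
        Complex.exp (-(2 * Real.pi * I * (((fun i => (ξ i : ℝ)) ⬝ᵥ x : ℝ) : ℂ)))‖ ^ 2)
      (∫ x in Set.Icc (0 : Fin n → ℝ) 1, ‖H x‖ ^ 2) := by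
  let f : C(UnitAddTorus (Fin n), ℂ) := ⟨lift H, continuous_lift hH hc⟩
  have h := UnitAddTorus.hasSum_sq_mFourierCoeff (ContinuousMap.toLp 2 volume ℂ f)
  have h1 : ∫ z, ‖(ContinuousMap.toLp 2 volume ℂ f) z‖ ^ 2 = ∫ z, ‖lift H z‖ ^ 2 := by
    refine integral_congr_ae ?_
    filter_upwards [f.coeFn_toLp (p := 2) (𝕜 := ℂ) volume] with z hz
    rw [hz]; rfl
  rw [h1, ← setIntegral_cube_eq] at h
  simp only [lift_proj hH, UnitAddTorus.mFourierCoeff_toLp] at h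
  convert h using 4 with ξ
  rw [UnitAddTorus.mFourierCoeff, ← setIntegral_cube_eq]
  congr 1; ext x
  rw [mFourier_proj, smul_eq_mul, mul_comm]
  congr 1
  · congr 1
    simp [dotProduct]
  · exact (lift_proj hH x).symm

theorem exp_two_pi_int (k : ℤ) (z : ℂ) :
    Complex.exp (2 * Real.pi * I * (z + k)) = Complex.exp (2 * Real.pi * I * z) := by
  rw [mul_add, Complex.exp_add, mul_comm (2 * Real.pi * I) (k : ℂ),
    Complex.exp_int_mul_two_pi_mul_I, mul_one]

theorem isPeriodic_exp (ξ : Fin n → ℤ) : IsPeriodic fun x : Fin n → ℝ =>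
    Complex.exp (2 * Real.pi * I * (((fun i => (ξ i : ℝ)) ⬝ᵥ x : ℝ) : ℂ)) := by
  intro k x
  have : (fun i => (ξ i : ℝ)) ⬝ᵥ (x + fun i => (k i : ℝ)) =
      (fun i => (ξ i : ℝ)) ⬝ᵥ x + ((∑ i, ξ i * k i : ℤ) : ℝ) := by
    rw [dotProduct_add]; simp [dotProduct]
  simp only [this]
  push_cast [-Int.cast_sum]
  exact exp_two_pi_int (∑ i, ξ i * k i) _

/-- A periodic function which is multiplied by `c ≠ 1` by a translation has integral zero. -/
theorem setIntegral_cube_eq_zero {H : (Fin n → ℝ) → ℂ} (hH : IsPeriodic H) (a : Fin n → ℝ) (c : ℂ)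
    (hc : c ≠ 1) (h : ∀ x, H (x + a) = c * H x) :
    ∫ x in Set.Icc (0 : Fin n → ℝ) 1, H x = 0 := by
  have h1 := setIntegral_cube_translate hH a
  simp only [h, integral_const_mul] at h1
  have h2 : (c - 1) * ∫ x in Set.Icc (0 : Fin n → ℝ) 1, H x = 0 := by rw [sub_mul, h1]; ring
  exact (mul_eq_zero.1 h2).resolve_left (sub_ne_zero.2 hc)

open Classical in
theorem setIntegral_cube_exp (ξ : Fin n → ℤ) :
    ∫ x in Set.Icc (0 : Fin n → ℝ) 1,
      Complex.exp (2 * Real.pi * I * (((fun i => (ξ i : ℝ)) ⬝ᵥ x : ℝ) : ℂ)) =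
      if ξ = 0 then 1 else 0 := by
  split_ifs with h
  · subst h
    simp [dotProduct, Measure.real, Real.volume_Icc_pi]
  · obtain ⟨ν, hν⟩ := Function.ne_iff.1 h
    -- Moving the `ν`-th coordinate by `1/(2ξ_ν)` changes the phase by `πi`, hence the factor `-1`.
    refine setIntegral_cube_eq_zero (isPeriodic_exp ξ) (Pi.single ν (1 / (2 * ξ ν))) (-1)
      (by norm_num) fun x => ?_
    have h0 : ((ξ ν : ℤ) : ℝ) ≠ 0 := by exact_mod_cast hν
    have h1 : (fun i => (ξ i : ℝ)) ⬝ᵥ (x + Pi.single ν (1 / (2 * (ξ ν : ℝ)))) =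
        (fun i => (ξ i : ℝ)) ⬝ᵥ x + 1 / 2 := by
      rw [dotProduct_add, dotProduct_single]; field_simp
    rw [h1]
    push_cast
    rw [mul_add, Complex.exp_add, show 2 * (Real.pi : ℂ) * I * (1 / 2) = Real.pi * I by ring,
      Complex.exp_pi_mul_I]
    ring

end Periodic

/-! ## Parseval's identity on `L²(G, ε)` -/

namespace Data

variable {n : ℕ} {D : Data n} {ε : D.Gam →* Multiplicative (ZMod 2)}

/-- The representative `val` is additive only modulo `2`, which is all that the powers of `e^{iπ} =
-1` see. -/
theorem exp_val_add (a b : ZMod 2) : Complex.exp (I * Real.pi * ((a + b).val : ℂ)) =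
    Complex.exp (I * Real.pi * (a.val : ℂ)) * Complex.exp (I * Real.pi * (b.val : ℂ)) := by
  have h : Complex.exp (I * Real.pi) = -1 := by rw [mul_comm, Complex.exp_pi_mul_I]
  have hv : ∀ c : ZMod 2, Complex.exp (I * Real.pi * (c.val : ℂ)) = (-1) ^ c.val := by
    intro c
    rw [← h, ← Complex.exp_nat_mul, mul_comm]
  rw [hv, hv, hv, ZMod.val_add, ← pow_add, ← neg_one_pow_eq_pow_mod_two]

theorem sign_mul (γ γ' : D.Gam) : D.sign ε (γ * γ') = D.sign ε γ * D.sign ε γ' := by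
  rw [sign, sign, sign, map_mul, toAdd_mul]
  exact exp_val_add _ _

theorem sign_one : D.sign ε 1 = 1 := by simp [sign]

theorem sign_mul_self (γ : D.Gam) : D.sign ε γ * D.sign ε γ = 1 := by
  rw [← sign_mul, sign, map_mul, toAdd_mul, ZModModule.add_self]
  simp

theorem sign_ne_zero (γ : D.Gam) : D.sign ε γ ≠ 0 := by
  intro h
  simpa [h] using sign_mul_self (ε := ε) γ

theorem gam_mul (k k' : Fin n → ℤ) : D.gam k 0 * D.gam k' 0 = D.gam (k + k') 0 := by
  refine Subtype.ext (Grp.ext ?_ ?_)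
  · ext i; simp [gam, A_zero]
  · simp [gam]

theorem gam_zero_mul (l l' : ℤ) : D.gam 0 l * D.gam 0 l' = D.gam 0 (l + l') := by
  refine Subtype.ext (Grp.ext ?_ ?_)
  · ext i; simp [gam, mulVec, dotProduct]
  · simp [gam]

theorem gam_mk_mul (k : Fin n → ℤ) (x : Fin n → ℝ) (t : ℝ) :
    (D.gam k 0 : D.Grp) * Grp.mk x t = Grp.mk (x + fun i => (k i : ℝ)) t := by
  refine Grp.ext ?_ ?_ <;> simp [gam, A_zero, add_comm]

theorem CSpace.apply_add_int (φ : D.CSpace ε) (k : Fin n → ℤ) (x : Fin n → ℝ) (t : ℝ) :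
    φ (Grp.mk (x + fun i => (k i : ℝ)) t) = D.sign ε (D.gam k 0) * φ (Grp.mk x t) := by
  rw [← gam_mk_mul, φ.equivariant]

theorem CSpace.isPeriodic_norm_sq (φ : D.CSpace ε) (t : ℝ) :
    Periodic.IsPeriodic fun x : Fin n → ℝ => ‖φ (Grp.mk x t)‖ ^ 2 := by
  intro k x
  simp only [φ.apply_add_int, norm_mul, norm_sign, one_mul]

/-- Translating `x` by `k` translates `2x` by `2k`, and signs are trivial on `2ℤⁿ`. This is the
reason for expanding `φ(2x, t)`: the function `φ(x, t)` itself is periodic only up to sign. -/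
theorem CSpace.isPeriodic_double (φ : D.CSpace ε) (t : ℝ) :
    Periodic.IsPeriodic fun x : Fin n → ℝ => φ (Grp.mk ((2 : ℝ) • x) t) := by
  intro k x
  have : (2 : ℝ) • (x + fun i => (k i : ℝ)) = (2 : ℝ) • x + fun i => ((k + k) i : ℝ) := by
    ext i; simp; ring
  simp only [this, φ.apply_add_int, ← gam_mul, sign_mul, sign_mul_self, one_mul]

theorem CSpace.continuous_slice (φ : D.CSpace ε) (t : ℝ) :
    Continuous fun x : Fin n → ℝ => φ (Grp.mk x t) :=
  φ.continuous.comp (Grp.continuous_mk continuous_id continuous_const)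

theorem CSpace.hasSum_fourier (φ : D.CSpace ε) (t : ℝ) :
    HasSum (fun ξ : Fin n → ℤ => ‖φ.fourier ξ t‖ ^ 2)
      (∫ x in Set.Icc (0 : Fin n → ℝ) 1, ‖φ (Grp.mk x t)‖ ^ 2) := by
  rw [← Periodic.setIntegral_cube_dilate (φ.isPeriodic_norm_sq t)
    ((φ.continuous_slice t).norm.pow 2)]
  exact Periodic.hasSum_sq_cube (φ.isPeriodic_double t)
    ((φ.continuous_slice t).comp (continuous_const_smul (2 : ℝ)))

/-- Parseval on a slice with values in `ℝ≥0∞`, so that the sum over `ξ` can be exchanged with the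
integral over `t` without summability conditions. -/
theorem CSpace.lintegral_slice (φ : D.CSpace ε) (t : ℝ) :
    ∫⁻ x in Set.Icc (0 : Fin n → ℝ) 1, ‖φ (Grp.mk x t)‖ₑ ^ 2 =
      ∑' ξ : Fin n → ℤ, ‖φ.fourier ξ t‖ₑ ^ 2 := by
  have h := φ.hasSum_fourier t
  have h1 : ∀ z : ℂ, ‖z‖ₑ ^ 2 = ENNReal.ofReal (‖z‖ ^ 2) := fun z => by
    rw [ENNReal.ofReal_pow (norm_nonneg _), ofReal_norm]
  simp only [h1]
  rw [← ENNReal.ofReal_tsum_of_nonneg (fun _ => by positivity) h.summable, h.tsum_eq,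
    ofReal_integral_eq_lintegral_ofReal]
  · exact (((φ.continuous_slice t).norm.pow 2).continuousOn).integrableOn_compact isCompact_Icc
  · exact Filter.Eventually.of_forall fun x => by positivity

theorem lintegral_box (f : D.Grp → ℝ≥0∞) (hf : Measurable f) :
    ∫⁻ p in D.box, f p =
      ∫⁻ t in Set.Icc (0 : ℝ) 1, ∫⁻ x in Set.Icc (0 : Fin n → ℝ) 1, f (Grp.mk x t) := by
  have hbox : volume.restrict D.box = ((volume.restrict (Set.Icc (0 : Fin n → ℝ) 1)).prod
      (volume.restrict (Set.Icc (0 : ℝ) 1)) : Measure ((Fin n → ℝ) × ℝ)) := by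
    rw [box_eq, Measure.prod_restrict, ← Set.pi_univ_Icc]
    rfl
  have hf' : Measurable fun q : (Fin n → ℝ) × ℝ => f (Grp.mk q.1 q.2) := hf
  rw [← lintegral_prod_symm (μ := volume.restrict (Set.Icc (0 : Fin n → ℝ) 1))
      (ν := volume.restrict (Set.Icc (0 : ℝ) 1)) _ hf'.aemeasurable, ← hbox]
  rfl

/-- Parseval's identity on `C(G, ε)`. -/
theorem CSpace.ofReal_norm_sq (φ : D.CSpace ε) : ENNReal.ofReal (‖φ‖ ^ 2) =
    ∑' ξ : Fin n → ℤ, ∫⁻ t in Set.Icc (0 : ℝ) 1, ‖φ.fourier ξ t‖ₑ ^ 2 := by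
  rw [φ.enorm_sq, lintegral_box _ (φ.continuous.measurable.enorm.pow_const 2)]
  simp only [φ.lintegral_slice]
  exact lintegral_tsum fun ξ => ((φ.continuous_fourier ξ).measurable.enorm.pow_const 2).aemeasurable

theorem ofReal_norm_toLp_sq {X : Type} [MeasurableSpace X] {μ : Measure X} {f : X → ℂ}
    (hf : MemLp f 2 μ) : ENNReal.ofReal (‖hf.toLp‖ ^ 2) = ∫⁻ x, ‖f x‖ₑ ^ 2 ∂μ := by
  rw [Lp.norm_toLp, ENNReal.ofReal_pow ENNReal.toReal_nonneg, ENNReal.ofReal_toReal hf.2.ne,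
    eLpNorm_eq_lintegral_rpow_enorm_toReal two_ne_zero ENNReal.ofNat_ne_top]
  simp only [ENNReal.toReal_ofNat, ENNReal.rpow_ofNat]
  rw [← ENNReal.rpow_natCast, ← ENNReal.rpow_mul]
  simp

variable (D ε)

theorem hasSum_norm_fourierC (φ : D.CSpace ε) :
    HasSum (fun ξ : Fin n → ℤ => ‖D.fourierC ε ξ φ‖ ^ 2) (‖φ‖ ^ 2) := by
  have h1 : ∀ ξ, ENNReal.ofReal (‖D.fourierC ε ξ φ‖ ^ 2) =
      ∫⁻ t in Set.Icc (0 : ℝ) 1, ‖φ.fourier ξ t‖ₑ ^ 2 := fun ξ =>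
    ofReal_norm_toLp_sq (φ.memLp_fourier ξ)
  have h2 := φ.ofReal_norm_sq
  simp only [← h1] at h2
  have h4 := ENNReal.hasSum_toReal (f := fun ξ => ENNReal.ofReal (‖D.fourierC ε ξ φ‖ ^ 2))
    (by rw [← h2]; exact ENNReal.ofReal_ne_top)
  rw [← ENNReal.tsum_toReal_eq fun _ => ENNReal.ofReal_ne_top, ← h2] at h4
  simpa only [ENNReal.toReal_ofReal, sq_nonneg] using h4

/-- The space `ℓ²(ℤⁿ; L²([0,1]))`. -/
abbrev Model (n : ℕ) : Type :=
  lp (fun _ : Fin n → ℤ => Lp ℂ 2 (volume.restrict (Set.Icc (0 : ℝ) 1))) 2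

theorem memℓp_fourierC (φ : D.CSpace ε) : Memℓp (fun ξ : Fin n → ℤ => D.fourierC ε ξ φ) 2 := by
  refine (memℓp_gen_iff (by norm_num)).2 ?_
  simpa using (D.hasSum_norm_fourierC ε φ).summable

/-- The isometry `φ ↦ (φ̂(ξ, ·))_ξ` from `C(G, ε)` to `ℓ²(ℤⁿ; L²([0,1]))`. -/
def planCSpace : D.CSpace ε →ₗᵢ[ℂ] Model n where
  toFun φ := ⟨fun ξ => D.fourierC ε ξ φ, D.memℓp_fourierC ε φ⟩
  map_add' φ ψ := by ext1; funext ξ; exact map_add (D.fourierC ε ξ) φ ψ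
  map_smul' c φ := by ext1; funext ξ; exact map_smul (D.fourierC ε ξ) c φ
  norm_map' φ := by
    rw [← sq_eq_sq₀ (norm_nonneg _) (norm_nonneg _)]
    have := lp.norm_rpow_eq_tsum (p := 2) (by norm_num)
      (⟨fun ξ => D.fourierC ε ξ φ, D.memℓp_fourierC ε φ⟩ : Model n)
    simp only [ENNReal.toReal_ofNat, Real.rpow_ofNat] at this
    exact this.trans (D.hasSum_norm_fourierC ε φ).tsum_eq

/-- The isometry `φ ↦ (φ̂(ξ, ·))_ξ` from `L²(G, ε)` to `ℓ²(ℤⁿ; L²([0,1]))`. -/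
def plan : D.L2 ε →ₗᵢ[ℂ] Model n where
  toLinearMap := ((D.planCSpace ε).toContinuousLinearMap.fromCompletion).toLinearMap
  norm_map' φ := by
    induction φ using UniformSpace.Completion.induction_on with
    | hp =>
      exact isClosed_eq ((D.planCSpace ε).toContinuousLinearMap.fromCompletion).continuous.norm
        continuous_norm
    | ih φ =>
      change ‖(D.planCSpace ε).toContinuousLinearMap.fromCompletion (φ : D.L2 ε)‖ = _
      rw [ContinuousLinearMap.fromCompletion_apply_coe]
      exact ((D.planCSpace ε).norm_map φ).trans (UniformSpace.Completion.norm_coe φ).symm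

/-- The coordinates of `plan` and the operators `F_ξ` are extended to the completion separately;
they agree on the dense subspace `C(G, ε)`, hence everywhere. -/
theorem plan_apply (φ : D.L2 ε) (ξ : Fin n → ℤ) : D.plan ε φ ξ = D.F ε ξ φ := by
  induction φ using UniformSpace.Completion.induction_on with
  | hp =>
    refine isClosed_eq ?_ (D.F ε ξ).continuous
    exact (lp.evalCLM ℂ _ 2 ξ).continuous.comp (D.plan ε).continuous
  | ih φ =>
    have h : D.plan ε (φ : D.L2 ε) = D.planCSpace ε φ :=
      ContinuousLinearMap.fromCompletion_apply_coe _ _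
    rw [h, F_coe]; rfl

variable {D ε}

/-- Parseval's identity on `L²(G, ε)`. -/
theorem hasSum_inner_F (φ ψ : D.L2 ε) :
    HasSum (fun ξ : Fin n → ℤ => inner ℂ (D.F ε ξ φ) (D.F ε ξ ψ)) (inner ℂ φ ψ) := by
  rw [← (D.plan ε).inner_map_map]
  simpa only [plan_apply] using lp.hasSum_inner (D.plan ε φ) (D.plan ε ψ)

theorem eq_zero_of_F_eq_zero (φ : D.L2 ε) (h : ∀ ξ, D.F ε ξ φ = 0) : φ = 0 := by
  have := hasSum_inner_F φ φ
  simp only [h, inner_zero_left] at this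
  exact inner_self_eq_zero.1 (this.unique hasSum_zero)

end Data

/-! ## The set `Σ_{ε'}` -/

namespace Data

variable {n : ℕ} {D : Data n} {ε : D.Gam →* Multiplicative (ZMod 2)}

/-- An integral vector, regarded as a real vector. -/
abbrev intVec (ξ : Fin n → ℤ) : Fin n → ℝ := fun i => (ξ i : ℝ)

theorem intVec_injective : Function.Injective (intVec : (Fin n → ℤ) → (Fin n → ℝ)) := by
  intro ξ ξ' h
  funext i
  exact Int.cast_injective (congrFun h i)

theorem exists_intVec_of_mem_Sig {ξ : Fin n → ℝ} (hξ : ξ ∈ D.Sig ε) : ∃ k, ξ = intVec k := by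
  choose k hk using hξ
  refine ⟨fun ν => 2 * k ν + (D.epsPrime ε (Pi.single ν 1)).val, ?_⟩
  funext ν
  rw [hk]; simp

/-- The character `k ↦ e^{πi⟨ξ,k⟩}` of `ℤⁿ`. -/
def latticeChar (ξ : Fin n → ℝ) : (Fin n → ℤ) →+ Additive ℂ where
  toFun k := Additive.ofMul (Complex.exp (Real.pi * I * ((ξ ⬝ᵥ intVec k : ℝ) : ℂ)))
  map_zero' := by
    have : ξ ⬝ᵥ intVec (0 : Fin n → ℤ) = 0 := by simp [dotProduct, intVec]
    rw [this]; simp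
  map_add' k k' := by
    have : ξ ⬝ᵥ intVec (k + k') = ξ ⬝ᵥ intVec k + ξ ⬝ᵥ intVec k' := by
      rw [← dotProduct_add]; congr 1; funext i; simp [intVec]
    rw [this, ← ofMul_mul, ← Complex.exp_add]
    congr 2; push_cast; ring

/-- The character `k ↦ e^{iπε'(k)}` of `ℤⁿ`. -/
def signChar (ε : D.Gam →* Multiplicative (ZMod 2)) : (Fin n → ℤ) →+ Additive ℂ where
  toFun k := Additive.ofMul (D.sign ε (D.gam k 0))
  map_zero' := by
    have : D.gam 0 0 = 1 := Subtype.ext (Grp.ext (by ext i; simp [gam]) (by simp [gam]))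
    rw [this, sign_one]; rfl
  map_add' k k' := by rw [← gam_mul, sign_mul]; rfl

/-- The congruences in `Σ_{ε'}` say that the characters `e^{πi⟨ξ,k⟩}` and `e^{iπε'(k)}` of `ℤⁿ`
agree at the standard basis vectors, and a character is determined there. This coordinate-free form
is the one used below. -/
theorem mem_Sig_iff {ξ : Fin n → ℝ} : ξ ∈ D.Sig ε ↔
    ∀ k : Fin n → ℤ, Complex.exp (Real.pi * I * ((ξ ⬝ᵥ intVec k : ℝ) : ℂ)) =
      D.sign ε (D.gam k 0) := by
  have hpi : (Real.pi * I : ℂ) ≠ 0 := by simp [Real.pi_ne_zero]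
  have h1 : ∀ ν : Fin n, ξ ⬝ᵥ intVec (Pi.single ν 1) = ξ ν := by
    intro ν
    have : intVec (Pi.single ν 1 : Fin n → ℤ) = Pi.single ν 1 := by
      funext i
      by_cases h : i = ν
      · subst h; simp [intVec]
      · simp [intVec, h]
    rw [this]; simp
  have h2 : ∀ ν, (∃ k : ℤ, ξ ν = 2 * (k : ℝ) + ((D.epsPrime ε (Pi.single ν 1)).val : ℝ)) ↔
      Complex.exp (Real.pi * I * ((ξ ⬝ᵥ intVec (Pi.single ν 1) : ℝ) : ℂ)) =
        D.sign ε (D.gam (Pi.single ν 1) 0) := by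
    intro ν
    rw [h1, sign, Complex.exp_eq_exp_iff_exists_int]
    refine exists_congr fun k => ?_
    rw [show I * Real.pi * (((ε (D.gam (Pi.single ν 1) 0)).toAdd.val : ℕ) : ℂ) +
      k * (2 * Real.pi * I) = Real.pi * I * (2 * (k : ℂ) +
        ((D.epsPrime ε (Pi.single ν 1)).val : ℂ)) by rw [epsPrime]; ring, mul_right_inj' hpi]
    exact_mod_cast Iff.rfl
  refine (forall_congr' h2).trans ⟨fun h k => ?_, fun h ν => h _⟩
  have h3 : latticeChar ξ = signChar ε := by
    refine AddMonoidHom.functions_ext' _ _ _ fun ν => AddMonoidHom.ext_int ?_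
    exact congrArg Additive.ofMul (h ν)
  exact congrArg Additive.toMul (DFunLike.congr_fun h3 k)

theorem exists_intVec_transpose_mulVec (D : Data n) (l : ℤ) (k : Fin n → ℤ) :
    ∃ k' : Fin n → ℤ, (D.A l)ᵀ *ᵥ intVec k = intVec k' := by
  obtain ⟨M, hM⟩ := D.A_int l
  refine ⟨(M : Matrix (Fin n) (Fin n) ℤ)ᵀ *ᵥ k, ?_⟩
  rw [hM]
  ext i
  simp [Matrix.mulVec, dotProduct, intVec]

theorem gam_conj (D : Data n) (l : ℤ) (k k' : Fin n → ℤ) (h : D.A l *ᵥ intVec k = intVec k') :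
    D.gam 0 l * D.gam k 0 = D.gam k' 0 * D.gam 0 l := by
  refine Subtype.ext (Grp.ext ?_ ?_)
  · have h' : D.A l *ᵥ (fun i => (k i : ℝ)) = fun i => (k' i : ℝ) := h
    ext i; simp [gam, A_zero, h']
  · simp [gam]

theorem transpose_mulVec_dotProduct (M : Matrix (Fin n) (Fin n) ℝ) (x y : Fin n → ℝ) :
    (Mᵀ *ᵥ x) ⬝ᵥ y = x ⬝ᵥ (M *ᵥ y) := by
  rw [Matrix.dotProduct_mulVec, Matrix.mulVec_transpose]

/-- The relation `(0, l)(k, 0) = (A(l)k, 0)(0, l)` in `Γ` and commutativity of the target of `ε`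
give `ε'(A(l)k) = ε'(k)`; transposing moves `A(l)` from `k` to `ξ`. -/
theorem transpose_mulVec_mem_Sig {ξ : Fin n → ℝ} (hξ : ξ ∈ D.Sig ε) (l : ℤ) :
    (D.A l)ᵀ *ᵥ ξ ∈ D.Sig ε := by
  rw [mem_Sig_iff] at hξ ⊢
  intro k
  obtain ⟨k', hk'⟩ := D.exists_A_int_mulVec l k
  rw [transpose_mulVec_dotProduct, hk', hξ k']
  have h := congrArg (D.sign ε) (gam_conj D l k k' hk')
  rw [sign_mul, sign_mul, mul_comm] at h
  exact (mul_right_cancel₀ (sign_ne_zero _) h).symm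

theorem A_transpose_add (D : Data n) (s t : ℝ) (ξ : Fin n → ℝ) :
    (D.A (s + t))ᵀ *ᵥ ξ = (D.A s)ᵀ *ᵥ ((D.A t)ᵀ *ᵥ ξ) := by
  rw [add_comm, A_add, transpose_mul, mulVec_mulVec]

theorem A_transpose_zero (D : Data n) (ξ : Fin n → ℝ) : (D.A 0)ᵀ *ᵥ ξ = ξ := by
  rw [A_zero, transpose_one, one_mulVec]

/-- Replacing `x` by `x + k/2` multiplies the periodic integrand of `φ̂(ξ, t)` by `e^{iπε'(k)}
e^{-πi⟨ξ,k⟩}`. If `ξ ∉ Σ_{ε'}`, some `k` makes this factor different from `1`, and the integral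
vanishes. -/
theorem F_eq_zero_of_not_mem_Sig {ξ : Fin n → ℤ} (hξ : intVec ξ ∉ D.Sig ε) (φ : D.L2 ε) :
    D.F ε ξ φ = 0 := by
  induction φ using UniformSpace.Completion.induction_on with
  | hp => exact isClosed_eq (D.F ε ξ).continuous continuous_const
  | ih φ =>
    rw [mem_Sig_iff, not_forall] at hξ
    obtain ⟨k, hk⟩ := hξ
    have h : φ.fourier ξ = 0 := by
      funext t
      have hper := Periodic.isPeriodic_exp (-ξ)
      refine Periodic.setIntegral_cube_eq_zero (H := fun x => φ (Grp.mk ((2 : ℝ) • x) t) *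
        Complex.exp (-(2 * Real.pi * I * (((fun i => (ξ i : ℝ)) ⬝ᵥ x : ℝ) : ℂ)))) ?_
        ((1 / 2 : ℝ) • intVec k) (D.sign ε (D.gam k 0) *
          (Complex.exp (Real.pi * I * ((intVec ξ ⬝ᵥ intVec k : ℝ) : ℂ)))⁻¹) ?_ ?_
      · intro m x
        have h1 := φ.isPeriodic_double t m x
        have h2 := hper m x
        have h3 : ∀ y : Fin n → ℝ, (fun i => ((-ξ) i : ℝ)) ⬝ᵥ y = -((fun i => (ξ i : ℝ)) ⬝ᵥ y) := by
          intro y; simp [dotProduct]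
        simp only [h3, Complex.ofReal_neg, mul_neg] at h2
        simp only [h1, h2]
      · intro h
        rw [mul_inv_eq_one₀ (Complex.exp_ne_zero _)] at h
        exact hk h.symm
      · intro x
        have h1 : (2 : ℝ) • (x + (1 / 2 : ℝ) • intVec k) = (2 : ℝ) • x + fun i => (k i : ℝ) := by
          ext i; simp
          ring
        simp only [h1, φ.apply_add_int]
        have h2 : (fun i => (ξ i : ℝ)) ⬝ᵥ (x + (1 / 2 : ℝ) • intVec k) =
          (fun i => (ξ i : ℝ)) ⬝ᵥ x + 1 / 2 * ((fun i => (ξ i : ℝ)) ⬝ᵥ intVec k) := by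
          rw [dotProduct_add, dotProduct_smul, smul_eq_mul]
        rw [h2, ← Complex.exp_neg]
        have h3 : -(2 * Real.pi * I * (((fun i => (ξ i : ℝ)) ⬝ᵥ x +
            1 / 2 * ((fun i => (ξ i : ℝ)) ⬝ᵥ intVec k) : ℝ) : ℂ)) =
          -(Real.pi * I * ((intVec ξ ⬝ᵥ intVec k : ℝ) : ℂ)) +
          -(2 * Real.pi * I * (((fun i => (ξ i : ℝ)) ⬝ᵥ x : ℝ) : ℂ)) := by push_cast; ring
        rw [h3, Complex.exp_add]
        ring
    rw [F_coe]
    refine (Lp.eq_zero_iff_ae_eq_zero).2 ?_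
    filter_upwards [(φ.memLp_fourier ξ).coeFn_toLp] with t ht
    rw [ht, h]

end Data

/-! ## Poincaré series -/

namespace Data

variable {n : ℕ} {D : Data n} {ε : D.Gam →* Multiplicative (ZMod 2)}

/-- The space of continuous functions with compact support on `ℝ`. -/
def Cc : Submodule ℂ (ℝ → ℂ) where
  carrier := {ψ | Continuous ψ ∧ HasCompactSupport ψ}
  add_mem' := fun ⟨h1, h2⟩ ⟨h3, h4⟩ => ⟨h1.add h3, h2.add h4⟩
  zero_mem' := ⟨continuous_const, HasCompactSupport.zero⟩
  smul_mem' := fun c _ ⟨h1, h2⟩ => ⟨h1.const_smul c, h2.smul_left (f := fun _ => c)⟩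

theorem Cc.continuous (ψ : Cc) : Continuous ψ.1 := ψ.2.1

theorem Cc.exists_bound (ψ : Cc) : ∃ R : ℝ, ∀ t, R < |t| → ψ.1 t = 0 := by
  obtain ⟨R, hR⟩ := ψ.2.2.isCompact.isBounded.subset_closedBall 0
  refine ⟨R, fun t ht => ?_⟩
  by_contra h
  have := hR (subset_tsupport _ h)
  rw [mem_closedBall_zero_iff, Real.norm_eq_abs] at this
  linarith

/-- Finiteness holds uniformly for `t` in a bounded interval; this local finiteness makes the
Poincaré series continuous. -/
theorem Cc.finite_ne_zero (ψ : Cc) (a b : ℝ) :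
    {l : ℤ | ∃ t ∈ Set.Icc a b, ψ.1 (l + t) ≠ 0}.Finite := by
  obtain ⟨R, hR⟩ := Cc.exists_bound ψ
  refine (Set.finite_Icc ⌊-R - b⌋ ⌈R - a⌉).subset ?_
  rintro l ⟨t, ht, hl⟩
  have h1 : |(l : ℝ) + t| ≤ R := by
    by_contra h
    exact hl (hR _ (not_le.1 h))
  rw [abs_le] at h1
  constructor
  · have : ((⌊-R - b⌋ : ℤ) : ℝ) ≤ l := (Int.floor_le _).trans (by linarith [ht.2])
    exact_mod_cast this
  · have : (l : ℝ) ≤ ((⌈R - a⌉ : ℤ) : ℝ) := le_trans (by linarith [ht.1]) (Int.le_ceil _)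
    exact_mod_cast this

theorem Cc.finite_ne_zero_at (ψ : Cc) (t : ℝ) : {l : ℤ | ψ.1 (l + t) ≠ 0}.Finite :=
  (Cc.finite_ne_zero ψ t t).subset fun _ hl => ⟨t, Set.left_mem_Icc.2 le_rfl, hl⟩

/-- The function `(x, t) ↦ ψ(t) e^{πi⟨ξ,x⟩}`. -/
def seed (ξ : Fin n → ℝ) (ψ : Cc) (y : D.Grp) : ℂ :=
  ψ.1 y.time * Complex.exp (Real.pi * I * ((ξ ⬝ᵥ y.vec : ℝ) : ℂ))

theorem continuous_seed (ξ : Fin n → ℝ) (ψ : Cc) : Continuous (seed ξ ψ : D.Grp → ℂ) := by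
  have h : Continuous fun y : D.Grp => ξ ⬝ᵥ y.vec := continuous_const.dotProduct Grp.continuous_vec
  have h' : Continuous fun y : D.Grp => ψ.1 y.time := (Cc.continuous ψ).comp Grp.continuous_time
  have h'' : Continuous fun y : D.Grp =>
      Complex.exp (Real.pi * I * ((ξ ⬝ᵥ y.vec : ℝ) : ℂ)) := by fun_prop
  exact h'.mul h''

/-- The condition `ξ ∈ Σ_{ε'}` already gives equivariance under `ℤⁿ`, so that it remains to average
over `ℤ` only. -/
theorem seed_lattice_mul {ξ : Fin n → ℝ} (hξ : ξ ∈ D.Sig ε) (ψ : Cc) (k : Fin n → ℤ) (y : D.Grp) :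
    seed ξ ψ ((D.gam k 0 : D.Grp) * y) = D.sign ε (D.gam k 0) * seed ξ ψ y := by
  rw [← mem_Sig_iff.1 hξ k]
  have h1 : ((D.gam k 0 : D.Grp) * y).time = y.time := by simp [gam]
  have h2 : ((D.gam k 0 : D.Grp) * y).vec = intVec k + y.vec := by simp [gam, A_zero]
  rw [seed, seed, h1, h2, dotProduct_add, Complex.ofReal_add, mul_add, Complex.exp_add]
  ring

/-- The action of `G` on `Cc` underlying `ρ_ξ`. -/
def Cc.act (ξ : Fin n → ℝ) (g : D.Grp) (ψ : Cc) : Cc :=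
  ⟨fun t => phase ξ g t * ψ.1 (t + g.time),
    (continuous_phase_right ξ g).mul ((Cc.continuous ψ).comp (continuous_add_const _)),
    (ψ.2.2.comp_homeomorph (Homeomorph.addRight g.time)).mul_left⟩

/-- Right translation of a seed yields a seed with the same `ξ`, and `ψ` is transformed by the
formula for `ρ_ξ`. This is the origin of the representations `ρ_η` inside `ρ`. -/
theorem seed_mul_right (ξ : Fin n → ℝ) (ψ : Cc) (y g : D.Grp) :
    seed ξ ψ (y * g) = seed ξ (Cc.act ξ g ψ) y := by
  simp only [seed, Cc.act, phase, Grp.time_mul, Grp.vec_mul, dotProduct_add,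
    transpose_mulVec_dotProduct, Complex.ofReal_add, mul_add, Complex.exp_add]
  ring

variable (ε)

/-- The Poincaré series of a seed function. -/
def poincareFun (ξ : Fin n → ℝ) (ψ : Cc) (y : D.Grp) : ℂ :=
  ∑ᶠ l : ℤ, D.sign ε (D.gam 0 l) * seed ξ ψ ((D.gam 0 l : D.Grp) * y)

variable {ε}

/-- The `l`-th term of the series has frequency `A(l)ᵀξ` in `x` and carries the piece of `ψ` near `l
+ t`. -/
theorem seed_translate (ξ : Fin n → ℝ) (ψ : Cc) (l : ℤ) (x : Fin n → ℝ) (t : ℝ) :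
    seed ξ ψ ((D.gam 0 l : D.Grp) * Grp.mk x t) = ψ.1 (l + t) *
      Complex.exp (Real.pi * I * ((((D.A l)ᵀ *ᵥ ξ) ⬝ᵥ x : ℝ) : ℂ)) := by
  have h : ((D.gam 0 l : D.Grp) * Grp.mk x t) = Grp.mk (D.A l *ᵥ x) (l + t) := by
    refine Grp.ext ?_ ?_
    · ext i; simp [gam]
    · simp [gam]
  rw [h, seed, transpose_mulVec_dotProduct]
  rfl

theorem finite_support_seed (ξ : Fin n → ℝ) (ψ : Cc) (y : D.Grp) :
    (Function.support fun l : ℤ =>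
      D.sign ε (D.gam 0 l) * seed ξ ψ ((D.gam 0 l : D.Grp) * y)).Finite := by
  refine (Cc.finite_ne_zero_at ψ y.time).subset fun l hl h => hl ?_
  rw [← Grp.mk_eta y]
  simp only [seed_translate]
  rw [h]; simp

theorem continuous_poincareFun (ξ : Fin n → ℝ) (ψ : Cc) :
    Continuous (poincareFun ε ξ ψ : D.Grp → ℂ) := by
  refine continuous_finsum (fun l => continuous_const.mul
    ((continuous_seed ξ ψ).comp (continuous_const_mul _))) fun y => ?_
  refine ⟨Grp.time ⁻¹' Set.Icc (y.time - 1) (y.time + 1), ?_, ?_⟩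
  · exact Grp.continuous_time.continuousAt.preimage_mem_nhds
      (Icc_mem_nhds (by linarith) (by linarith))
  · refine (Cc.finite_ne_zero ψ (y.time - 1) (y.time + 1)).subset ?_
    rintro l ⟨z, hz, hz'⟩
    refine ⟨z.time, hz', fun h => hz ?_⟩
    rw [← Grp.mk_eta z]
    simp only [seed_translate]
    rw [h]; simp

/-- Write `γ = (k, 0)(0, m)`. Passing `(0, l)` across `(k, 0)` leaves a lattice element of the same
sign, which the seed absorbs; the factor `(0, m)` is absorbed by the substitution `l ↦ l + m`. -/
theorem poincareFun_equivariant {ξ : Fin n → ℝ} (hξ : ξ ∈ D.Sig ε) (ψ : Cc) (γ : D.Gam)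
    (y : D.Grp) : poincareFun ε ξ ψ (γ * y) = D.sign ε γ * poincareFun ε ξ ψ y := by
  obtain ⟨_, k, m, rfl⟩ := γ
  have hγ : (⟨Grp.mk (fun i => (k i : ℝ)) (m : ℝ), k, m, rfl⟩ : D.Gam) =
      D.gam k 0 * D.gam 0 m := by
    refine Subtype.ext (Grp.ext ?_ ?_)
    · ext i; simp [gam, A_zero]
    · simp [gam]
  rw [hγ, poincareFun, poincareFun, ← smul_eq_mul (D.sign ε _), smul_finsum]
  refine Eq.trans ?_ (finsum_comp_equiv (Equiv.addRight m))
  refine finsum_congr fun l => ?_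
  obtain ⟨k', hk'⟩ := D.exists_A_int_mulVec l k
  have h1 := gam_conj D l k k' hk'
  have h2 : ((D.gam 0 l : D.Gam) : D.Grp) * (((D.gam k 0 * D.gam 0 m : D.Gam) : D.Grp) * y) =
      (D.gam k' 0 : D.Grp) * ((D.gam 0 (l + m) : D.Grp) * y) := by
    rw [← gam_zero_mul, Subgroup.coe_mul, Subgroup.coe_mul, ← mul_assoc, ← mul_assoc, ← mul_assoc,
      ← mul_assoc]
    congr 2
    exact congrArg Subtype.val h1
  have h3 := congrArg (D.sign ε) h1
  rw [sign_mul, sign_mul, mul_comm] at h3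
  have h4 := mul_right_cancel₀ (sign_ne_zero _) h3
  simp only [Equiv.coe_addRight, smul_eq_mul]
  rw [h2, seed_lattice_mul hξ, ← h4, ← gam_zero_mul, sign_mul, sign_mul]
  have h5 := sign_mul_self (ε := ε) (D.gam 0 m)
  linear_combination (-(D.sign ε (D.gam 0 l) * D.sign ε (D.gam k 0) *
    seed ξ ψ (((D.gam 0 l * D.gam 0 m : D.Gam) : D.Grp) * y))) * h5

/-- The Poincaré series as a linear map from `Cc` to `C(G, ε)`. -/
def poincare (ξ : D.Sig ε) : Cc →ₗ[ℂ] D.CSpace ε where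
  toFun ψ := ⟨poincareFun ε ξ ψ, continuous_poincareFun _ ψ, poincareFun_equivariant ξ.2 ψ⟩
  map_add' ψ χ := by
    ext y
    change poincareFun ε ξ _ y = poincareFun ε ξ _ y + poincareFun ε ξ _ y
    rw [poincareFun, poincareFun, poincareFun, ← finsum_add_distrib (finite_support_seed _ ψ y)
      (finite_support_seed _ χ y)]
    refine finsum_congr fun l => ?_
    simp only [seed, Submodule.coe_add, Pi.add_apply]; ring
  map_smul' c ψ := by
    ext y
    change poincareFun ε ξ _ y = c * poincareFun ε ξ _ y
    rw [poincareFun, poincareFun, ← smul_eq_mul c, smul_finsum]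
    refine finsum_congr fun l => ?_
    simp only [seed, Submodule.coe_smul, Pi.smul_apply, smul_eq_mul]; ring

theorem poincare_apply (ξ : D.Sig ε) (ψ : Cc) (y : D.Grp) :
    poincare ξ ψ y = ∑ᶠ l : ℤ, D.sign ε (D.gam 0 l) * seed ξ ψ ((D.gam 0 l : D.Grp) * y) := rfl

theorem trans_poincare (ξ : D.Sig ε) (ψ : Cc) (g : D.Grp) :
    CSpace.trans g (poincare ξ ψ) = poincare ξ (Cc.act ξ g ψ) := by
  ext y
  rw [CSpace.trans_apply, poincare_apply, poincare_apply]
  refine finsum_congr fun l => ?_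
  rw [← mul_assoc, seed_mul_right]

-- For fixed `t` the series is a finite sum of exponentials in `x`, and orthogonality of characters
-- of the torus retains the terms with `A(l)ᵀξ = ξ'`. Several `l` may survive when `ξ` has a
-- nontrivial stabiliser.
open Classical in
theorem fourier_poincare (ξ : D.Sig ε) (ψ : Cc) (ξ' : Fin n → ℤ) (t : ℝ) :
    (poincare ξ ψ).fourier ξ' t = ∑ᶠ l : ℤ, if (D.A l)ᵀ *ᵥ (ξ : Fin n → ℝ) = intVec ξ' then
      D.sign ε (D.gam 0 l) * ψ.1 (l + t) else 0 := by
  have hfin := Cc.finite_ne_zero_at ψ t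
  set S := hfin.toFinset
  have hS : ∀ l : ℤ, l ∉ S → ψ.1 (l + t) = 0 := fun l hl => by
    by_contra h
    exact hl (hfin.mem_toFinset.2 h)
  obtain ⟨k, hk⟩ := exists_intVec_of_mem_Sig ξ.2
  -- The frequencies `A(l)ᵀξ` are integral vectors `κ l`, so each term times `e^{-2πi⟨ξ',x⟩}` is a
  -- character of the torus.
  choose κ hκ using fun l : ℤ => exists_intVec_transpose_mulVec D l k
  rw [← hk] at hκ
  have h1 : ∀ x : Fin n → ℝ, poincare ξ ψ (Grp.mk ((2 : ℝ) • x) t) *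
      Complex.exp (-(2 * Real.pi * I * (((fun i => (ξ' i : ℝ)) ⬝ᵥ x : ℝ) : ℂ))) =
      ∑ l ∈ S, D.sign ε (D.gam 0 l) * ψ.1 (l + t) *
        Complex.exp (2 * Real.pi * I * (((fun i => ((κ l - ξ') i : ℝ)) ⬝ᵥ x : ℝ) : ℂ)) := by
    intro x
    rw [poincare_apply, finsum_eq_sum_of_support_subset (s := S), Finset.sum_mul]
    · refine Finset.sum_congr rfl fun l _ => ?_
      rw [seed_translate, hκ, ← mul_assoc, mul_assoc (D.sign ε (D.gam 0 l) * ψ.1 (l + t)),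
        ← Complex.exp_add]
      have : (fun i => ((κ l - ξ') i : ℝ)) ⬝ᵥ x =
          intVec (κ l) ⬝ᵥ x - (fun i => (ξ' i : ℝ)) ⬝ᵥ x := by
        rw [← sub_dotProduct]; congr 1; funext i; simp [intVec]
      rw [this, dotProduct_smul, smul_eq_mul]
      congr 2
      push_cast; ring
    · intro l hl
      by_contra h
      refine hl ?_
      simp only [seed_translate]
      rw [hS l h]; simp
  rw [CSpace.fourier]
  simp only [h1]
  rw [integral_finsetSum]
  · simp only [integral_const_mul, Periodic.setIntegral_cube_exp]
    rw [finsum_eq_sum_of_support_subset (s := S)]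
    · refine Finset.sum_congr rfl fun l _ => ?_
      have : (D.A l)ᵀ *ᵥ (ξ : Fin n → ℝ) = intVec ξ' ↔ κ l - ξ' = 0 := by
        rw [hκ, intVec_injective.eq_iff, sub_eq_zero]
      by_cases h : κ l - ξ' = 0
      · rw [if_pos h, if_pos (this.2 h), mul_one]
      · rw [if_neg h, if_neg (mt this.1 h), mul_zero]
    · intro l hl
      by_contra h
      refine hl ?_
      simp only [hS l h, mul_zero, ite_self]
  · intro l _
    refine Continuous.integrableOn_Icc ?_
    have : Continuous fun x : Fin n → ℝ => (fun i => ((κ l - ξ') i : ℝ)) ⬝ᵥ x :=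
      continuous_const.dotProduct continuous_id
    fun_prop

theorem fourier_poincare_of_not_mem (ξ : D.Sig ε) (ψ : Cc) (ξ' : Fin n → ℤ)
    (h : intVec ξ' ∉ D.zOrbit ξ) (t : ℝ) : (poincare ξ ψ).fourier ξ' t = 0 := by
  classical
  rw [fourier_poincare]
  refine (finsum_congr fun l => ?_).trans (finsum_zero (α := ℤ))
  rw [if_neg fun hl => h ⟨l, hl⟩]

-- If `ψ` is supported in `(0, 1)`, only `l = 0` contributes for `t ∈ [0,1]`. Such series have a
-- single nonzero Fourier coefficient, equal to `ψ`, and serve as test functions for one coordinate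
-- at a time.
open Classical in
theorem fourier_poincare_of_support (ξ : D.Sig ε) (ψ : Cc) (hψ : ∀ t, t ∉ Set.Ioo (0 : ℝ) 1 → ψ.1 t = 0)
    (ξ' : Fin n → ℤ) {t : ℝ} (ht : t ∈ Set.Icc (0 : ℝ) 1) :
    (poincare ξ ψ).fourier ξ' t = if intVec ξ' = (ξ : Fin n → ℝ) then ψ.1 t else 0 := by
  rw [fourier_poincare, finsum_eq_single _ (0 : ℤ)]
  · have h1 : D.gam 0 0 = 1 := Subtype.ext (Grp.ext (by ext i; simp [gam]) (by simp [gam]))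
    rw [Int.cast_zero, A_transpose_zero, h1, sign_one, one_mul, zero_add]
    simp only [eq_comm]
  · intro l hl
    -- From `0 < l + t < 1` and `0 ≤ t ≤ 1` it would follow that `-1 < l < 1`.
    have : ψ.1 (l + t) = 0 := by
      refine hψ _ fun h => hl ?_
      have h2 : ((-1 : ℤ) : ℝ) < l := by push_cast; linarith [h.1, ht.2]
      have h3 : (l : ℝ) < ((1 : ℤ) : ℝ) := by push_cast; linarith [h.2, ht.1]
      have h2 : -1 < l := by exact_mod_cast h2
      have h3 : l < 1 := by exact_mod_cast h3
      omega
    rw [this, mul_zero, ite_self]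

end Data

/-! ## The subspaces `U_θ` -/

namespace Data

variable {n : ℕ} {D : Data n} {ε : D.Gam →* Multiplicative (ZMod 2)}

theorem inner_eq_zero_of_F {φ ψ : (D.rho ε).space}
    (h : ∀ k, D.F ε k φ = 0 ∨ D.F ε k ψ = 0) : inner ℂ φ ψ = 0 := by
  have h1 : HasSum (fun k : Fin n → ℤ => inner ℂ (D.F ε k φ) (D.F ε k ψ)) (inner ℂ φ ψ) :=
    hasSum_inner_F (D := D) (ε := ε) φ ψ
  have h2 : ∀ k, inner ℂ (D.F ε k φ) (D.F ε k ψ) = 0 := fun k => by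
    rcases h k with h | h <;> simp [h]
  simp only [h2] at h1
  exact h1.unique hasSum_zero

theorem mem_U_iff {θ : Set (Fin n → ℝ)} {φ : (D.rho ε).space} :
    φ ∈ D.U ε θ ↔ ∀ k : Fin n → ℤ, intVec k ∉ θ → D.F ε k φ = 0 := by
  simp only [U, Submodule.mem_iInf]
  exact Iff.rfl

/-- The inclusion of `C(G, ε)` into the space of `ρ`. -/
def incl : D.CSpace ε →ₗᵢ[ℂ] (D.rho ε).space :=
  (UniformSpace.Completion.toComplₗᵢ : D.CSpace ε →ₗᵢ[ℂ] D.L2 ε)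

theorem incl_apply (φ : D.CSpace ε) : incl φ = (φ : D.L2 ε) := rfl

theorem F_incl_ae (k : Fin n → ℤ) (φ : D.CSpace ε) :
    D.F ε k (incl φ) =ᵐ[volume.restrict (Set.Icc (0 : ℝ) 1)] φ.fourier k := by
  rw [incl_apply, F_coe]
  exact MemLp.coeFn_toLp _

theorem F_incl_eq_zero {k : Fin n → ℤ} {φ : D.CSpace ε} (h : ∀ t ∈ Set.Icc (0 : ℝ) 1, φ.fourier k t = 0) :
    D.F ε k (incl φ) = 0 := by
  refine (Lp.eq_zero_iff_ae_eq_zero).2 ?_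
  filter_upwards [F_incl_ae k φ, ae_restrict_mem measurableSet_Icc] with t ht ht'
  rw [ht, h t ht']; rfl

theorem rho_op_incl (g : D.Grp) (φ : D.CSpace ε) :
    (D.rho ε).op g (incl φ) = incl (CSpace.trans g φ) := rho_op_coe D ε g φ

theorem incl_poincare_mem_U (ξ : D.Sig ε) (ψ : Cc) :
    incl (poincare ξ ψ) ∈ D.U ε (D.zOrbit ξ) :=
  mem_U_iff.2 fun k hk => F_incl_eq_zero fun t _ => fourier_poincare_of_not_mem ξ ψ k hk t

/-- A smooth real function with compact support, as an element of `Cc`. -/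
def Cc.ofReal (g : ℝ → ℝ) (hg : Continuous g) (hc : HasCompactSupport g) : Cc :=
  ⟨fun t => (g t : ℂ), Complex.continuous_ofReal.comp hg, hc.comp_left Complex.ofReal_zero⟩

/-- For smooth `ψ` supported in `(0, 1)`, Parseval reduces the inner product with the Poincaré
series to `∫ ψ F_k φ`. Its vanishing for all such `ψ` forces `F_k φ = 0` by the fundamental lemma of
the calculus of variations. -/
theorem F_eq_zero_of_orthogonal {ξ : D.Sig ε} {φ : (D.rho ε).space}
    (h : ∀ ψ : Cc, inner ℂ (incl (poincare ξ ψ)) φ = 0) {k : Fin n → ℤ}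
    (hk : intVec k = (ξ : Fin n → ℝ)) : D.F ε k φ = 0 := by
  have hint : ∀ g : ℝ → ℝ, ContDiff ℝ (⊤ : ℕ∞) g → HasCompactSupport g →
      tsupport g ⊆ Set.Ioo (0 : ℝ) 1 →
      ∫ t, g t • D.F ε k φ t ∂(volume.restrict (Set.Icc (0 : ℝ) 1)) = 0 := by
    intro g hg hc hs
    set ψ := Cc.ofReal g hg.continuous hc
    have hψ : ∀ t, t ∉ Set.Ioo (0 : ℝ) 1 → ψ.1 t = 0 := by
      intro t ht
      change ((g t : ℝ) : ℂ) = 0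
      rw [image_eq_zero_of_notMem_tsupport fun h => ht (hs h), Complex.ofReal_zero]
    have h1 : HasSum (fun k : Fin n → ℤ => inner ℂ (D.F ε k (incl (poincare ξ ψ))) (D.F ε k φ))
      (inner ℂ (incl (poincare ξ ψ)) φ) := hasSum_inner_F (D := D) (ε := ε) _ φ
    rw [h ψ] at h1
    have h2 := h1.unique (hasSum_single k fun k' hk' => by
      rw [F_incl_eq_zero, inner_zero_left]
      intro t ht
      rw [fourier_poincare_of_support ξ ψ hψ k' ht, if_neg]
      rw [← hk, intVec_injective.eq_iff]
      exact hk')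
    rw [L2.inner_def] at h2
    refine (integral_congr_ae ?_).trans h2.symm
    filter_upwards [F_incl_ae k (poincare ξ ψ), ae_restrict_mem measurableSet_Icc] with t ht ht'
    rw [ht, fourier_poincare_of_support ξ ψ hψ k ht', if_pos hk]
    change _ = D.F ε k φ t * (starRingEnd ℂ) ((g t : ℝ) : ℂ)
    rw [Complex.conj_ofReal, Complex.real_smul, mul_comm]
  have h3 := isOpen_Ioo.ae_eq_zero_of_integral_contDiff_smul_eq_zero
    (((Lp.memLp (D.F ε k φ)).integrable one_le_two).locallyIntegrable.locallyIntegrableOn _) hint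
  refine (Lp.eq_zero_iff_ae_eq_zero).2 ?_
  have h4 : ∀ᵐ t ∂(volume.restrict (Set.Icc (0 : ℝ) 1)), t ∈ Set.Ioo (0 : ℝ) 1 := by
    rw [← restrict_Ioo_eq_restrict_Icc]
    exact ae_restrict_mem measurableSet_Ioo
  filter_upwards [h3, h4] with t h5 h6
  exact h5 h6

/-- `A(l)ᵀξ` as an element of `Σ_{ε'}`. -/
def shift (l : ℤ) (ξ : D.Sig ε) : D.Sig ε :=
  ⟨(D.A l)ᵀ *ᵥ (ξ : Fin n → ℝ), transpose_mulVec_mem_Sig ξ.2 l⟩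

/-- Translation on `Cc`. -/
def Cc.translate (s : ℝ) (ψ : Cc) : Cc :=
  ⟨fun t => ψ.1 (t + s), (Cc.continuous ψ).comp (continuous_add_const _),
    ψ.2.2.comp_homeomorph (Homeomorph.addRight s)⟩

/-- Passing to another point of the `ℤ`-orbit only reindexes the series, up to a sign and a
translation of `ψ`. Hence orthogonality to the series of `ξ` controls the Fourier coefficients at
all points of the orbit. -/
theorem poincare_shift (l : ℤ) (ξ : D.Sig ε) (ψ : Cc) :
    poincare (shift l ξ) ψ = D.sign ε (D.gam 0 l) • poincare ξ (Cc.translate (-l) ψ) := by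
  ext y
  rw [← Grp.mk_eta y, CSpace.smul_apply, poincare_apply, poincare_apply, ← smul_eq_mul, smul_finsum]
  refine Eq.trans ?_ (finsum_comp_equiv (Equiv.addRight l))
  refine finsum_congr fun m => ?_
  simp only [seed_translate, shift, Equiv.coe_addRight, Cc.translate, smul_eq_mul]
  rw [← A_transpose_add, ← gam_zero_mul, sign_mul]
  have h5 := sign_mul_self (ε := ε) (D.gam 0 l)
  have h6 : ((m + l : ℤ) : ℝ) + y.time + -l = m + y.time := by push_cast; ring
  rw [h6]
  push_cast
  generalize Complex.exp _ = E
  linear_combination (-(D.sign ε (D.gam 0 m) * ψ.1 (m + y.time) * E)) * h5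

/-- The space of all Poincaré series attached to `ξ`. -/
def poincareRange (ξ : D.Sig ε) : Submodule ℂ (D.rho ε).space :=
  LinearMap.range (incl.toLinearMap ∘ₗ poincare ξ)

/-- A vector orthogonal to all Poincaré series of `ξ` has vanishing coefficients on the orbit, while
a vector of `U_θ` has vanishing coefficients off it. By Parseval the two are orthogonal, so `U_θ`
lies in the double orthogonal complement of the Poincaré series, which is their closure. -/
theorem U_eq_closure (ξ : D.Sig ε) :
    D.U ε (D.zOrbit ξ) = (poincareRange ξ).topologicalClosure := by
  refine le_antisymm ?_ ?_
  · rw [← Submodule.orthogonal_orthogonal_eq_closure]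
    intro φ hφ
    rw [Submodule.mem_orthogonal]
    intro w hw
    refine inner_eq_zero_of_F fun k => ?_
    by_cases hk : intVec k ∈ D.zOrbit ξ
    · left
      obtain ⟨l, hl⟩ := hk
      refine F_eq_zero_of_orthogonal (ξ := shift l ξ) (fun ψ => ?_) hl.symm
      rw [poincare_shift, map_smul, inner_smul_left]
      refine mul_eq_zero_of_right _ ?_
      exact (Submodule.mem_orthogonal _ _).1 hw _ ⟨_, rfl⟩
    · right
      exact mem_U_iff.1 hφ k hk
  · refine Submodule.topologicalClosure_minimal _ ?_ (D.isClosed_U ε _)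
    rintro _ ⟨ψ, rfl⟩
    exact incl_poincare_mem_U ξ ψ

theorem exists_eq_zOrbit {θ : Set (Fin n → ℝ)} (hθ : θ ∈ D.zOrbitsIn (D.Sig ε)) :
    ∃ ξ : D.Sig ε, θ = D.zOrbit ξ := by
  obtain ⟨⟨ξ, rfl⟩, h⟩ := hθ
  exact ⟨⟨ξ, h ⟨0, by simp only [Int.cast_zero, A_transpose_zero]⟩⟩, rfl⟩

theorem mem_zOrbit_self (D : Data n) (ξ : Fin n → ℝ) : ξ ∈ D.zOrbit ξ :=
  ⟨0, by simp only [Int.cast_zero, A_transpose_zero]⟩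

theorem zOrbit_subset_Sig (ξ : D.Sig ε) : D.zOrbit ξ ⊆ D.Sig ε := by
  rintro _ ⟨l, rfl⟩
  exact transpose_mulVec_mem_Sig ξ.2 l

theorem zOrbit_eq_of_mem {ξ η : Fin n → ℝ} (h : η ∈ D.zOrbit ξ) : D.zOrbit η = D.zOrbit ξ := by
  obtain ⟨l, rfl⟩ := h
  refine Set.Subset.antisymm ?_ ?_
  · rintro _ ⟨m, rfl⟩
    refine ⟨m + l, ?_⟩
    push_cast
    exact A_transpose_add D m l ξ
  · rintro _ ⟨m, rfl⟩
    refine ⟨m - l, ?_⟩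
    dsimp only
    rw [← A_transpose_add]
    push_cast
    rw [sub_add_cancel]

theorem zOrbit_disjoint {ξ η ζ : Fin n → ℝ} (h1 : ζ ∈ D.zOrbit ξ) (h2 : ζ ∈ D.zOrbit η) :
    D.zOrbit ξ = D.zOrbit η := (zOrbit_eq_of_mem h1).symm.trans (zOrbit_eq_of_mem h2)

/-- Invariance is not visible from the definition, since translation in time moves the interval
`[0,1]`. It is checked on Poincaré series, which are dense in `U_θ` and are permuted by right
translations. -/
theorem rho_op_mem_U {θ : Set (Fin n → ℝ)} (hθ : θ ∈ D.zOrbitsIn (D.Sig ε)) (g : D.Grp)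
    (φ : (D.rho ε).space) (hφ : φ ∈ D.U ε θ) : (D.rho ε).op g φ ∈ D.U ε θ := by
  obtain ⟨ξ, rfl⟩ := exists_eq_zOrbit hθ
  have h : IsClosed ((D.rho ε).op g ⁻¹' (D.U ε (D.zOrbit ξ) : Set (D.rho ε).space)) :=
    (D.isClosed_U ε _).preimage ((D.rho ε).op g).continuous
  have h2 : (poincareRange ξ : Set (D.rho ε).space) ⊆
      (D.rho ε).op g ⁻¹' (D.U ε (D.zOrbit ξ) : Set (D.rho ε).space) := by
    rintro _ ⟨ψ, rfl⟩
    change (D.rho ε).op g (incl (poincare ξ ψ)) ∈ D.U ε (D.zOrbit ξ)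
    rw [rho_op_incl, trans_poincare]
    exact incl_poincare_mem_U _ _
  rw [U_eq_closure] at hφ
  exact closure_minimal h2 h hφ

theorem orthogonalFamily_U : OrthogonalFamily ℂ (fun θ : D.zOrbitsIn (D.Sig ε) => D.U ε θ)
    (fun θ : D.zOrbitsIn (D.Sig ε) => (D.U ε θ).subtypeₗᵢ) := by
  intro θ θ' hne φ ψ
  refine inner_eq_zero_of_F fun k => ?_
  by_cases hk : intVec k ∈ (θ : Set (Fin n → ℝ))
  · right
    refine mem_U_iff.1 ψ.2 k fun hk' => hne (Subtype.ext ?_)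
    obtain ⟨ξ, hξ⟩ := exists_eq_zOrbit θ.2
    obtain ⟨ξ', hξ'⟩ := exists_eq_zOrbit θ'.2
    rw [hξ] at hk ⊢
    rw [hξ'] at hk' ⊢
    exact zOrbit_disjoint hk hk'
  · left
    exact mem_U_iff.1 φ.2 k hk

/-- A vector orthogonal to all `U_θ` is orthogonal to all Poincaré series, so its coefficients on
`Σ_{ε'}` vanish; those off `Σ_{ε'}` always do. -/
theorem iSup_U_topologicalClosure :
    (⨆ θ : D.zOrbitsIn (D.Sig ε), D.U ε θ).topologicalClosure = ⊤ := by
  rw [Submodule.topologicalClosure_eq_top_iff, Submodule.eq_bot_iff]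
  intro φ hφ
  refine eq_zero_of_F_eq_zero (D := D) (ε := ε) φ fun k => ?_
  by_cases hk : intVec k ∈ D.Sig ε
  · refine F_eq_zero_of_orthogonal (ξ := ⟨intVec k, hk⟩) (fun ψ => ?_) rfl
    refine (Submodule.mem_orthogonal _ _).1 hφ _ ?_
    exact Submodule.mem_iSup_of_mem (p := fun θ : D.zOrbitsIn (D.Sig ε) => D.U ε θ)
      ⟨D.zOrbit (intVec k), ⟨_, rfl⟩, zOrbit_subset_Sig ⟨intVec k, hk⟩⟩
      (incl_poincare_mem_U ⟨intVec k, hk⟩ ψ)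
  · exact F_eq_zero_of_not_mem_Sig (D := D) (ε := ε) hk φ

theorem isHilbertSum_U : IsHilbertSum ℂ (fun θ : D.zOrbitsIn (D.Sig ε) => D.U ε θ)
    (fun θ : D.zOrbitsIn (D.Sig ε) => (D.U ε θ).subtypeₗᵢ) := by
  have : ∀ θ : D.zOrbitsIn (D.Sig ε), CompleteSpace (D.U ε θ) := fun θ =>
    (D.isClosed_U ε θ).completeSpace_coe
  exact IsHilbertSum.mkInternal _ orthogonalFamily_U iSup_U_topologicalClosure.ge

end Data

/-! ## Constructing unitary equivalences -/

namespace UnitaryRep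

variable {G : Type} [Group G] [TopologicalSpace G]

theorem Equivalent.symm {π σ : UnitaryRep G} (h : π.Equivalent σ) : σ.Equivalent π := by
  obtain ⟨T, hT⟩ := h
  refine ⟨T.symm, fun g v => T.injective ?_⟩
  rw [hT, T.apply_symm_apply, T.apply_symm_apply]

theorem Equivalent.trans {π σ τ : UnitaryRep G} (h : π.Equivalent σ) (h' : σ.Equivalent τ) :
    π.Equivalent τ := by
  obtain ⟨T, hT⟩ := h
  obtain ⟨S, hS⟩ := h'
  exact ⟨T.trans S, fun g v => by
    rw [LinearIsometryEquiv.trans_apply, LinearIsometryEquiv.trans_apply, hT, hS]⟩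

/-- A Hilbert sum of intertwining isometries gives a unitary equivalence with the direct sum. -/
theorem equivalent_directSum {ι : Type} {π : UnitaryRep G} (σ : ι → UnitaryRep G)
    (V : ∀ i, (σ i).space →ₗᵢ[ℂ] π.space)
    (hV : IsHilbertSum ℂ (fun i => (σ i).space) V)
    (hop : ∀ i g v, V i ((σ i).op g v) = π.op g (V i v)) :
    π.Equivalent (directSum σ) := by
  refine Equivalent.symm ⟨hV.linearIsometryEquiv.symm, fun g f => ?_⟩
  have h1 := hV.hasSum_linearIsometryEquiv_symm ((directSum σ).op g f)
  have h2 := (hV.hasSum_linearIsometryEquiv_symm f).map (π.op g) (π.op g).continuous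
  have h3 : HasSum (fun i => V i ((show lp (fun i => (σ i).space) 2 from (directSum σ).op g f) i))
      (π.op g (hV.linearIsometryEquiv.symm f)) := h2.congr_fun fun i => ?_
  · exact h1.unique h3
  exact hop i g ((show lp (fun i => (σ i).space) 2 from f) i)

/-- Refinement of an orthogonal decomposition: isometries whose ranges decompose every summand. -/
theorem isHilbertSum_of_fibers {ι Θ E : Type} [NormedAddCommGroup E] [InnerProductSpace ℂ E]
    [CompleteSpace E] {H : ι → Type} [∀ i, NormedAddCommGroup (H i)]
    [∀ i, InnerProductSpace ℂ (H i)] [∀ i, CompleteSpace (H i)] (W : Θ → Submodule ℂ E)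
    (hW : OrthogonalFamily ℂ (fun θ => W θ) (fun θ => (W θ).subtypeₗᵢ))
    (hWt : (⨆ θ, W θ).topologicalClosure = ⊤) (V : ∀ i, H i →ₗᵢ[ℂ] E) (p : ι → Θ)
    (hVW : ∀ i v, V i v ∈ W (p i))
    (hV : ∀ i j, i ≠ j → p i = p j → ∀ v w, inner ℂ (V i v) (V j w) = 0)
    (hVt : ∀ θ, ∀ u ∈ W θ, (∀ i, p i = θ → ∀ v, inner ℂ (V i v) u = 0) → u = 0)
    (hWc : ∀ θ, IsClosed (W θ : Set E)) :
    IsHilbertSum ℂ H V := by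
  have hW' : ∀ θ θ', θ ≠ θ' → ∀ u ∈ W θ, ∀ u' ∈ W θ', inner ℂ u u' = 0 :=
    fun θ θ' h u hu u' hu' => hW h ⟨u, hu⟩ ⟨u', hu'⟩
  refine IsHilbertSum.mk (fun i j hij v w => ?_) ?_
  · by_cases h : p i = p j
    · exact hV i j hij h v w
    · exact hW' _ _ h _ (hVW i v) _ (hVW j w)
  · rw [top_le_iff, Submodule.topologicalClosure_eq_top_iff, Submodule.eq_bot_iff]
    intro u hu
    have hV0 : ∀ i v, inner ℂ (V i v) u = 0 := fun i v =>
      (Submodule.mem_orthogonal _ _).1 hu _ (Submodule.mem_iSup_of_mem i ⟨v, rfl⟩)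
    have hWt' := (Submodule.topologicalClosure_eq_top_iff).1 hWt
    rw [Submodule.eq_bot_iff] at hWt'
    refine hWt' u ?_
    rw [Submodule.mem_orthogonal]
    intro w hw
    induction hw using Submodule.iSup_induction' with
    | zero => exact inner_zero_left _
    | add a b _ _ ha hb => rw [inner_add_left, ha, hb, add_zero]
    | mem θ w hw =>
      have : CompleteSpace (W θ) := (hWc θ).completeSpace_coe
      -- Since `V i v` lies in `W θ`, replacing `u` by its projection to `W θ` does not change the
      -- inner product with `V i v`; the totality assumption then applies inside `W θ`.
      have h1 : (W θ).starProjection u = 0 := by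
        refine hVt θ _ (Submodule.starProjection_apply_mem _ _) ?_
        rintro i rfl v
        have h2 := Submodule.starProjection_inner_eq_zero u (V i v) (hVW i v)
        have h3 := hV0 i v
        rw [inner_sub_left, sub_eq_zero] at h2
        rw [← inner_conj_symm, ← h2, inner_conj_symm, h3]
      have h2 := Submodule.starProjection_inner_eq_zero u w hw
      rw [h1, sub_zero] at h2
      rw [← inner_conj_symm, h2, map_zero]

/-- Two linearly parametrised dense families of vectors with the same norms give a unitary map. -/
theorem exists_linearIsometryEquiv_of_dense {M H K : Type} [AddCommGroup M] [Module ℂ M]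
    [NormedAddCommGroup H] [InnerProductSpace ℂ H] [CompleteSpace H]
    [NormedAddCommGroup K] [InnerProductSpace ℂ K] [CompleteSpace K]
    (a : M →ₗ[ℂ] H) (b : M →ₗ[ℂ] K) (ha : DenseRange a) (hb : DenseRange b)
    (hab : ∀ m, ‖a m‖ = ‖b m‖) : ∃ T : H ≃ₗᵢ[ℂ] K, ∀ m, T (a m) = b m :=
  ⟨(LinearEquiv.refl ℂ M).extendOfIsometry a b ha hb fun m => (hab m).symm, fun m =>
    LinearEquiv.extendOfIsometry_eq _ _ _ ha hb _ m⟩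

/-- Criterion for unitary equivalence by means of dense families of vectors. -/
theorem equivalent_of_dense {M : Type} [AddCommGroup M] [Module ℂ M] {π σ : UnitaryRep G}
    (a : M →ₗ[ℂ] π.space) (b : M →ₗ[ℂ] σ.space) (ha : DenseRange a) (hb : DenseRange b)
    (hab : ∀ m, ‖a m‖ = ‖b m‖) (act : G → M → M) (hact : ∀ g m, π.op g (a m) = a (act g m))
    (hact' : ∀ g m, σ.op g (b m) = b (act g m)) : π.Equivalent σ := by
  obtain ⟨T, hT⟩ := exists_linearIsometryEquiv_of_dense a b ha hb hab
  refine ⟨T, fun g v => ?_⟩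
  -- Both sides are continuous in `v`, so they need to be compared only on the dense range of `a`.
  refine congrFun (ha.equalizer (T.continuous.comp (π.op g).continuous)
    ((σ.op g).continuous.comp T.continuous) (funext fun m => ?_)) v
  simp only [Function.comp_apply]
  rw [hact, hT, hT, hact']

end UnitaryRep

/-! ## The representations `ρ_θ` on infinite orbits -/

namespace Data

variable {n : ℕ} {D : Data n} {ε : D.Gam →* Multiplicative (ZMod 2)}

theorem Cc.memLp (ψ : Cc) : MemLp ψ.1 2 (volume : Measure ℝ) :=
  (Cc.continuous ψ).memLp_of_hasCompactSupport ψ.2.2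

/-- The inclusion of `Cc` into `L²(ℝ)`. -/
def Cc.toL2 : Cc →ₗ[ℂ] Lp ℂ 2 (volume : Measure ℝ) where
  toFun ψ := (Cc.memLp ψ).toLp
  map_add' ψ χ := MemLp.toLp_add (Cc.memLp ψ) (Cc.memLp χ)
  map_smul' c ψ := MemLp.toLp_const_smul c (Cc.memLp ψ)

theorem Cc.denseRange_toL2 : DenseRange Cc.toL2 := by
  intro f
  rw [Metric.mem_closure_iff]
  intro e he
  obtain ⟨g, hg1, hg2, hg3, hg4⟩ := (Lp.memLp f).exists_hasCompactSupport_eLpNorm_sub_le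
    ENNReal.ofNat_ne_top (ε := ENNReal.ofReal (e / 2)) (by simp [he])
  refine ⟨_, ⟨⟨g, hg3, hg1⟩, rfl⟩, ?_⟩
  change dist f hg4.toLp < e
  rw [Lp.dist_def]
  have h1 : eLpNorm (⇑f - ⇑hg4.toLp) 2 volume = eLpNorm (⇑f - g) 2 volume :=
    eLpNorm_congr_ae (Filter.EventuallyEq.rfl.sub hg4.coeFn_toLp)
  rw [h1]
  calc _ ≤ (ENNReal.ofReal (e / 2)).toReal := ENNReal.toReal_mono ENNReal.ofReal_ne_top hg2
    _ = e / 2 := ENNReal.toReal_ofReal (by positivity)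
    _ < e := by linarith

theorem Cc.toL2_act (η : Fin n → ℝ) (g : D.Grp) (ψ : Cc) :
    (D.rhoEta η).op g (Cc.toL2 ψ) = Cc.toL2 (Cc.act η g ψ) := by
  change etaOp η g (Cc.toL2 ψ) = _
  refine Lp.ext ?_
  filter_upwards [etaOp_ae η g (Cc.toL2 ψ), (Cc.memLp (Cc.act η g ψ)).coeFn_toLp,
    ae_shift (Cc.memLp ψ).coeFn_toLp g.time] with t h1 h2 h3
  refine h1.trans (Eq.trans ?_ h2.symm)
  exact congrArg _ h3

/-- The half-open intervals `(l, l + 1]` tile the line. -/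
theorem lintegral_eq_tsum_translate (f : ℝ → ℝ≥0∞) :
    ∑' l : ℤ, ∫⁻ t in Set.Icc (0 : ℝ) 1, f (l + t) = ∫⁻ t, f t := by
  have h1 : ∀ l : ℤ, ∫⁻ t in Set.Icc (0 : ℝ) 1, f (l + t) =
      ∫⁻ t in Set.Ioc (l : ℝ) (l + 1), f t := by
    intro l
    rw [← restrict_Ioc_eq_restrict_Icc]
    have h := (measurePreserving_add_left volume (l : ℝ)).setLIntegral_comp_preimage_emb
      (measurableEmbedding_addLeft (l : ℝ)) f (Set.Ioc (l : ℝ) (l + 1))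
    rw [← h]
    congr 2
    ext t; simp
  simp only [h1]
  rw [← lintegral_iUnion (fun l => measurableSet_Ioc) (Set.pairwise_disjoint_Ioc_intCast ℝ),
    iUnion_Ioc_intCast, Measure.restrict_univ]

theorem norm_sign_enorm (γ : D.Gam) : ‖D.sign ε γ‖ₑ = 1 := by
  rw [← ofReal_norm, norm_sign, ENNReal.ofReal_one]

/-- When the points `A(l)ᵀξ` are distinct, each frequency of the series receives exactly one term,
of square norm `∫₀¹ |ψ(l + t)|² dt`. Parseval adds these up to `∫ |ψ|²` over `ℝ`. At a fixed point
the terms would share one frequency and interfere. -/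
theorem norm_poincare (ξ : D.Sig ε)
    (hξ : Function.Injective fun l : ℤ => (D.A l)ᵀ *ᵥ (ξ : Fin n → ℝ)) (ψ : Cc) :
    ‖poincare ξ ψ‖ = ‖Cc.toL2 ψ‖ := by
  classical
  obtain ⟨k, hk⟩ := exists_intVec_of_mem_Sig ξ.2
  choose κ hκ using fun l : ℤ => exists_intVec_transpose_mulVec D l k
  rw [← hk] at hκ
  have hκi : Function.Injective κ := fun l m h => hξ (by
    simp only [hκ, h])
  have h1 : ENNReal.ofReal (‖poincare ξ ψ‖ ^ 2) = ENNReal.ofReal (‖Cc.toL2 ψ‖ ^ 2) := by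
    refine Eq.trans ?_ (ofReal_norm_toLp_sq (Cc.memLp ψ)).symm
    rw [CSpace.ofReal_norm_sq, ← lintegral_eq_tsum_translate fun t => ‖ψ.1 t‖ₑ ^ 2,
      ← hκi.tsum_eq]
    · refine tsum_congr fun l => lintegral_congr fun t => ?_
      rw [fourier_poincare, finsum_eq_single _ l]
      · rw [if_pos (hκ l), enorm_mul, norm_sign_enorm, one_mul]
      · intro m hm
        rw [if_neg]
        rw [← hκ l]
        exact fun h => hm (hξ h)
    -- Frequencies outside the range of `κ` are not in the orbit and contribute nothing, so the sum
    -- over `ℤⁿ` can be reindexed by `ℤ`.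
    · intro ξ' hξ'
      by_contra h
      refine hξ' ?_
      have : ∀ t, (poincare ξ ψ).fourier ξ' t = 0 := fun t =>
        fourier_poincare_of_not_mem ξ ψ ξ' (by
          rintro ⟨l, hl⟩
          refine h ⟨l, intVec_injective ?_⟩
          rw [← hκ]; exact hl) t
      simp [this]
  rw [ENNReal.ofReal_eq_ofReal_iff (by positivity) (by positivity)] at h1
  exact (pow_left_inj₀ (norm_nonneg _) (norm_nonneg _) two_ne_zero).1 h1

/-- If the `ℤ`-orbit `θ` of `ξ` is infinite, then `ρ_θ ≅ ρ_ξ`. -/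
theorem rhoTheta_equivalent_rhoEta (ξ : D.Sig ε)
    (hξ : Function.Injective fun l : ℤ => (D.A l)ᵀ *ᵥ (ξ : Fin n → ℝ))
    (hinv : ∀ (g : D.Grp), ∀ φ ∈ D.U ε (D.zOrbit ξ), (D.rho ε).op g φ ∈ D.U ε (D.zOrbit ξ)) :
    (D.rhoTheta ε (D.zOrbit ξ) hinv).Equivalent (D.rhoEta ξ) := by
  let b : Cc →ₗ[ℂ] D.U ε (D.zOrbit ξ) :=
    (incl.toLinearMap ∘ₗ poincare ξ).codRestrict _ (incl_poincare_mem_U ξ)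
  refine UnitaryRep.equivalent_of_dense (M := Cc) (π := D.rhoTheta ε (D.zOrbit ξ) hinv)
    (σ := D.rhoEta ξ) b Cc.toL2 ?_ Cc.denseRange_toL2 ?_ (Cc.act ξ) ?_ (Cc.toL2_act _)
  · have h : Dense (Set.range b) := by
      rw [Subtype.dense_iff]
      intro φ hφ
      have h1 : φ ∈ (poincareRange ξ).topologicalClosure := by rw [← U_eq_closure]; exact hφ
      refine closure_mono ?_ h1
      rintro _ ⟨ψ, rfl⟩
      exact ⟨b ψ, ⟨ψ, rfl⟩, rfl⟩
    exact h
  · intro ψ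
    have h : ‖incl (poincare ξ ψ)‖ = ‖Cc.toL2 ψ‖ := by
      rw [incl.norm_map, norm_poincare ξ hξ]
    exact h
  · intro g ψ
    refine Subtype.ext ?_
    have h := rho_op_incl g (poincare ξ ψ)
    rw [trans_poincare] at h
    exact h

/-- The representations `ρ_η` attached to the points of an orbit are equivalent. -/
theorem rhoEta_equivalent_translate (η : Fin n → ℝ) (s : ℝ) :
    (D.rhoEta η).Equivalent (D.rhoEta ((D.A s)ᵀ *ᵥ η)) := by
  -- The intertwiner is translation by `s`; this is `ρ_η(0, s)`, whose phase is trivial.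
  refine ⟨(D.rhoEta η).op (Grp.mk 0 s), fun g ψ => ?_⟩
  change etaOp η (Grp.mk 0 s) (etaOp η g ψ) = etaOp _ g (etaOp η (Grp.mk 0 s) ψ)
  have h0 : ∀ χ : Lp ℂ 2 (volume : Measure ℝ), ∀ᵐ t, etaOp η (Grp.mk 0 s : D.Grp) χ t = χ (t + s) := by
    intro χ
    filter_upwards [etaOp_ae η (Grp.mk 0 s : D.Grp) χ] with t h
    rw [h]; simp [phase]
  refine Lp.ext ?_
  filter_upwards [h0 (etaOp η g ψ), etaOp_ae ((D.A s)ᵀ *ᵥ η) g (etaOp η (Grp.mk 0 s) ψ),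
    ae_shift (h0 ψ) g.time, ae_shift (etaOp_ae η g ψ) s] with t h1 h2 h3 h4
  rw [h1, h2, h3, h4, phase, phase, A_transpose_add, add_right_comm]

theorem rhoEta_equivalent_of_mem {ω : Set (Fin n → ℝ)} {η₀ η η' : Fin n → ℝ}
    (hω : ω = D.rOrbit η₀) (hη : η ∈ ω) (hη' : η' ∈ ω) :
    (D.rhoEta η).Equivalent (D.rhoEta η') := by
  subst hω
  obtain ⟨s, rfl⟩ := hη
  obtain ⟨s', rfl⟩ := hη'
  exact (rhoEta_equivalent_translate η₀ s).symm.trans (rhoEta_equivalent_translate η₀ s')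

end Data

/-! ## The representations `ρ_θ` at fixed points -/

namespace Data

variable {n : ℕ} {D : Data n} {ε : D.Gam →* Multiplicative (ZMod 2)}

theorem fixedPoint_mem_Sig (ω : D.X0 ε) : fixedPoint ω ∈ D.Sig ε := ω.2.choose_spec.1

theorem X0_eq_zOrbit (ω : D.X0 ε) : (ω : Set (Fin n → ℝ)) = D.zOrbit (fixedPoint ω) := by
  rw [eq_singleton_fixedPoint ω]
  ext x
  simp only [zOrbit, fixedPoint_fixed, Set.range_const]

/-- Both sides are characters of `ℤ` in `l`, so `l = 1` suffices, where the two exponents differ by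
`2πim`. -/
theorem sign_gam_zero (l : ℤ) (m : ℤ) :
    Complex.exp (Real.pi * I * (2 * (m : ℂ) + ((D.epsDot ε 1).val : ℂ)) * (l : ℂ)) =
      D.sign ε (D.gam 0 l) := by
  let f : ℤ →+ Additive ℂ :=
    { toFun := fun l => Additive.ofMul
        (Complex.exp (Real.pi * I * (2 * (m : ℂ) + ((D.epsDot ε 1).val : ℂ)) * (l : ℂ)))
      map_zero' := by simp
      map_add' := fun a b => by
        rw [← ofMul_mul, ← Complex.exp_add]
        congr 2; push_cast; ring }
  let g : ℤ →+ Additive ℂ :=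
    { toFun := fun l => Additive.ofMul (D.sign ε (D.gam 0 l))
      map_zero' := by
        have : D.gam 0 0 = 1 := Subtype.ext (Grp.ext (by ext i; simp [gam]) (by simp [gam]))
        rw [this, sign_one]; rfl
      map_add' := fun a b => by rw [← gam_zero_mul, sign_mul]; rfl }
  have h : f = g := by
    refine AddMonoidHom.ext_int (congrArg Additive.ofMul ?_)
    rw [sign, Complex.exp_eq_exp_iff_exists_int]
    refine ⟨m, ?_⟩
    rw [epsDot]; push_cast; ring
  exact congrArg Additive.toMul (DFunLike.congr_fun h l)

/-- The character of `G` restricts to `e^{iπε}` on `Γ`. By multiplicativity it is therefore itself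
an element of `C(G, ε)`, on which right translation acts by scalars. -/
theorem chiVal_gam (ω : D.X0 ε) (m : ℤ) (γ : D.Gam) : chiVal ω m (γ : D.Grp) = D.sign ε γ := by
  obtain ⟨_, k, l, rfl⟩ := γ
  have hγ : (⟨Grp.mk (fun i => (k i : ℝ)) (l : ℝ), k, l, rfl⟩ : D.Gam) =
      D.gam k 0 * D.gam 0 l := by
    refine Subtype.ext (Grp.ext ?_ ?_)
    · ext i; simp [gam, A_zero]
    · simp [gam]
  rw [hγ, sign_mul, ← sign_gam_zero l m, ← mem_Sig_iff.1 (fixedPoint_mem_Sig ω) k]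
  simp [chiVal, gam, A_zero]

/-- The character `χ_{ε̇,ω,m}` as an element of `C(G, ε)`. -/
def chiFun (ω : D.X0 ε) (m : ℤ) : D.CSpace ε :=
  ⟨chiVal ω m, continuous_chiVal ω m, fun γ y => by rw [chiVal_mul, chiVal_gam]⟩

theorem chiFun_apply (ω : D.X0 ε) (m : ℤ) (y : D.Grp) : chiFun ω m y = chiVal ω m y := rfl

theorem trans_chiFun (ω : D.X0 ε) (m : ℤ) (g : D.Grp) :
    CSpace.trans g (chiFun ω m) = chiVal ω m g • chiFun ω m := by
  ext y
  rw [CSpace.trans_apply, CSpace.smul_apply, chiFun_apply, chiFun_apply, chiVal_mul, mul_comm]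

theorem norm_chiFun (ω : D.X0 ε) (m : ℤ) : ‖chiFun ω m‖ = 1 := by
  have h : ‖chiFun ω m‖ ^ 2 = 1 := by
    rw [CSpace.norm_sq]
    simp only [chiFun_apply, norm_chiVal, one_pow, integral_const, smul_eq_mul, mul_one]
    have : (volume : Measure D.Grp) D.box = 1 := by
      rw [box_eq]
      change ((volume : Measure (Fin n → ℝ)).prod (volume : Measure ℝ)) _ = 1
      rw [Measure.prod_prod, volume_pi, Measure.pi_pi]
      simp
    simp [Measure.real, this]
  exact (pow_eq_one_iff_of_nonneg (norm_nonneg _) two_ne_zero).1 h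

theorem fourier_chiFun (ω : D.X0 ε) (m : ℤ) (k : Fin n → ℤ) (t : ℝ) :
    (chiFun ω m).fourier k t = if intVec k = fixedPoint ω then
      Complex.exp (Real.pi * I * (2 * (m : ℂ) + ((D.epsDot ε 1).val : ℂ)) * (t : ℂ)) else 0 := by
  obtain ⟨κ, hκ⟩ := exists_intVec_of_mem_Sig (fixedPoint_mem_Sig ω)
  have h1 : ∀ x : Fin n → ℝ, chiFun ω m (Grp.mk ((2 : ℝ) • x) t) *
      Complex.exp (-(2 * Real.pi * I * (((fun i => (k i : ℝ)) ⬝ᵥ x : ℝ) : ℂ))) =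
      Complex.exp (Real.pi * I * (2 * (m : ℂ) + ((D.epsDot ε 1).val : ℂ)) * (t : ℂ)) *
        Complex.exp (2 * Real.pi * I * (((fun i => ((κ - k) i : ℝ)) ⬝ᵥ x : ℝ) : ℂ)) := by
    intro x
    have : (fun i => ((κ - k) i : ℝ)) ⬝ᵥ x = intVec κ ⬝ᵥ x - (fun i => (k i : ℝ)) ⬝ᵥ x := by
      rw [← sub_dotProduct]; congr 1; funext i; simp [intVec]
    rw [chiFun_apply, chiVal, Grp.vec_mk, Grp.time_mk, hκ, this, dotProduct_smul, smul_eq_mul,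
      ← Complex.exp_add, ← Complex.exp_add, ← Complex.exp_add]
    congr 1
    push_cast; ring
  rw [CSpace.fourier]
  simp only [h1]
  rw [integral_const_mul, Periodic.setIntegral_cube_exp]
  have : intVec k = fixedPoint ω ↔ κ - k = 0 := by
    rw [hκ, intVec_injective.eq_iff, sub_eq_zero, eq_comm]
  by_cases h : κ - k = 0
  · rw [if_pos h, if_pos (this.2 h), mul_one]
  · rw [if_neg h, if_neg (mt this.1 h), mul_zero]

/-- The isometric embedding of `χ_{ε̇,ω,m}` into `ρ`. -/
def chiIncl (ω : D.X0 ε) (m : ℤ) : (chi ω m).space →ₗᵢ[ℂ] (D.rho ε).space :=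
  LinearIsometry.toSpanSingleton ℂ (D.rho ε).space
    ((incl.norm_map (chiFun ω m)).trans (norm_chiFun ω m))

theorem chiIncl_apply (ω : D.X0 ε) (m : ℤ) (z : ℂ) :
    chiIncl ω m z = z • incl (chiFun ω m) := rfl

theorem chiIncl_op (ω : D.X0 ε) (m : ℤ) (g : D.Grp) (z : (chi ω m).space) :
    chiIncl ω m ((chi ω m).op g z) = (D.rho ε).op g (chiIncl ω m z) := by
  revert z
  change ∀ z : ℂ, (chiVal ω m g * z) • incl (chiFun ω m) =
    (D.rho ε).op g (z • incl (chiFun ω m))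
  intro z
  rw [map_smul, rho_op_incl, trans_chiFun, map_smul, smul_smul,
    mul_comm]

theorem chiIncl_mem_U (ω : D.X0 ε) (m : ℤ) (z : (chi ω m).space) :
    chiIncl ω m z ∈ D.U ε ω := by
  refine Submodule.smul_mem _ _ (mem_U_iff.2 fun k hk => F_incl_eq_zero fun t _ => ?_)
  rw [fourier_chiFun, if_neg]
  intro h
  rw [eq_singleton_fixedPoint ω, h] at hk
  exact hk rfl

/-- Characters attached to the same fixed point differ by a sign at some point. -/
theorem exists_chiVal_eq_neg (ω : D.X0 ε) {m m' : ℤ} (h : m ≠ m') :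
    ∃ g : D.Grp, chiVal ω m' g = -chiVal ω m g := by
  have hne : ((m' - m : ℤ) : ℂ) ≠ 0 := by
    exact_mod_cast sub_ne_zero.2 h.symm
  -- The exponents differ by `2πi(m' - m)s`, which is `πi` for this value of `s`.
  refine ⟨Grp.mk 0 (1 / (2 * ((m' - m : ℤ) : ℝ))), ?_⟩
  set g : D.Grp := Grp.mk 0 (1 / (2 * ((m' - m : ℤ) : ℝ))) with hg
  have h3 : (Real.pi * I * (2 * (m' : ℂ) + ((D.epsDot ε 1).val : ℂ)) * (g.time : ℂ)) =
      (Real.pi * I * (2 * (m : ℂ) + ((D.epsDot ε 1).val : ℂ)) * (g.time : ℂ)) + Real.pi * I := by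
    rw [hg, Grp.time_mk]
    push_cast at hne ⊢
    field_simp
    ring
  rw [chiVal, chiVal, h3, Complex.exp_add, Complex.exp_pi_mul_I]
  ring

/-- Translating both vectors by a `g` at which the two characters are opposite preserves their inner
product by unitarity, but also changes its sign. -/
theorem inner_chiIncl (ω : D.X0 ε) {m m' : ℤ} (h : m ≠ m') (z : (chi ω m).space)
    (z' : (chi ω m').space) : inner ℂ (chiIncl ω m z) (chiIncl ω m' z') = 0 := by
  revert z z'
  change ∀ z z' : ℂ, inner ℂ (z • incl (chiFun ω m)) (z' • incl (chiFun ω m')) = 0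
  intro z z'
  rw [inner_smul_left, inner_smul_right]
  suffices h : inner ℂ (incl (chiFun ω m)) (incl (chiFun ω m')) = 0 by rw [h]; simp
  obtain ⟨g, h2⟩ := exists_chiVal_eq_neg ω h
  have h1 := ((D.rho ε).op g).inner_map_map (incl (chiFun ω m)) (incl (chiFun ω m'))
  rw [rho_op_incl, rho_op_incl, trans_chiFun, trans_chiFun, map_smul, map_smul, inner_smul_left,
    inner_smul_right, ← mul_assoc] at h1
  have h3 : (starRingEnd ℂ) (chiVal ω m g) * chiVal ω m g = 1 := by
    rw [Complex.conj_mul', norm_chiVal]; simp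
  rw [h2, mul_neg, h3] at h1
  linear_combination (-1 / 2 : ℂ) * h1

/-- Multiplication by the unimodular function `e^{-πivt}` reduces the claim to completeness of the
exponentials `e^{2πimt}` on `[0,1]`. The twist `v` stands for `ε̇(1)`. -/
theorem eq_zero_of_orthogonal_exp (v : ℂ) (hv : v.im = 0)
    (f : Lp ℂ 2 (volume.restrict (Set.Icc (0 : ℝ) 1)))
    (h : ∀ m : ℤ, ∫ t in Set.Icc (0 : ℝ) 1,
      (starRingEnd ℂ) (Complex.exp (Real.pi * I * (2 * (m : ℂ) + v) * (t : ℂ))) * f t = 0) :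
    f = 0 := by
  obtain ⟨v, rfl⟩ : ∃ r : ℝ, v = r := ⟨v.re, by apply Complex.ext <;> simp [hv]⟩
  set E : ℝ → ℂ := fun t => (starRingEnd ℂ) (Complex.exp (Real.pi * I * v * (t : ℂ))) with hE
  have hEn : ∀ t, ‖E t‖ = 1 := by
    intro t
    have : (Real.pi * I * v * (t : ℂ)) = ((Real.pi * v * t : ℝ) : ℂ) * I := by push_cast; ring
    rw [hE]; dsimp only
    rw [RCLike.norm_conj, this, Complex.norm_exp_ofReal_mul_I]
  have hEc : Continuous E := Complex.continuous_conj.comp (by fun_prop)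
  have hm : MemLp (fun t => E t * f t) 2 (volume.restrict (Set.Ioc (0 : ℝ) 1)) := by
    rw [restrict_Ioc_eq_restrict_Icc]
    exact (Lp.memLp f).congr_norm (hEc.aestronglyMeasurable.mul (Lp.aestronglyMeasurable f))
      (Filter.Eventually.of_forall fun t => by rw [norm_mul, hEn, one_mul])
  have h1 := hasSum_sq_fourierCoeffOn (zero_lt_one' ℝ) hm
  have h2 : ∀ m : ℤ, fourierCoeffOn (zero_lt_one' ℝ) (fun t => E t * f t) m = 0 := by
    intro m
    rw [fourierCoeffOn_eq_integral, intervalIntegral.integral_of_le zero_le_one,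
      restrict_Ioc_eq_restrict_Icc]
    refine smul_eq_zero_of_right _ ?_
    rw [← h m]
    congr 1; ext t
    rw [smul_eq_mul, ← mul_assoc, fourier_neg, ← map_mul]
    congr 2
    rw [fourier_coe_apply, ← Complex.exp_add]
    congr 1
    push_cast; ring
  simp only [h2, norm_zero, ne_eq, OfNat.ofNat_ne_zero, not_false_eq_true, zero_pow] at h1
  have h3 := h1.unique hasSum_zero
  rw [intervalIntegral.integral_of_le zero_le_one, sub_zero, inv_one, one_smul,
    integral_eq_zero_iff_of_nonneg (fun t => by positivity)
      ((memLp_two_iff_integrable_sq_norm hm.1).1 hm), restrict_Ioc_eq_restrict_Icc] at h3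
  refine (Lp.eq_zero_iff_ae_eq_zero).2 ?_
  filter_upwards [h3] with t ht
  have h4 : ‖E t * f t‖ ^ 2 = 0 := ht
  rw [norm_mul, hEn, one_mul] at h4
  simpa using h4

/-- A vector of `U_ω` has only one possibly nonzero coefficient, at the fixed point. Its inner
products with the characters are, by Parseval, the twisted Fourier coefficients of that function on
`[0,1]`. -/
theorem eq_zero_of_orthogonal_chiIncl (ω : D.X0 ε) (φ : (D.rho ε).space) (hφ : φ ∈ D.U ε ω)
    (h : ∀ m (z : (chi ω m).space), inner ℂ (chiIncl ω m z) φ = 0) : φ = 0 := by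
  refine eq_zero_of_F_eq_zero (D := D) (ε := ε) φ fun k => ?_
  by_cases hk : intVec k = fixedPoint ω
  · refine eq_zero_of_orthogonal_exp ((D.epsDot ε 1).val : ℂ) (Complex.natCast_im _) _ fun m => ?_
    have h1 : HasSum (fun k : Fin n → ℤ => inner ℂ (D.F ε k (incl (chiFun ω m))) (D.F ε k φ))
      (inner ℂ (incl (chiFun ω m)) φ) := hasSum_inner_F (D := D) (ε := ε) _ φ
    have h0 := h m (1 : ℂ)
    rw [chiIncl_apply, one_smul] at h0
    rw [h0] at h1
    have h2 := h1.unique (hasSum_single k fun k' hk' => by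
      rw [F_incl_eq_zero, inner_zero_left]
      intro t ht
      rw [fourier_chiFun, if_neg]
      rw [← hk, intVec_injective.eq_iff]
      exact hk')
    rw [L2.inner_def] at h2
    refine (integral_congr_ae ?_).trans h2.symm
    filter_upwards [F_incl_ae k (chiFun ω m)] with t ht
    rw [ht, fourier_chiFun, if_pos hk]
    change _ = D.F ε k φ t * (starRingEnd ℂ) _
    rw [mul_comm]
  · refine mem_U_iff.1 hφ k fun h => hk ?_
    rw [eq_singleton_fixedPoint ω] at h
    exact h

/-- At a fixed point, `ρ_θ` is the direct sum of the characters `χ_{ε̇,θ,m}`. -/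
theorem rhoTheta_equivalent_directSum_chi (ω : D.X0 ε)
    (hinv : ∀ (g : D.Grp), ∀ φ ∈ D.U ε ω, (D.rho ε).op g φ ∈ D.U ε ω) :
    (D.rhoTheta ε ω hinv).Equivalent (UnitaryRep.directSum fun m : ℤ => chi ω m) := by
  let V : ∀ m : ℤ, (chi ω m).space →ₗᵢ[ℂ] (D.rhoTheta ε ω hinv).space := fun m =>
    (⟨(chiIncl ω m).toLinearMap.codRestrict (D.U ε ω) (chiIncl_mem_U ω m),
      fun z => (chiIncl ω m).norm_map z⟩ : (chi ω m).space →ₗᵢ[ℂ] D.U ε ω)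
  refine UnitaryRep.equivalent_directSum (fun m : ℤ => chi ω m) V (IsHilbertSum.mk ?_ ?_) ?_
  · intro m m' hne z z'
    exact inner_chiIncl ω hne z z'
  · rw [top_le_iff, Submodule.topologicalClosure_eq_top_iff, Submodule.eq_bot_iff]
    intro φ hφ
    refine Subtype.ext (eq_zero_of_orthogonal_chiIncl ω (φ : D.U ε ω).1 (φ : D.U ε ω).2
      fun m z => ?_)
    exact (Submodule.mem_orthogonal _ _).1 hφ _ (Submodule.mem_iSup_of_mem m ⟨z, rfl⟩)
  · intro m g z
    exact Subtype.ext (chiIncl_op ω m g z)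

end Data

/-! ## Orbits -/

namespace Data

variable {n : ℕ} {D : Data n} {ε : D.Gam →* Multiplicative (ZMod 2)}

/-! ### Consequences of exponentiality: fixed points and trivial stabilisers. -/

/-- If `G` is exponential, then a point which is fixed by some `A(s)ᵀ`, `s ≠ 0`, is fixed by the
whole one-parameter group. -/
theorem IsExponential.fixed (hD : D.IsExponential) {s : ℝ} (hs : s ≠ 0) {ξ : Fin n → ℝ}
    (h : (D.A s)ᵀ *ᵥ ξ = ξ) (t : ℝ) : (D.A t)ᵀ *ᵥ ξ = ξ := by
  obtain ⟨L, -, hR, -, -⟩ := hD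
  -- It suffices to show that `⟨ξ, A(t)w⟩` is independent of `t` for every `w`. Surjectivity of the
  -- exponential map supplies `X` with `exp X = (w, s)`, that is, `w = ∫₀¹ A(rs)X₁ dr`.
  refine dotProduct_eq _ _ fun w => ?_
  rw [transpose_mulVec_dotProduct]
  set X := L (Grp.mk w s)
  have hX : D.expMap X = Grp.mk w s := hR _
  have hX2 : X.2 = s := congrArg Grp.time hX
  have hX1 : ∫ r in (0 : ℝ)..1, D.A (r * s) *ᵥ X.1 = w := by
    rw [← hX2]; exact congrArg Grp.vec hX
  set c : ℝ → ℝ := fun u => ξ ⬝ᵥ (D.A u *ᵥ X.1)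
  have hper : Function.Periodic c s := by
    intro u
    change ξ ⬝ᵥ (D.A (u + s) *ᵥ X.1) = ξ ⬝ᵥ (D.A u *ᵥ X.1)
    rw [add_comm, A_add, ← mulVec_mulVec, ← transpose_mulVec_dotProduct, h]
  -- Applying `⟨ξ, A(u)·⟩` to the integral for `w` and substituting `u + sr` gives the mean of `c`
  -- over an interval of length `s`. As `c` has period `s`, this mean does not depend on `u`.
  have key : ∀ u, ξ ⬝ᵥ (D.A u *ᵥ w) = s⁻¹ * ∫ r in u..u + s, c r := by
    intro u
    have hc := D.continuous_A_mulVec s X.1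
    let ℓ : (Fin n → ℝ) →L[ℝ] ℝ := LinearMap.toContinuousLinearMap
      { toFun := fun y => ξ ⬝ᵥ (D.A u *ᵥ y)
        map_add' := fun y z => by rw [mulVec_add, dotProduct_add]
        map_smul' := fun a y => by rw [mulVec_smul, dotProduct_smul]; rfl }
    have h1 := ℓ.intervalIntegral_comp_comm (hc.intervalIntegrable (μ := volume) 0 1)
    rw [hX1] at h1
    have h2 := intervalIntegral.integral_comp_add_mul (a := 0) (b := 1) c hs u
    rw [mul_zero, mul_one, add_zero, smul_eq_mul] at h2
    rw [← h2]
    refine h1.symm.trans ?_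
    congr 1; ext r
    change ξ ⬝ᵥ (D.A u *ᵥ (D.A (r * s) *ᵥ X.1)) = ξ ⬝ᵥ (D.A (u + s * r) *ᵥ X.1)
    rw [mulVec_mulVec, ← A_add, mul_comm s r]
  have h0 := key 0
  rw [A_zero, one_mulVec] at h0
  rw [key, h0, hper.intervalIntegral_add_eq t 0]

/-- Orbits which are not reduced to a point have trivial stabilisers. -/
theorem IsExponential.injective (hD : D.IsExponential) {ξ : Fin n → ℝ}
    (h : ¬ ∀ t, (D.A t)ᵀ *ᵥ ξ = ξ) : Function.Injective fun t : ℝ => (D.A t)ᵀ *ᵥ ξ := by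
  intro s t hst
  by_contra hne
  refine h (hD.fixed (sub_ne_zero.2 hne) ?_)
  have h1 : (D.A s)ᵀ *ᵥ ξ = (D.A t)ᵀ *ᵥ ξ := hst
  rw [sub_eq_neg_add, A_transpose_add, h1, ← A_transpose_add, neg_add_cancel, A_transpose_zero]

theorem injective_int {ξ : Fin n → ℝ} (h : Function.Injective fun t : ℝ => (D.A t)ᵀ *ᵥ ξ) :
    Function.Injective fun l : ℤ => (D.A l)ᵀ *ᵥ ξ := fun _ _ hlm =>
  Int.cast_injective (h hlm)

theorem finite_intVec_mem {K : Set (Fin n → ℝ)} (hK : Bornology.IsBounded K) :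
    {k : Fin n → ℤ | intVec k ∈ K}.Finite := by
  obtain ⟨R, hR⟩ := hK.subset_closedBall 0
  refine (Set.finite_Icc (fun _ : Fin n => -⌈R⌉) (fun _ => ⌈R⌉)).subset fun k hk => ?_
  have h1 := hR hk
  rw [mem_closedBall_zero_iff] at h1
  have h2 : ∀ i, |(k i : ℝ)| ≤ R := fun i => (norm_le_pi_norm (intVec k) i).trans h1
  constructor <;> intro i
  · have : ((-⌈R⌉ : ℤ) : ℝ) ≤ k i := by
      push_cast
      linarith [(abs_le.1 (h2 i)).1, Int.le_ceil R]
    exact_mod_cast this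
  · have : (k i : ℝ) ≤ (⌈R⌉ : ℤ) := (abs_le.1 (h2 i)).2.trans (Int.le_ceil R)
    exact_mod_cast this

/-- A point of `Σ_{ε'}` with a relatively compact orbit is fixed. -/
theorem IsExponential.fixed_of_isCompact (hD : D.IsExponential) {ξ : Fin n → ℝ}
    (hξ : ξ ∈ D.Sig ε) (hc : IsCompact (closure (D.rOrbit ξ))) (t : ℝ) : (D.A t)ᵀ *ᵥ ξ = ξ := by
  by_contra hne
  have hinj := injective_int (hD.injective (ξ := ξ) fun h => hne (h t))
  have hfin := finite_intVec_mem (hc.isBounded.subset subset_closure)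
  -- If the point were not fixed, its `ℤ`-orbit would be infinite; but it consists of integral
  -- points of the bounded `ℝ`-orbit.
  have h1 : Set.range (fun l : ℤ => (D.A l)ᵀ *ᵥ ξ) ⊆
      intVec '' {k : Fin n → ℤ | intVec k ∈ D.rOrbit ξ} := by
    rintro _ ⟨l, rfl⟩
    obtain ⟨k, hk⟩ := exists_intVec_of_mem_Sig (transpose_mulVec_mem_Sig hξ l)
    exact ⟨k, ⟨l, hk⟩, hk.symm⟩
  exact Set.infinite_range_of_injective hinj ((hfin.image _).subset h1)

theorem rOrbit_eq_of_mem {ξ η : Fin n → ℝ} (h : η ∈ D.rOrbit ξ) : D.rOrbit η = D.rOrbit ξ := by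
  obtain ⟨s, rfl⟩ := h
  refine Set.Subset.antisymm ?_ ?_
  · rintro _ ⟨t, rfl⟩
    exact ⟨t + s, A_transpose_add D t s ξ⟩
  · rintro _ ⟨t, rfl⟩
    refine ⟨t - s, ?_⟩
    dsimp only
    rw [← A_transpose_add, sub_add_cancel]

theorem mem_rOrbit_self (D : Data n) (ξ : Fin n → ℝ) : ξ ∈ D.rOrbit ξ :=
  ⟨0, A_transpose_zero D ξ⟩

theorem zOrbit_subset_rOrbit (ξ : Fin n → ℝ) : D.zOrbit ξ ⊆ D.rOrbit ξ := by
  rintro _ ⟨l, rfl⟩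
  exact ⟨l, rfl⟩

theorem XInf_eq_rOrbit (ω : D.XInf ε) {η : Fin n → ℝ} (hη : η ∈ (ω : Set (Fin n → ℝ))) :
    (ω : Set (Fin n → ℝ)) = D.rOrbit η := by
  obtain ⟨η₀, hη₀⟩ := ω.2.1
  rw [hη₀] at hη ⊢
  exact (rOrbit_eq_of_mem hη).symm

theorem not_fixed_of_mem_XInf (ω : D.XInf ε) {η : Fin n → ℝ} (hη : η ∈ (ω : Set (Fin n → ℝ))) :
    ¬ ∀ t, (D.A t)ᵀ *ᵥ η = η := by
  intro h
  refine ω.2.2.2 ?_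
  rw [XInf_eq_rOrbit ω hη]
  have : D.rOrbit η = {η} := by
    simp only [rOrbit, h, Set.range_const]
  rw [this, closure_singleton]
  exact isCompact_singleton

/-- This is the dichotomy for points of `Σ_{ε'}`: those which are not fixed lie on orbits that are
not relatively compact. It makes the two sums in the decomposition of `ρ` exhaustive. -/
theorem IsExponential.rOrbit_mem_XInf (hD : D.IsExponential) {ξ : Fin n → ℝ} (hξ : ξ ∈ D.Sig ε)
    (h : ¬ ∀ t, (D.A t)ᵀ *ᵥ ξ = ξ) : D.rOrbit ξ ∈ D.XInf ε :=
  ⟨⟨ξ, rfl⟩, ⟨ξ, mem_rOrbit_self D ξ, hξ⟩, fun hc => h (hD.fixed_of_isCompact hξ hc)⟩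

/-- The multiplicities are finite. -/
theorem finite_zOrbitsIn (ω : D.XInf ε) :
    (D.zOrbitsIn ((ω : Set (Fin n → ℝ)) ∩ D.Sig ε)).Finite := by
  obtain ⟨η, hη⟩ := ω.2.1
  -- Removing the integral part of the time parameter moves any `ℤ`-orbit in question to a point of
  -- this compact arc, which contains finitely many integral points.
  have hK : IsCompact ((fun t : ℝ => (D.A t)ᵀ *ᵥ η) '' Set.Icc 0 1) :=
    isCompact_Icc.image (D.continuous_A.matrix_transpose.matrix_mulVec continuous_const)
  refine ((finite_intVec_mem hK.isBounded).image fun k => D.zOrbit (intVec k)).subset ?_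
  rintro θ ⟨⟨ζ, rfl⟩, hζ⟩
  have h1 := hζ (mem_zOrbit_self D ζ)
  obtain ⟨t, ht⟩ : ζ ∈ D.rOrbit η := hη ▸ h1.1
  have h2 : (D.A (-⌊t⌋ : ℤ))ᵀ *ᵥ ζ = (D.A (Int.fract t))ᵀ *ᵥ η := by
    have ht' : (D.A t)ᵀ *ᵥ η = ζ := ht
    rw [← ht', ← A_transpose_add]
    congr 3
    push_cast
    rw [Int.fract]; ring
  obtain ⟨k, hk⟩ := exists_intVec_of_mem_Sig (transpose_mulVec_mem_Sig h1.2 (-⌊t⌋))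
  refine ⟨k, ⟨Int.fract t, ⟨Int.fract_nonneg t, (Int.fract_lt_one t).le⟩, ?_⟩, ?_⟩
  · exact h2.symm.trans hk
  · dsimp only
    rw [← hk]
    exact zOrbit_eq_of_mem ⟨_, rfl⟩

end Data

/-! ## Irreducibility and inequivalence -/

namespace Data

variable {n : ℕ} {D : Data n} {ε : D.Gam →* Multiplicative (ZMod 2)}

/-! ### Uniqueness of Fourier transforms along injective curves. -/

/-- Push-forwards of finite measures along curves are determined by their Fourier transforms. -/
theorem map_eq_map_of_integral_exp {μ ν : Measure ℝ} [IsFiniteMeasure μ] [IsFiniteMeasure ν]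
    {γ γ' : ℝ → Fin n → ℝ} (hγ : Continuous γ) (hγ' : Continuous γ')
    (h : ∀ x : Fin n → ℝ, ∫ t, Complex.exp (Real.pi * I * ((γ t ⬝ᵥ x : ℝ) : ℂ)) ∂μ =
      ∫ t, Complex.exp (Real.pi * I * ((γ' t ⬝ᵥ x : ℝ) : ℂ)) ∂ν) :
    μ.map γ = ν.map γ' := by
  refine Measure.ext_of_charFunDual (funext fun L => ?_)
  -- Dividing the coordinates of the functional `L` by `π` matches the normalisation `e^{πi⟨·,x⟩}`
  -- with the characteristic function `e^{iL}`.
  set x : Fin n → ℝ := fun i => L (Pi.single i 1) / Real.pi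
  have hL : ∀ y : Fin n → ℝ, ((L y : ℝ) : ℂ) * I = Real.pi * I * ((y ⬝ᵥ x : ℝ) : ℂ) := by
    intro y
    have h1 : L y = Real.pi * (y ⬝ᵥ x) := by
      have h2 : y = ∑ i, y i • (Pi.single i 1 : Fin n → ℝ) := by
        ext j; simp [Finset.sum_apply, Pi.single_apply]
      conv_lhs => rw [h2]
      rw [map_sum, dotProduct, Finset.mul_sum]
      refine Finset.sum_congr rfl fun i _ => ?_
      rw [map_smul, smul_eq_mul]
      simp only [x]
      field_simp
    rw [h1]; push_cast; ring
  have hc : Continuous fun y : Fin n → ℝ => Complex.exp ((L y : ℝ) * I) := by fun_prop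
  rw [charFunDual_apply, charFunDual_apply,
    integral_map hγ.aemeasurable hc.aestronglyMeasurable,
    integral_map hγ'.aemeasurable hc.aestronglyMeasurable]
  simp only [hL]
  exact h x

theorem norm_exp_pi_I_mul (r : ℝ) : ‖Complex.exp (Real.pi * I * (r : ℂ))‖ = 1 := by
  have : Real.pi * I * (r : ℂ) = ((Real.pi * r : ℝ) : ℂ) * I := by push_cast; ring
  rw [this, Complex.norm_exp_ofReal_mul_I]

theorem integrable_mul_exp {γ : ℝ → Fin n → ℝ} (hγ : Continuous γ) {f : ℝ → ℂ}
    (hf : Integrable f) (x : Fin n → ℝ) :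
    Integrable fun t => f t * Complex.exp (Real.pi * I * ((γ t ⬝ᵥ x : ℝ) : ℂ)) := by
  have hc : Continuous fun t => Complex.exp (Real.pi * I * ((γ t ⬝ᵥ x : ℝ) : ℂ)) := by
    have : Continuous fun t => γ t ⬝ᵥ x := hγ.dotProduct continuous_const
    fun_prop
  exact hf.mul_bdd (c := 1) hc.aestronglyMeasurable
    (Filter.Eventually.of_forall fun t => (norm_exp_pi_I_mul _).le)

/-- The finite measures with densities `f⁺` and `f⁻` have push-forwards with the same Fourier
transform, hence the same push-forwards. An injective continuous curve is a Borel embedding, so the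
measures agree on the line and `f⁺ = f⁻` almost everywhere. -/
theorem ae_eq_zero_of_integral_exp_real {γ : ℝ → Fin n → ℝ} (hγ : Continuous γ)
    (hinj : Function.Injective γ) {f : ℝ → ℝ} (hf : Integrable f)
    (h : ∀ x : Fin n → ℝ, ∫ t, (f t : ℂ) * Complex.exp (Real.pi * I * ((γ t ⬝ᵥ x : ℝ) : ℂ)) = 0) :
    f =ᵐ[volume] 0 := by
  have hp : AEMeasurable (fun t => ENNReal.ofReal (f t)) := hf.1.aemeasurable.ennreal_ofReal
  have hn : AEMeasurable (fun t => ENNReal.ofReal (-f t)) := hf.1.aemeasurable.neg.ennreal_ofReal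
  have hfp : IsFiniteMeasure (volume.withDensity fun t => ENNReal.ofReal (f t)) :=
    isFiniteMeasure_withDensity_ofReal hf.2
  have hfn : IsFiniteMeasure (volume.withDensity fun t => ENNReal.ofReal (-f t)) :=
    isFiniteMeasure_withDensity_ofReal hf.neg.2
  have h1 := map_eq_map_of_integral_exp
    (μ := volume.withDensity fun t => ENNReal.ofReal (f t))
    (ν := volume.withDensity fun t => ENNReal.ofReal (-f t)) hγ hγ fun x => by
      rw [integral_withDensity_eq_integral_toReal_smul₀ hp
          (Filter.Eventually.of_forall fun _ => ENNReal.ofReal_lt_top),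
        integral_withDensity_eq_integral_toReal_smul₀ hn
          (Filter.Eventually.of_forall fun _ => ENNReal.ofReal_lt_top), ← sub_eq_zero,
        ← integral_sub, ← h x]
      · refine integral_congr_ae (Filter.Eventually.of_forall fun t => ?_)
        simp only [ENNReal.toReal_ofReal', Complex.real_smul]
        rw [← sub_mul]
        congr 1
        rw [← Complex.ofReal_sub, max_zero_sub_max_neg_zero_eq_self]
      · simp only [ENNReal.toReal_ofReal', Complex.real_smul]
        exact integrable_mul_exp hγ (f := fun t => ((max (f t) 0 : ℝ) : ℂ)) hf.pos_part.ofReal x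
      · simp only [ENNReal.toReal_ofReal', Complex.real_smul]
        exact integrable_mul_exp hγ (f := fun t => ((max (-f t) 0 : ℝ) : ℂ)) hf.neg_part.ofReal x
  have he := hγ.measurableEmbedding hinj
  have h2 := congrArg (fun μ => Measure.comap γ μ) h1
  simp only [he.comap_map] at h2
  rw [withDensity_eq_iff_of_sigmaFinite hp hn] at h2
  filter_upwards [h2] with t ht
  have h3 := congrArg ENNReal.toReal ht
  simp only [ENNReal.toReal_ofReal'] at h3
  have h4 := max_zero_sub_max_neg_zero_eq_self (f t)
  rw [h3, sub_self] at h4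
  exact h4.symm

/-- Conjugating the hypothesis at `-x` gives the same hypothesis for the conjugate of `f`, so the
real and imaginary parts can be treated separately. -/
theorem ae_eq_zero_of_integral_exp {γ : ℝ → Fin n → ℝ} (hγ : Continuous γ)
    (hinj : Function.Injective γ) {f : ℝ → ℂ} (hf : Integrable f)
    (h : ∀ x : Fin n → ℝ, ∫ t, f t * Complex.exp (Real.pi * I * ((γ t ⬝ᵥ x : ℝ) : ℂ)) = 0) :
    f =ᵐ[volume] 0 := by
  have hconj : ∀ x : Fin n → ℝ, ∫ t, (starRingEnd ℂ) (f t) *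
      Complex.exp (Real.pi * I * ((γ t ⬝ᵥ x : ℝ) : ℂ)) = 0 := by
    intro x
    have h1 := congrArg (starRingEnd ℂ) (h (-x))
    rw [← integral_conj, map_zero] at h1
    rw [← h1]
    congr 1; ext t
    rw [map_mul, ← Complex.exp_conj]
    congr 2
    simp only [dotProduct_neg, map_mul, map_neg, Complex.conj_ofReal, Complex.conj_I, Complex.ofReal_neg]
    ring
  have hfc : Integrable fun t => (starRingEnd ℂ) (f t) :=
    (LinearIsometryEquiv.integrable_comp_iff Complex.conjLIE).2 hf
  have hre := ae_eq_zero_of_integral_exp_real hγ hinj hf.re fun x => by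
    have h1 := congrArg₂ (· + ·) (h x) (hconj x)
    simp only [add_zero] at h1
    rw [← integral_add (integrable_mul_exp hγ hf x) (integrable_mul_exp hγ hfc x)] at h1
    have h2 : ∀ t, f t * Complex.exp (Real.pi * I * ((γ t ⬝ᵥ x : ℝ) : ℂ)) +
        (starRingEnd ℂ) (f t) * Complex.exp (Real.pi * I * ((γ t ⬝ᵥ x : ℝ) : ℂ)) =
        2 * (((f t).re : ℂ) * Complex.exp (Real.pi * I * ((γ t ⬝ᵥ x : ℝ) : ℂ))) := by
      intro t
      rw [← add_mul, Complex.add_conj]; push_cast; ring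
    simp only [h2, integral_const_mul] at h1
    exact (mul_eq_zero.1 h1).resolve_left two_ne_zero
  have him := ae_eq_zero_of_integral_exp_real hγ hinj hf.im fun x => by
    have h1 := congrArg₂ (· - ·) (h x) (hconj x)
    simp only [sub_zero] at h1
    rw [← integral_sub (integrable_mul_exp hγ hf x) (integrable_mul_exp hγ hfc x)] at h1
    have h2 : ∀ t, f t * Complex.exp (Real.pi * I * ((γ t ⬝ᵥ x : ℝ) : ℂ)) -
        (starRingEnd ℂ) (f t) * Complex.exp (Real.pi * I * ((γ t ⬝ᵥ x : ℝ) : ℂ)) =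
        2 * I * (((f t).im : ℂ) * Complex.exp (Real.pi * I * ((γ t ⬝ᵥ x : ℝ) : ℂ))) := by
      intro t
      rw [← sub_mul, Complex.sub_conj]; push_cast; ring
    simp only [h2, integral_const_mul] at h1
    exact (mul_eq_zero.1 h1).resolve_left (by simp)
  filter_upwards [hre, him] with t h1 h2
  exact Complex.ext h1 h2

theorem continuous_orbitMap (D : Data n) (η : Fin n → ℝ) :
    Continuous fun t : ℝ => (D.A t)ᵀ *ᵥ η :=
  D.continuous_A.matrix_transpose.matrix_mulVec continuous_const

/-! ### Irreducibility via matrix coefficients. -/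

/-- Two square integrable functions whose translates have disjoint supports. -/
theorem eq_zero_or_eq_zero_of_translates (v w : Lp ℂ 2 (volume : Measure ℝ))
    (h : ∀ s : ℝ, ∀ᵐ t, v (t + s) * (starRingEnd ℂ) (w t) = 0) : v = 0 ∨ w = 0 := by
  have hv : Measurable fun t => ‖v t‖ₑ := (Lp.stronglyMeasurable v).measurable.enorm
  have hw : Measurable fun t => ‖w t‖ₑ := (Lp.stronglyMeasurable w).measurable.enorm
  -- By Tonelli this double integral is the product of the integrals of `|v|` and `|w|` in `[0, ∞]`.
  -- No integrability is needed, since only the vanishing of a factor is used.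
  have h1 : ∫⁻ s, ∫⁻ t, ‖v (t + s)‖ₑ * ‖w t‖ₑ = 0 := by
    have : ∀ s : ℝ, ∫⁻ t, ‖v (t + s)‖ₑ * ‖w t‖ₑ = 0 := fun s => by
      rw [← lintegral_zero (μ := (volume : Measure ℝ))]
      refine lintegral_congr_ae ?_
      filter_upwards [h s] with t ht
      rcases mul_eq_zero.1 ht with h | h
      · simp [h]
      · rw [map_eq_zero] at h; simp [h]
    simp only [this, lintegral_zero]
  rw [lintegral_lintegral_swap] at h1
  · have h2 : ∀ t : ℝ, ∫⁻ s, ‖v (t + s)‖ₑ * ‖w t‖ₑ = (∫⁻ s, ‖v s‖ₑ) * ‖w t‖ₑ := by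
      intro t
      have hvt : Measurable fun s => ‖v (t + s)‖ₑ := hv.comp (measurable_const_add t)
      rw [lintegral_mul_const _ hvt,
        lintegral_add_left_eq_self fun s => ‖v s‖ₑ]
    simp only [h2] at h1
    rw [lintegral_const_mul _ hw, mul_eq_zero, lintegral_eq_zero_iff hv,
      lintegral_eq_zero_iff hw] at h1
    refine h1.imp (fun h => ?_) fun h => ?_
    all_goals
      refine (Lp.eq_zero_iff_ae_eq_zero).2 ?_
      filter_upwards [h] with t ht
      simpa using ht
  · exact ((hv.comp (measurable_snd.add measurable_fst)).mul
      (hw.comp measurable_snd)).aemeasurable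

theorem inner_etaOp (η : Fin n → ℝ) (x : Fin n → ℝ) (s : ℝ) (v w : Lp ℂ 2 (volume : Measure ℝ)) :
    inner ℂ w (etaOp η (Grp.mk x s : D.Grp) v) = ∫ t, (v (t + s) * (starRingEnd ℂ) (w t)) *
      Complex.exp (Real.pi * I * ((((D.A t)ᵀ *ᵥ η) ⬝ᵥ x : ℝ) : ℂ)) := by
  rw [L2.inner_def]
  refine integral_congr_ae ?_
  filter_upwards [etaOp_ae η (Grp.mk x s : D.Grp) v] with t ht
  rw [ht]
  change phase η (Grp.mk x s) t * v (t + s) * (starRingEnd ℂ) (w t) = _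
  rw [phase, Grp.vec_mk]
  ring

theorem integrable_translate_mul_conj (s : ℝ) (v w : Lp ℂ 2 (volume : Measure ℝ)) :
    Integrable fun t => v (t + s) * (starRingEnd ℂ) (w t) := by
  have h1 : MemLp (fun t => v (t + s)) 2 (volume : Measure ℝ) :=
    (Lp.memLp v).comp_measurePreserving (measurePreserving_add_right volume s)
  have h2 : MemLp (fun t => (starRingEnd ℂ) (w t)) 2 (volume : Measure ℝ) :=
    (Lp.memLp w).congr_norm (Complex.continuous_conj.comp_aestronglyMeasurable
      (Lp.aestronglyMeasurable w)) (Filter.Eventually.of_forall fun t => by simp)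
  exact h1.integrable_mul h2

/-- The indicator function of `[a, b]` in `L²(ℝ)`. -/
def indicatorIcc (a b : ℝ) : Lp ℂ 2 (volume : Measure ℝ) :=
  indicatorConstLp 2 (measurableSet_Icc (a := a) (b := b)) (by simp) 1

theorem indicatorIcc_ne_zero {a b : ℝ} (h : a < b) : indicatorIcc a b ≠ 0 := by
  rw [← norm_ne_zero_iff, indicatorIcc, norm_indicatorConstLp two_ne_zero ENNReal.ofNat_ne_top]
  have : (volume : Measure ℝ).real (Set.Icc a b) = b - a := by
    rw [Measure.real, Real.volume_Icc, ENNReal.toReal_ofReal (by linarith)]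
  rw [this, norm_one, one_mul]
  exact (Real.rpow_pos_of_pos (by linarith) _).ne'

/-- The representation `ρ_η` is irreducible if `η` has trivial stabiliser. -/
theorem irreducible_rhoEta (η : Fin n → ℝ)
    (hinj : Function.Injective fun t : ℝ => (D.A t)ᵀ *ᵥ η) : (D.rhoEta η).Irreducible := by
  refine ⟨⟨indicatorIcc 0 1, 0, indicatorIcc_ne_zero zero_lt_one⟩, fun W hWc hW => ?_⟩
  have hcomp : CompleteSpace W := hWc.completeSpace_coe
  by_contra! hne
  obtain ⟨v, hv, hv0⟩ := (Submodule.ne_bot_iff _).1 hne.1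
  have hW' : Wᗮ ≠ ⊥ := fun h => hne.2 (Submodule.orthogonal_eq_bot_iff.1 h)
  obtain ⟨w, hw, hw0⟩ := (Submodule.ne_bot_iff _).1 hW'
  -- For fixed `s` the matrix coefficients `⟨w, ρ_η(x, s)v⟩` vanish for all `x`, because `w` is
  -- orthogonal to the invariant subspace containing `v`. Uniqueness along the orbit makes their
  -- density vanish.
  have key : ∀ s : ℝ, ∀ᵐ t, (show Lp ℂ 2 (volume : Measure ℝ) from v) (t + s) *
      (starRingEnd ℂ) ((show Lp ℂ 2 (volume : Measure ℝ) from w) t) = 0 := by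
    intro s
    refine ae_eq_zero_of_integral_exp (continuous_orbitMap D η) hinj
      (integrable_translate_mul_conj s v w) fun x => ?_
    rw [← inner_etaOp]
    have h1 := (Submodule.mem_orthogonal' _ _).1 hw _ (hW (Grp.mk x s) v hv)
    exact h1
  rcases eq_zero_or_eq_zero_of_translates v w key with h | h
  · exact hv0 h
  · exact hw0 h

theorem isFiniteMeasure_withDensity_sq (v : Lp ℂ 2 (volume : Measure ℝ)) :
    IsFiniteMeasure (volume.withDensity fun t => ‖v t‖ₑ ^ 2) := by
  refine isFiniteMeasure_withDensity ?_
  have h := ofReal_norm_toLp_sq (Lp.memLp v)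
  rw [← h]
  exact ENNReal.ofReal_ne_top

/-- The diagonal matrix coefficient of `ρ_η` on `ℝⁿ` is the Fourier transform of the measure `|v|²
dt` carried to the orbit of `η`. Unitary equivalence preserves it, so this measure is an invariant
of the pair consisting of the representation and the vector. -/
theorem integral_withDensity_sq (η : Fin n → ℝ) (x : Fin n → ℝ)
    (v : Lp ℂ 2 (volume : Measure ℝ)) :
    ∫ t, Complex.exp (Real.pi * I * ((((D.A t)ᵀ *ᵥ η) ⬝ᵥ x : ℝ) : ℂ))
      ∂(volume.withDensity fun t => ‖v t‖ₑ ^ 2) =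
      inner ℂ v (etaOp η (Grp.mk x 0 : D.Grp) v) := by
  rw [integral_withDensity_eq_integral_toReal_smul
    ((Lp.stronglyMeasurable v).measurable.enorm.pow_const 2)
    (Filter.Eventually.of_forall fun t => by simp), inner_etaOp]
  refine integral_congr_ae (Filter.Eventually.of_forall fun t => ?_)
  simp only [add_zero, Complex.real_smul]
  congr 1
  rw [Complex.mul_conj', ENNReal.toReal_pow, toReal_enorm]
  push_cast; rfl

/-! ### Mutual inequivalence of the constituents. -/

/-- Representations attached to different orbits are inequivalent. -/
theorem not_equivalent_rhoEta {η η' : Fin n → ℝ}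
    (hinj : Function.Injective fun t : ℝ => (D.A t)ᵀ *ᵥ η)
    (hne : Disjoint (D.rOrbit η) (D.rOrbit η')) :
    ¬ (D.rhoEta η).Equivalent (D.rhoEta η') := by
  rintro ⟨T, hT⟩
  set v : Lp ℂ 2 (volume : Measure ℝ) := indicatorIcc 0 1
  set w : Lp ℂ 2 (volume : Measure ℝ) := T v
  have := isFiniteMeasure_withDensity_sq v
  have := isFiniteMeasure_withDensity_sq w
  have h1 := map_eq_map_of_integral_exp (μ := volume.withDensity fun t => ‖v t‖ₑ ^ 2)
    (ν := volume.withDensity fun t => ‖w t‖ₑ ^ 2) (continuous_orbitMap D η)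
    (continuous_orbitMap D η') fun x => by
      rw [integral_withDensity_sq, integral_withDensity_sq]
      have h2 := T.inner_map_map v ((D.rhoEta η).op (Grp.mk x 0) v)
      exact h2.symm.trans (congrArg (inner ℂ (T v)) (hT (Grp.mk x 0) v))
  -- The orbit is Borel as an injective continuous image of `ℝ`. Evaluating both push-forwards on it
  -- gives `‖v‖²` on one side and, by disjointness, `0` on the other.
  have hm : MeasurableSet (D.rOrbit η) :=
    ((continuous_orbitMap D η).measurableEmbedding hinj).measurableSet_range
  have h2 := congrArg (fun μ => μ (D.rOrbit η)) h1
  simp only [Measure.map_apply (continuous_orbitMap D η).measurable hm,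
    Measure.map_apply (continuous_orbitMap D η').measurable hm] at h2
  have h3 : (fun t : ℝ => (D.A t)ᵀ *ᵥ η) ⁻¹' D.rOrbit η = Set.univ :=
    Set.eq_univ_of_forall fun t => ⟨t, rfl⟩
  have h4 : (fun t : ℝ => (D.A t)ᵀ *ᵥ η') ⁻¹' D.rOrbit η = ∅ :=
    Set.eq_empty_of_forall_notMem fun t ht => Set.disjoint_left.1 hne ht ⟨t, rfl⟩
  rw [h3, h4, measure_empty, withDensity_apply _ MeasurableSet.univ, Measure.restrict_univ,
    lintegral_eq_zero_iff ((Lp.stronglyMeasurable v).measurable.enorm.pow_const 2)] at h2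
  refine indicatorIcc_ne_zero zero_lt_one ((Lp.eq_zero_iff_ae_eq_zero).2 ?_)
  filter_upwards [h2] with t ht
  simpa using ht

/-- Infinite-dimensional and one-dimensional representations are inequivalent. -/
theorem not_equivalent_chi_rhoEta (ω : D.X0 ε) (m : ℤ) (η : Fin n → ℝ) :
    ¬ (chi ω m).Equivalent (D.rhoEta η) := by
  intro h
  obtain ⟨T, -⟩ := h.symm
  -- `L²(ℝ)` contains two nonzero orthogonal vectors, which is impossible in the one-dimensional
  -- space `ℂ`.
  have h0 : inner ℂ (indicatorIcc 0 1) (indicatorIcc 2 3) = 0 := by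
    rw [indicatorIcc, indicatorIcc, L2.inner_indicatorConstLp_indicatorConstLp (hμs := by simp) (hμt := by simp)]
    have : Set.Icc (0 : ℝ) 1 ∩ Set.Icc 2 3 = ∅ := by
      ext t; simp only [Set.mem_inter_iff, Set.mem_Icc, Set.mem_empty_iff_false, iff_false]
      rintro ⟨h1, h2⟩; linarith [h1.2, h2.1]
    rw [this]; simp
  let S : Lp ℂ 2 (volume : Measure ℝ) ≃ₗᵢ[ℂ] ℂ := T
  have h2 : S (indicatorIcc 2 3) * (starRingEnd ℂ) (S (indicatorIcc 0 1)) = 0 :=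
    (S.inner_map_map (indicatorIcc 0 1) (indicatorIcc 2 3)).trans h0
  have h3 : ∀ a b : ℝ, a < b → S (indicatorIcc a b) ≠ 0 := fun a b hab h =>
    indicatorIcc_ne_zero hab (S.injective (h.trans (map_zero S).symm))
  rcases mul_eq_zero.1 h2 with h | h
  · exact h3 2 3 (by norm_num) h
  · exact h3 0 1 (by norm_num) ((map_eq_zero _).1 h)

theorem chiVal_eq_of_equivalent {ω ω' : D.X0 ε} {m m' : ℤ}
    (h : (chi ω m).Equivalent (chi ω' m')) (g : D.Grp) : chiVal ω m g = chiVal ω' m' g := by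
  obtain ⟨T, hT⟩ := h
  let S : ℂ ≃ₗᵢ[ℂ] ℂ := T
  have h1 : S (chiVal ω m g * 1) = chiVal ω' m' g * S 1 := hT g (1 : ℂ)
  have h2 : S (chiVal ω m g * 1) = chiVal ω m g * S 1 := S.map_smul (chiVal ω m g) 1
  have h3 : S 1 ≠ 0 := fun h => one_ne_zero (α := ℂ) (S.injective (h.trans (map_zero S).symm))
  exact mul_right_cancel₀ h3 (h2.symm.trans h1)

/-- Different characters are inequivalent. -/
theorem not_equivalent_chi {ω ω' : D.X0 ε} {m m' : ℤ} (hne : (ω, m) ≠ (ω', m')) :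
    ¬ (chi ω m).Equivalent (chi ω' m') := by
  intro h
  have hval := chiVal_eq_of_equivalent h
  have hω : ω = ω' := by
    by_contra hω
    have hξ : fixedPoint ω ≠ fixedPoint ω' := fun h => hω (Subtype.ext (by
      rw [eq_singleton_fixedPoint, eq_singleton_fixedPoint, h]))
    obtain ⟨i, hi⟩ := Function.ne_iff.1 hξ
    have hi' : fixedPoint ω i - fixedPoint ω' i ≠ 0 := sub_ne_zero.2 hi
    -- At this point `⟨ξ, x⟩` and `⟨ξ', x⟩` differ by `1`, so the two characters have opposite
    -- values.
    have h1 := hval (Grp.mk (Pi.single i (1 / (fixedPoint ω i - fixedPoint ω' i))) 0)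
    simp only [chiVal, Grp.vec_mk, Grp.time_mk, dotProduct_single, Complex.ofReal_zero, mul_zero,
      Complex.exp_zero, mul_one] at h1
    have h2 : (Real.pi * I * ((fixedPoint ω i * (1 / (fixedPoint ω i - fixedPoint ω' i)) : ℝ) : ℂ)) =
        Real.pi * I * ((fixedPoint ω' i * (1 / (fixedPoint ω i - fixedPoint ω' i)) : ℝ) : ℂ) +
          Real.pi * I := by
      have : fixedPoint ω i * (1 / (fixedPoint ω i - fixedPoint ω' i)) =
          fixedPoint ω' i * (1 / (fixedPoint ω i - fixedPoint ω' i)) + 1 := by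
        field_simp; ring
      rw [this]; push_cast; ring
    rw [h2, Complex.exp_add, Complex.exp_pi_mul_I] at h1
    have h3 := Complex.exp_ne_zero
      (Real.pi * I * ((fixedPoint ω' i * (1 / (fixedPoint ω i - fixedPoint ω' i)) : ℝ) : ℂ))
    refine h3 ?_
    linear_combination (-1 / 2 : ℂ) * h1
  subst hω
  have hm : m ≠ m' := fun h => hne (by rw [h])
  obtain ⟨g, hg⟩ := exists_chiVal_eq_neg ω hm
  have h1 := hval g
  rw [hg] at h1
  have h2 : chiVal ω m g = 0 := by linear_combination (1 / 2 : ℂ) * h1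
  have h3 := norm_chiVal ω m g
  rw [h2, norm_zero] at h3
  exact zero_ne_one h3

end Data

/-! ## The decomposition of `ρ` -/

namespace Data

variable {n : ℕ} {D : Data n} {ε : D.Gam →* Multiplicative (ZMod 2)}

theorem rho_equivalent_directSum_rhoTheta :
    (D.rho ε).Equivalent (UnitaryRep.directSum fun θ : D.zOrbitsIn (D.Sig ε) =>
      D.rhoTheta ε θ (rho_op_mem_U θ.2)) :=
  UnitaryRep.equivalent_directSum (π := D.rho ε)
    (fun θ : D.zOrbitsIn (D.Sig ε) => D.rhoTheta ε θ (rho_op_mem_U θ.2))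
    (fun θ => (D.U ε θ).subtypeₗᵢ) isHilbertSum_U fun _ _ _ => rfl

/-- The representation attached to a `ℤ`-orbit which is contained in a non-compact `ℝ`-orbit. -/
theorem IsExponential.rhoTheta_equivalent_rhoEta (hD : D.IsExponential)
    {θ : Set (Fin n → ℝ)} (hθ : θ ∈ D.zOrbitsIn (D.Sig ε)) (ω : D.XInf ε)
    (h : θ ⊆ ω) {η : Fin n → ℝ} (hη : η ∈ (ω : Set (Fin n → ℝ))) :
    (D.rhoTheta ε θ (rho_op_mem_U hθ)).Equivalent (D.rhoEta η) := by
  obtain ⟨ξ, rfl⟩ := exists_eq_zOrbit hθ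
  have hξ : (ξ : Fin n → ℝ) ∈ (ω : Set (Fin n → ℝ)) := h (mem_zOrbit_self D ξ)
  exact (Data.rhoTheta_equivalent_rhoEta ξ
    (injective_int (hD.injective (not_fixed_of_mem_XInf ω hξ))) _).trans
    (rhoEta_equivalent_of_mem (XInf_eq_rOrbit ω hξ) hξ hη)

/-- An enumeration of the `ℤ`-orbits in `ω ∩ Σ_{ε'}`. -/
def enumOrbits (ω : D.XInf ε) :
    D.zOrbitsIn ((ω : Set (Fin n → ℝ)) ∩ D.Sig ε) ≃ Fin (D.mult ε ω) :=
  have : Finite (D.zOrbitsIn ((ω : Set (Fin n → ℝ)) ∩ D.Sig ε)) := finite_zOrbitsIn ω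
  Finite.equivFinOfCardEq (Nat.card_coe_set_eq _)

/-- The `ℤ`-orbit which carries a given irreducible constituent of `ρ`. -/
def constituentOrbit :
    (D.X0 ε × ℤ) ⊕ (Σ ω : D.XInf ε, Fin (D.mult ε ω)) → D.zOrbitsIn (D.Sig ε)
  | .inl p => ⟨p.1, ⟨fixedPoint p.1, X0_eq_zOrbit p.1⟩, by
      rw [X0_eq_zOrbit p.1]; exact zOrbit_subset_Sig ⟨_, fixedPoint_mem_Sig p.1⟩⟩
  | .inr q => ⟨(enumOrbits q.1).symm q.2, ((enumOrbits q.1).symm q.2).2.1,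
      ((enumOrbits q.1).symm q.2).2.2.trans Set.inter_subset_right⟩

theorem constituentOrbit_inr_subset (q : Σ ω : D.XInf ε, Fin (D.mult ε ω)) :
    (constituentOrbit (.inr q) : Set (Fin n → ℝ)) ⊆ q.1 :=
  ((enumOrbits q.1).symm q.2).2.2.trans Set.inter_subset_left

theorem constituentOrbit_inl_ne_inr (p : D.X0 ε × ℤ) (q : Σ ω : D.XInf ε, Fin (D.mult ε ω)) :
    constituentOrbit (.inl p) ≠ constituentOrbit (.inr q) := by
  intro h
  have h1 : fixedPoint p.1 ∈ (constituentOrbit (.inl p) : Set (Fin n → ℝ)) := by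
    change fixedPoint p.1 ∈ p.1.1
    rw [eq_singleton_fixedPoint p.1]
    rfl
  rw [h] at h1
  exact not_fixed_of_mem_XInf q.1 (constituentOrbit_inr_subset q h1) (fixedPoint_fixed p.1)

theorem XInf_eq_of_mem {ω ω' : D.XInf ε} {η : Fin n → ℝ} (h : η ∈ (ω : Set (Fin n → ℝ)))
    (h' : η ∈ (ω' : Set (Fin n → ℝ))) : ω = ω' :=
  Subtype.ext ((XInf_eq_rOrbit ω h).trans (XInf_eq_rOrbit ω' h').symm)

/-- An infinite `ℤ`-orbit carries exactly one constituent. For fixed points this fails, since all `m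
∈ ℤ` share one orbit; this is why the Hilbert sum is assembled by `isHilbertSum_of_fibers`. -/
theorem constituentOrbit_inr_injective :
    Function.Injective fun q : Σ ω : D.XInf ε, Fin (D.mult ε ω) => constituentOrbit (.inr q) := by
  rintro ⟨ω, k⟩ ⟨ω', k'⟩ h
  dsimp only at h
  obtain ⟨ξ, hξ⟩ := exists_eq_zOrbit (constituentOrbit (ε := ε) (.inr ⟨ω, k⟩)).2
  have h1 : (ξ : Fin n → ℝ) ∈ (constituentOrbit (ε := ε) (.inr ⟨ω, k⟩) : Set (Fin n → ℝ)) := by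
    rw [hξ]; exact mem_zOrbit_self D ξ
  obtain rfl : ω = ω' := XInf_eq_of_mem (constituentOrbit_inr_subset _ h1)
    (constituentOrbit_inr_subset _ (h ▸ h1))
  have h2 := congrArg Subtype.val h
  have h3 : (enumOrbits ω).symm k = (enumOrbits ω).symm k' := Subtype.ext h2
  rw [(enumOrbits ω).symm.injective h3]

/-- The decomposition of `ρ` into irreducible representations. -/
theorem IsExponential.rho_equivalent_directSum (hD : D.IsExponential)
    (η : D.XInf ε → (Fin n → ℝ)) (hη : ∀ ω : D.XInf ε, η ω ∈ (ω : Set (Fin n → ℝ))) :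
    (D.rho ε).Equivalent (UnitaryRep.directSum (Sum.elim
      (fun p : D.X0 ε × ℤ => chi p.1 p.2)
      (fun q : (Σ ω : D.XInf ε, Fin (D.mult ε ω)) => D.rhoEta (η q.1)))) := by
  -- Each of the `m_{ε,ω}` orbits `θ` in `ω ∩ Σ_{ε'}` contributes one copy of `ρ_ω`, realised on the
  -- whole of `U_θ`.
  have hT : ∀ q : (Σ ω : D.XInf ε, Fin (D.mult ε ω)),
      (D.rhoEta (η q.1)).Equivalent (D.rhoTheta ε (constituentOrbit (.inr q))
        (rho_op_mem_U (constituentOrbit (ε := ε) (.inr q)).2)) := fun q =>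
    (hD.rhoTheta_equivalent_rhoEta (constituentOrbit (ε := ε) (.inr q)).2 q.1 (constituentOrbit_inr_subset q) (hη q.1)).symm
  choose T hTop using hT
  let V : ∀ i, ((Sum.elim (fun p : D.X0 ε × ℤ => chi p.1 p.2)
      (fun q : (Σ ω : D.XInf ε, Fin (D.mult ε ω)) => D.rhoEta (η q.1))) i).space →ₗᵢ[ℂ]
        (D.rho ε).space
    | .inl p => chiIncl p.1 p.2
    | .inr q => (D.U ε (constituentOrbit (.inr q))).subtypeₗᵢ.comp (T q).toLinearIsometry
  refine UnitaryRep.equivalent_directSum (π := D.rho ε) _ V (UnitaryRep.isHilbertSum_of_fibers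
    (fun θ : D.zOrbitsIn (D.Sig ε) => D.U ε θ) orthogonalFamily_U iSup_U_topologicalClosure V
    constituentOrbit ?_ ?_ ?_ fun θ => D.isClosed_U ε θ) ?_
  · rintro (p | q) v
    · exact chiIncl_mem_U p.1 p.2 v
    · exact (show D.U ε (constituentOrbit (.inr q)) from T q v).2
  · rintro (⟨ω, m⟩ | q) (⟨ω', m'⟩ | q') hne hp v w
    · have hp' := congrArg Subtype.val hp
      obtain rfl : ω = ω' := Subtype.ext hp'
      have hm : m ≠ m' := fun h => hne (h ▸ rfl)
      exact inner_chiIncl ω hm v w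
    · exact absurd hp (constituentOrbit_inl_ne_inr _ _)
    · exact absurd hp.symm (constituentOrbit_inl_ne_inr _ _)
    · exact absurd (congrArg Sum.inr (constituentOrbit_inr_injective hp)) hne
  · intro θ u hu h
    obtain ⟨ξ, hξ⟩ := exists_eq_zOrbit θ.2
    -- Totality inside `U_θ`: over a fixed point it is completeness of the characters, and over any
    -- other orbit the single isometry is onto `U_θ`, so that `u` is orthogonal to itself.
    by_cases hfix : ∀ t, (D.A t)ᵀ *ᵥ (ξ : Fin n → ℝ) = ξ
    · have hθ : (θ : Set (Fin n → ℝ)) ∈ D.X0 ε := by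
        refine ⟨ξ, ξ.2, hfix, ?_⟩
        rw [hξ]
        simp only [zOrbit, hfix, Set.range_const]
      let ω : D.X0 ε := ⟨θ, hθ⟩
      refine eq_zero_of_orthogonal_chiIncl ω u hu fun m z => ?_
      have hp : constituentOrbit (.inl (ω, m)) = θ := Subtype.ext rfl
      exact h (.inl (ω, m)) hp z
    · let ω : D.XInf ε := ⟨D.rOrbit ξ, hD.rOrbit_mem_XInf ξ.2 hfix⟩
      have hθ : (θ : Set (Fin n → ℝ)) ∈ D.zOrbitsIn ((ω : Set (Fin n → ℝ)) ∩ D.Sig ε) :=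
        ⟨θ.2.1, Set.subset_inter (hξ ▸ zOrbit_subset_rOrbit _) θ.2.2⟩
      have hq' := congrArg Subtype.val ((enumOrbits ω).symm_apply_apply ⟨θ, hθ⟩)
      have hq : constituentOrbit (.inr ⟨ω, enumOrbits ω ⟨θ, hθ⟩⟩) = θ := Subtype.ext hq'
      set q : (Σ ω : D.XInf ε, Fin (D.mult ε ω)) := ⟨ω, enumOrbits ω ⟨θ, hθ⟩⟩
      have hu' : u ∈ D.U ε (constituentOrbit (.inr q)) := by rw [hq]; exact hu
      have h1 : V (.inr q) ((T q).symm (⟨u, hu'⟩ : D.U ε (constituentOrbit (.inr q)))) = u :=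
        congrArg Subtype.val
          ((T q).apply_symm_apply (⟨u, hu'⟩ : D.U ε (constituentOrbit (.inr q))))
      have h2 := h (.inr q) hq ((T q).symm (⟨u, hu'⟩ : D.U ε (constituentOrbit (.inr q))))
      rw [h1] at h2
      exact inner_self_eq_zero.1 h2
  · rintro (p | q) g v
    · exact chiIncl_op p.1 p.2 g v
    · exact congrArg Subtype.val (hTop q g v)

/-- The irreducible constituents of `ρ` are mutually inequivalent. -/
theorem IsExponential.pairwise_not_equivalent (hD : D.IsExponential)
    (η : D.XInf ε → (Fin n → ℝ)) (hη : ∀ ω : D.XInf ε, η ω ∈ (ω : Set (Fin n → ℝ))) :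
    Pairwise fun i j : (D.X0 ε × ℤ) ⊕ D.XInf ε =>
      ¬ (Sum.elim (fun p : D.X0 ε × ℤ => chi p.1 p.2) (fun ω => D.rhoEta (η ω)) i).Equivalent
        (Sum.elim (fun p : D.X0 ε × ℤ => chi p.1 p.2) (fun ω => D.rhoEta (η ω)) j) := by
  rintro (p | ω) (p' | ω') hne
  · exact not_equivalent_chi (ω := p.1) (m := p.2) (ω' := p'.1) (m' := p'.2)
      fun h => hne (congrArg Sum.inl h)
  · exact not_equivalent_chi_rhoEta p.1 p.2 (η ω')
  · exact fun h => not_equivalent_chi_rhoEta p'.1 p'.2 (η ω) h.symm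
  · have hd : Disjoint (D.rOrbit (η ω)) (D.rOrbit (η ω')) := by
      rw [← XInf_eq_rOrbit ω (hη ω), ← XInf_eq_rOrbit ω' (hη ω')]
      exact Set.disjoint_left.2 fun ζ h h' => hne (congrArg Sum.inr (XInf_eq_of_mem h h'))
    exact not_equivalent_rhoEta (hD.injective (not_fixed_of_mem_XInf ω (hη ω))) hd

end Data

end SemidirectModel
end

theorem mainTheorem2 {n : ℕ} (D : SemidirectModel.Data n) (hD : D.IsExponential)
    (ε : D.Gam →* Multiplicative (ZMod 2)) :
    -- `L²(G, ε)` is the orthogonal sum of the subspaces `U_θ`, `θ ∈ ℤ \ Σ_{ε'}`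
    IsHilbertSum ℂ (fun θ : D.zOrbitsIn (D.Sig ε) => D.U ε θ)
      (fun θ : D.zOrbitsIn (D.Sig ε) => (D.U ε θ).subtypeₗᵢ) ∧
    -- these subspaces are invariant, and `ρ` is the orthogonal sum of the `ρ_θ`
    (∃ hinv : ∀ θ : D.zOrbitsIn (D.Sig ε), ∀ g : D.Grp, ∀ φ ∈ D.U ε θ,
        (D.rho ε).op g φ ∈ D.U ε θ,
      (D.rho ε).Equivalent
        (SemidirectModel.UnitaryRep.directSum fun θ : D.zOrbitsIn (D.Sig ε) =>
          D.rhoTheta ε θ (hinv θ)) ∧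
      -- contribution of the fixed points
      (∀ (θ : D.zOrbitsIn (D.Sig ε)) (hθ : (θ : Set (Fin n → ℝ)) ∈ D.X0 ε),
        (D.rhoTheta ε θ (hinv θ)).Equivalent
          (SemidirectModel.UnitaryRep.directSum fun m : ℤ =>
            SemidirectModel.Data.chi (⟨θ, hθ⟩ : D.X0 ε) m)) ∧
      -- contribution of the orbits which are not relatively compact
      (∀ (θ : D.zOrbitsIn (D.Sig ε)) (ω : D.XInf ε), (θ : Set (Fin n → ℝ)) ⊆ ω →
        ∀ η ∈ (ω : Set (Fin n → ℝ)), (D.rhoTheta ε θ (hinv θ)).Equivalent (D.rhoEta η))) ∧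
    -- the multiplicities are finite
    (∀ ω : D.XInf ε, (D.zOrbitsIn ((ω : Set (Fin n → ℝ)) ∩ D.Sig ε)).Finite) ∧
    -- the `ρ_ω` are irreducible
    (∀ ω : D.XInf ε, ∀ η ∈ (ω : Set (Fin n → ℝ)), (D.rhoEta η).Irreducible) ∧
    -- all points of an orbit give the same unitary equivalence class
    (∀ ω : D.XInf ε, ∀ η ∈ (ω : Set (Fin n → ℝ)), ∀ η' ∈ (ω : Set (Fin n → ℝ)),
      (D.rhoEta η).Equivalent (D.rhoEta η')) ∧
    -- for every choice of representatives `η ω ∈ ω`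
    ∀ η : D.XInf ε → (Fin n → ℝ), (∀ ω : D.XInf ε, η ω ∈ (ω : Set (Fin n → ℝ))) →
      -- the decomposition of `ρ` into irreducible representations
      (D.rho ε).Equivalent
        (SemidirectModel.UnitaryRep.directSum
          (Sum.elim
            (fun p : D.X0 ε × ℤ => SemidirectModel.Data.chi p.1 p.2)
            (fun q : (Σ ω : D.XInf ε, Fin (D.mult ε ω)) => D.rhoEta (η q.1)))) ∧
      -- mutual inequivalence
      Pairwise fun i j : (D.X0 ε × ℤ) ⊕ D.XInf ε =>
        ¬ (Sum.elim (fun p : D.X0 ε × ℤ => SemidirectModel.Data.chi p.1 p.2)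
              (fun ω : D.XInf ε => D.rhoEta (η ω)) i).Equivalent
            (Sum.elim (fun p : D.X0 ε × ℤ => SemidirectModel.Data.chi p.1 p.2)
              (fun ω : D.XInf ε => D.rhoEta (η ω)) j) := by

  open SemidirectModel.Data in
  exact ⟨isHilbertSum_U, ⟨fun θ => rho_op_mem_U θ.2, rho_equivalent_directSum_rhoTheta,
      fun θ hθ => rhoTheta_equivalent_directSum_chi (⟨θ, hθ⟩ : D.X0 ε) (rho_op_mem_U θ.2),
      fun θ ω h η hη => hD.rhoTheta_equivalent_rhoEta θ.2 ω h hη⟩,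
    finite_zOrbitsIn,
    fun ω η hη => irreducible_rhoEta η (hD.injective (not_fixed_of_mem_XInf ω hη)),
    fun ω η hη η' hη' => rhoEta_equivalent_of_mem (XInf_eq_rOrbit ω hη) hη hη',
    fun η hη => ⟨hD.rho_equivalent_directSum η hη, hD.pairwise_not_equivalent η hη⟩⟩
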